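/- Let $M$ be a smooth manifold of dimension $n$ (real dimension) with a symplectic form $\omega$, and let $\{f,g\}=\sum\omega^{\mu\nu}\,\partial_\mu f\,\partial_\nu g$, where $\sum_\nu\omega^{\mu\nu}\omega_{\nu\rho}=\delta^\mu_\rho$, be its Poisson bracket. Functions take values in $\mathbb K=\mathbb R$ or $\mathbb C$. Let $\mathcal V$ be the sheaf of $N_K=2$ SUSY vertex algebras associated to $(M,\{\,,\})$. Its stalk at $x$ is the universal $N_K=2$ SUSY vertex algebra, graded without negative conformal weights, generated by the germs at $x$ of smooth functions as even elements of weight $0$, in which $1=|0\rangle$, $fg={:}fg{:}$, $[f_\Lambda g]=\{f,g\}$ and $D_i f=\sum_l {:}h_l\,D_i g_l{:}$ whenever $df=\sum_l h_l\,dg_l$ near $x$. A section of $\mathcal V$ is a family of elements of the stalks that is given locally by a formal expression (in the $D_i$ and the products of the vertex algebra) in smooth functions. Here $D_1,D_2$ are odd derivations with $D_iD_j+D_jD_i=2\delta_{ij}\partial$, all operations on sections are those of the stalks, and, with $Y(a,Z)=\sum_{j\in\mathbb Z} z^{-1-j}\left(a_{(j|11)}+\theta^1a_{(j|01)}+\theta^2a_{(j|10)}+\theta^1\theta^2a_{(j|00)}\right)$,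 $${:}ab{:}=a_{(-1|11)}b,\qquad [a_\Lambda b]=\sum_{j\ge0}\frac{\lambda^j}{j!}\left(a_{(j|00)}b-\chi_1a_{(j|10)}b+\chi_2a_{(j|01)}b-\chi_1\chi_2a_{(j|11)}b\right),$$ a formal series in the even parameter $\lambda$ and the odd parameters $\chi_1,\chi_2$. In a chart with coordinates $x^\mu$, let $\Phi^\mu$ be the section of $\mathcal V$ given by the function $x^\mu$. Then: 1. For all smooth functions $f,g,h$ on an open set and $i=1,2$, the normally ordered product of $f$, $D_ig$, $D_ih$ does not depend on the bracketing or on the position of the factor $f$, and ${:}D_ig\,D_ih{:}=-{:}D_ih\,D_ig{:}$. Hence there are no ordering ambiguities in the expression $$\mathcal G_\omega=\tfrac12\,\omega_{\mu\nu}\left(D_1\Phi^\mu D_1\Phi^\nu+D_2\Phi^\mu D_2\Phi^\nu\right).$$ 2. This expression is a well defined section of $\mathcal V$: there is a unique global section $\mathcal G_\omega$ of $\mathcal V$ over $M$ whose restriction to the domain of every smooth chart is the expression in the coordinates of that chart. 3. $\mathcal G_\omega$ satisfies the relation of the $N=2$ superconformal algebra with central charge $c=3\dim M$: $$[{\mathcal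 G_\omega}_\Lambda\mathcal G_\omega]=\left(2\lambda+2\partial+\chi_1D_1+\chi_2D_2\right)\mathcal G_\omega+\lambda\chi_1\chi_2\,\frac c3\,|0\rangle .$$ -/

import Mathlib

set_option linter.unusedSectionVars false
set_option linter.unusedVariables false

open TopologicalSpace (Opens)
open scoped Manifold ContDiff Topology

noncomputable section

/-! ### `N = 2` SUSY vertex algebras -/

/-- The sign `(-1)^b`. -/
def koszul (b : Bool) : ℤ := if b then -1 else 1

/-- The operations of an `N_K = 2` SUSY vertex algebra: the vacuum, the two operators `D₁, D₂`
(here `D 0, D 1`) and the modes of the superfields,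
`Y(a, Z) = ∑ⱼ z^{-1-j} (a_(j|11) + θ¹ a_(j|01) + θ² a_(j|10) + θ¹θ² a_(j|00))`.
`mode j e₁ e₂ a b` is `a_(j|e₁e₂) b`, with `true` for the index `1` and `false` for `0`. -/
class N2Operations (𝕜 V : Type*) [Field 𝕜] [AddCommGroup V] [Module 𝕜 V] where
  vac : V
  D : Fin 2 → V →ₗ[𝕜] V
  mode : ℤ → Bool → Bool → V →ₗ[𝕜] V →ₗ[𝕜] V

/-- `End(V)`-valued formal distributions in `Z = (z, θ¹, θ²)`: `F s₁ s₂ j` is the coefficient of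
`(θ¹)^{s₁} (θ²)^{s₂} z^{-1-j}`. -/
abbrev Superfield (𝕜 V : Type*) [Field 𝕜] [AddCommGroup V] [Module 𝕜 V] :=
  Bool → Bool → ℤ → (V →ₗ[𝕜] V)

namespace Superfield

variable {𝕜 V : Type*} [Field 𝕜] [AddCommGroup V] [Module 𝕜 V]

/-- The odd left derivation `∂/∂θⁱ`. -/
def dTheta (i : Fin 2) (F : Superfield 𝕜 V) : Superfield 𝕜 V := fun s₁ s₂ j =>
  if i = 0 then (if s₁ then 0 else F true s₂ j)
  else (if s₂ then 0 else koszul s₁ • F s₁ true j)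

/-- Left multiplication by `θⁱ`. -/
def theta (i : Fin 2) (F : Superfield 𝕜 V) : Superfield 𝕜 V := fun s₁ s₂ j =>
  if i = 0 then (if s₁ then F false s₂ j else 0)
  else (if s₂ then koszul s₁ • F s₁ false j else 0)

/-- The derivative `∂_z`. -/
def dz (F : Superfield 𝕜 V) : Superfield 𝕜 V := fun s₁ s₂ j => (-j) • F s₁ s₂ (j - 1)

/-- The supercommutator `[D, F(Z)]` of an odd endomorphism `D` with a superfield of total parity
`p`; `D` anticommutes with the `θⁱ`, and the coefficient of `(θ¹)^{s₁}(θ²)^{s₂}` has parity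
`p + s₁ + s₂`. -/
def oddBracket (D : V →ₗ[𝕜] V) (p : Bool) (F : Superfield 𝕜 V) : Superfield 𝕜 V :=
  fun s₁ s₂ j => koszul (s₁ ^^ s₂) •
    (D ∘ₗ F s₁ s₂ j - koszul (p ^^ s₁ ^^ s₂) • (F s₁ s₂ j ∘ₗ D))

end Superfield

namespace N2Operations

variable (𝕜 : Type*) {V : Type*} [Field 𝕜] [AddCommGroup V] [Module 𝕜 V] [N2Operations 𝕜 V]

/-- The state-field correspondence `a ↦ Y(a, Z)`. -/
def field (a : V) : Superfield 𝕜 V := fun s₁ s₂ j => mode j (!s₁) (!s₂) a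

/-- The translation operator `∂ = D₁² = ½ [D₁, D₁]`. -/
def del : V →ₗ[𝕜] V := D 0 ∘ₗ D 0

/-- The normally ordered product `:ab: = a_(-1|11) b`. -/
def nord (a b : V) : V := mode (𝕜 := 𝕜) (-1) true true a b

end N2Operations

/-- Formal series in the even parameter `λ` and the odd parameters `χ₁, χ₂` with coefficients in
`V`: `P j e₁ e₂` is the coefficient of `λ^j χ₁^{e₁} χ₂^{e₂}`, written on the left. -/
abbrev LambdaSeries (V : Type*) := ℕ → Bool → Bool → V

/-- The series `λ^j χ₁^{e₁} χ₂^{e₂} v`. -/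
def LambdaSeries.monomial {V : Type*} [AddCommGroup V] (j : ℕ) (e₁ e₂ : Bool) (v : V) :
    LambdaSeries V :=
  fun j' e₁' e₂' => if j' = j ∧ e₁' = e₁ ∧ e₂' = e₂ then v else 0

/-- The `Λ`-bracket `[a_Λ b] = ∑_{j ≥ 0} (λ^j / j!)
(a_(j|00) b - χ₁ a_(j|10) b + χ₂ a_(j|01) b - χ₁ χ₂ a_(j|11) b)`. -/
def lambdaBracket (𝕜 : Type*) {V : Type*} [Field 𝕜] [AddCommGroup V] [Module 𝕜 V]
    [N2Operations 𝕜 V] (a b : V) : LambdaSeries V :=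
  fun j e₁ e₂ => (j.factorial : 𝕜)⁻¹ • koszul e₁ • N2Operations.mode (𝕜 := 𝕜) j e₁ e₂ a b

open N2Operations Superfield in
/-- `N_K = 2` SUSY vertex algebras. `par false` and `par true` are the even and the odd part. -/
class N2SUSYVertexAlgebra (𝕜 V : Type*) [Field 𝕜] [AddCommGroup V] [Module 𝕜 V]
    extends N2Operations 𝕜 V where
  par : Bool → Submodule 𝕜 V
  isCompl_par : IsCompl (par false) (par true)
  vac_mem : vac ∈ par false
  D_mem : ∀ i p, ∀ a ∈ par p, D i a ∈ par (!p)
  mode_mem : ∀ j e₁ e₂ p q, ∀ a ∈ par p, ∀ b ∈ par q, mode j e₁ e₂ a b ∈ par (p ^^ q ^^ !e₁ ^^ !e₂)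
  D_sq : D 1 ∘ₗ D 1 = D 0 ∘ₗ D 0
  D_anticomm : D 0 ∘ₗ D 1 + D 1 ∘ₗ D 0 = 0
  mode_eventually_zero : ∀ a b, ∃ N : ℤ, ∀ j ≥ N, ∀ e₁ e₂, mode j e₁ e₂ a b = 0
  D_vac : ∀ i, D i vac = 0
  vac_mode : ∀ j e₁ e₂ a, mode j e₁ e₂ vac a = if j = -1 ∧ e₁ ∧ e₂ then a else 0
  mode_vac : ∀ a, ∀ j ≥ 0, ∀ e₁ e₂, mode j e₁ e₂ a vac = 0
  mode_vac_neg_one : ∀ a, mode (-1) true true a vac = a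
  /-- Translation invariance `[Dᵢ, Y(a, Z)] = (∂/∂θⁱ - θⁱ ∂_z) Y(a, Z)`. -/
  translation : ∀ i p, ∀ a ∈ par p,
    oddBracket (D i) p (field 𝕜 a) = dTheta i (field 𝕜 a) - theta i (dz (field 𝕜 a))
  /-- Locality `(z - w)^N [Y(a, Z), Y(b, W)] = 0` for some `N`, in terms of the coefficients. -/
  locality : ∀ p q, ∀ a ∈ par p, ∀ b ∈ par q, ∃ N : ℕ, ∀ (s₁ s₂ t₁ t₂ : Bool) (m n : ℤ) (c : V),
    ∑ i ∈ Finset.range (N + 1), ((-1) ^ i * (N.choose i : ℤ)) •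
      (field 𝕜 a s₁ s₂ (m + N - i) (field 𝕜 b t₁ t₂ (n + i) c)
        - koszul ((p ^^ s₁ ^^ s₂) && (q ^^ t₁ ^^ t₂)) •
          field 𝕜 b t₁ t₂ (n + i) (field 𝕜 a s₁ s₂ (m + N - i) c)) = 0

/-! ### The `N = 2` SUSY vertex algebra of an algebra with a bracket and a differential -/

/-- Formal expressions in the generators `f ∈ A`, the operators `D₁, D₂` and the products
`s_(n) t = s_(n|11) t`. -/
inductive N2Term (A : Type*) where
  | of (f : A) : N2Term A
  | D (i : Fin 2) (t : N2Term A) : N2Term A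
  | prod (n : ℤ) (s t : N2Term A) : N2Term A

namespace N2Term

variable {A B : Type*}

/-- The functorial action of a map of generators. -/
def map (φ : A → B) : N2Term A → N2Term B
  | of f => of (φ f)
  | D i t => D i (t.map φ)
  | prod n s t => prod n (s.map φ) (t.map φ)

lemma map_map {C : Type*} (ψ : B → C) (φ : A → B) (t : N2Term A) :
    (t.map φ).map ψ = t.map fun a => ψ (φ a) := by
  induction t with
  | of f => rfl
  | D i t ih => simp [map, ih]
  | prod n s t ihs iht => simp [map, ihs, iht]

/-- Twice the conformal weight; the generators have weight `0`. -/
def weight : N2Term A → ℤ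
  | of _ => 0
  | D _ t => t.weight + 1
  | prod n s t => s.weight + t.weight - 2 * n - 2

/-- The parity; the generators are even. -/
def odd : N2Term A → Bool
  | of _ => false
  | D _ t => !t.odd
  | prod _ s t => s.odd ^^ t.odd

end N2Term

/-- The vector space spanned by the formal expressions. -/
abbrev N2Free (𝕜 A : Type*) [Field 𝕜] := N2Term A →₀ 𝕜

namespace N2Free

variable (𝕜 : Type*) {A : Type*} [Field 𝕜]

/-- The basis vector of an expression. -/
def term (t : N2Term A) : N2Free 𝕜 A := Finsupp.single t 1

/-- The linear extension of `t ↦ D i t`. -/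
def D (i : Fin 2) : N2Free 𝕜 A →ₗ[𝕜] N2Free 𝕜 A :=
  Finsupp.linearCombination 𝕜 fun t => term 𝕜 (.D i t)

/-- The bilinear extension of `s, t ↦ s_(n) t`. -/
def prod (n : ℤ) : N2Free 𝕜 A →ₗ[𝕜] N2Free 𝕜 A →ₗ[𝕜] N2Free 𝕜 A :=
  Finsupp.linearCombination 𝕜 fun s => Finsupp.linearCombination 𝕜 fun t => term 𝕜 (.prod n s t)

/-- The parity involution. -/
def inv : N2Free 𝕜 A →ₗ[𝕜] N2Free 𝕜 A :=
  Finsupp.linearCombination 𝕜 fun t => koszul t.odd • term 𝕜 t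

/-- The linear extension of `N2Term.map`. -/
def map {B : Type*} (φ : A → B) : N2Free 𝕜 A →ₗ[𝕜] N2Free 𝕜 B :=
  Finsupp.linearCombination 𝕜 fun t => term 𝕜 (t.map φ)

end N2Free

section Relations

variable {𝕜 A Ω : Type*} [Field 𝕜] [CommRing A] [Module 𝕜 A] [AddCommGroup Ω] [Module A Ω]

open N2Term N2Free in
/-- The relations that define the universal `N = 2` SUSY vertex algebra generated by `A` in
conformal weight `0`, without negative conformal weights, such that `1 = |0⟩`, `fg = :fg:`,
`[f_Λ g] = {f, g}` and `Dᵢ f = ∑ₗ :hₗ Dᵢ gₗ:` whenever `df = ∑ₗ hₗ dgₗ`. The other relations say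
that the products `s_(n) t` are those of a vertex superalgebra on which `D₁` and `D₂` act as odd
derivations with `Dᵢ Dⱼ + Dⱼ Dᵢ = 2 δᵢⱼ ∂`. -/
inductive N2Rel (br : A → A → A) (d : A → Ω) : N2Free 𝕜 A → Prop
  | add (f g : A) : N2Rel br d (term 𝕜 (of (f + g)) - term 𝕜 (of f) - term 𝕜 (of g))
  | smul (r : 𝕜) (f : A) : N2Rel br d (term 𝕜 (of (r • f)) - r • term 𝕜 (of f))
  | mul (f g : A) : N2Rel br d (term 𝕜 (of (f * g)) - term 𝕜 (prod (-1) (of f) (of g)))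
  /-- `f_(0|00) g = {f, g}`. -/
  | bracket (f g : A) :
      N2Rel br d (term 𝕜 (prod 0 (D 1 (D 0 (of f))) (of g)) - term 𝕜 (of (br f g)))
  | diff (i : Fin 2) (f : A) (k : ℕ) (h g : Fin k → A) (hd : d f = ∑ l, h l • d (g l)) :
      N2Rel br d (term 𝕜 (D i (of f)) - ∑ l, term 𝕜 (prod (-1) (of (h l)) (D i (of (g l)))))
  | weight (t : N2Term A) (ht : t.weight < 0) : N2Rel br d (term 𝕜 t)
  | D_sq (t : N2Term A) : N2Rel br d (term 𝕜 (D 1 (D 1 t)) - term 𝕜 (D 0 (D 0 t)))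
  | D_anticomm (t : N2Term A) : N2Rel br d (term 𝕜 (D 0 (D 1 t)) + term 𝕜 (D 1 (D 0 t)))
  | D_vac (i : Fin 2) : N2Rel br d (term 𝕜 (D i (of 1)))
  | D_prod (i : Fin 2) (n : ℤ) (s t : N2Term A) :
      N2Rel br d (term 𝕜 (D i (prod n s t)) - term 𝕜 (prod n (D i s) t)
        - koszul s.odd • term 𝕜 (prod n s (D i t)))
  /-- `(∂s)_(n) = -n s_(n-1)`. -/
  | del_prod (n : ℤ) (s t : N2Term A) :
      N2Rel br d (term 𝕜 (prod n (D 0 (D 0 s)) t) + n • term 𝕜 (prod (n - 1) s t))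
  | vac_prod (n : ℤ) (t : N2Term A) :
      N2Rel br d (term 𝕜 (prod n (of 1) t) - if n = -1 then term 𝕜 t else 0)
  | prod_vac (n : ℤ) (hn : 0 ≤ n) (t : N2Term A) : N2Rel br d (term 𝕜 (prod n t (of 1)))
  | prod_vac_neg_one (t : N2Term A) : N2Rel br d (term 𝕜 (prod (-1) t (of 1)) - term 𝕜 t)
  /-- The Borcherds identity
  `∑ⱼ C(m,j) (a_(n+j) b)_(m+k-j) c = ∑ⱼ (-1)ʲ C(n,j)
    (a_(m+n-j) (b_(k+j) c) - (-1)^{n+|a||b|} b_(n+k-j) (a_(m+j) c))`;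
  the terms with `j ≥ L` vanish because their weights are negative. -/
  | borcherds (m n k : ℤ) (a b c : N2Term A) (L : ℕ)
      (hab : a.weight + b.weight < 2 * (n + L) + 2)
      (hbc : b.weight + c.weight < 2 * (k + L) + 2)
      (hac : a.weight + c.weight < 2 * (m + L) + 2) :
      N2Rel br d (∑ j ∈ Finset.range L, Ring.choose m j •
          term 𝕜 (prod (m + k - j) (prod (n + j) a b) c)
        - ∑ j ∈ Finset.range L, ((-1) ^ j * Ring.choose n j) •
          (term 𝕜 (prod (m + n - j) a (prod (k + j) b c))
            - (koszul (a.odd && b.odd) * (Int.negOnePow n : ℤ)) •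
              term 𝕜 (prod (n + k - j) b (prod (m + j) a c))))

/-- The ideal generated by the relations. -/
def N2Ideal (𝕜 : Type*) {A Ω : Type*} [Field 𝕜] [CommRing A] [Module 𝕜 A] [AddCommGroup Ω]
    [Module A Ω] (br : A → A → A) (d : A → Ω) : Submodule 𝕜 (N2Free 𝕜 A) :=
  sInf {I | (∀ x, N2Rel br d x → x ∈ I) ∧ (∀ i, ∀ x ∈ I, N2Free.D 𝕜 i x ∈ I) ∧
    ∀ n, ∀ x ∈ I, ∀ y, N2Free.prod 𝕜 n x y ∈ I ∧ N2Free.prod 𝕜 n y x ∈ I}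

end Relations

/-- The `N = 2` SUSY vertex algebra generated by an algebra `A` with the bracket `br` and the
differential `d`. -/
def N2Envelope (𝕜 : Type*) {A Ω : Type*} [Field 𝕜] [CommRing A] [Module 𝕜 A] [AddCommGroup Ω]
    [Module A Ω] (br : A → A → A) (d : A → Ω) : Type _ :=
  N2Free 𝕜 A ⧸ N2Ideal 𝕜 br d

lemma koszul_xor (a b : Bool) : koszul (a ^^ b) = koszul a * koszul b := by
  cases a <;> cases b <;> simp [koszul]

lemma koszul_not (a : Bool) : koszul (!a) = - koszul a := by
  cases a <;> simp [koszul]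

lemma koszul_mul_self (a : Bool) : koszul a * koszul a = 1 := by
  cases a <;> simp [koszul]

namespace N2Free

variable {𝕜 A : Type*} [Field 𝕜]

lemma D_term (i : Fin 2) (t : N2Term A) : D 𝕜 i (term 𝕜 t) = term 𝕜 (.D i t) := by
  simp [D, term]

lemma prod_term (n : ℤ) (s t : N2Term A) :
    prod 𝕜 n (term 𝕜 s) (term 𝕜 t) = term 𝕜 (.prod n s t) := by
  simp [prod, term]

lemma inv_term (t : N2Term A) : inv 𝕜 (term 𝕜 t) = koszul t.odd • term 𝕜 t := by
  simp [inv, term]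

lemma map_term {B : Type*} (φ : A → B) (t : N2Term A) :
    map 𝕜 φ (term 𝕜 t) = term 𝕜 (t.map φ) := by
  simp [map, term]

lemma induction {P : N2Free 𝕜 A → Prop} (x : N2Free 𝕜 A) (h0 : P 0)
    (hadd : ∀ x y, P x → P y → P (x + y)) (hsmul : ∀ (r : 𝕜) x, P x → P (r • x))
    (hterm : ∀ t, P (term 𝕜 t)) : P x := by
  induction x using Finsupp.induction_linear with
  | zero => exact h0
  | add x y hx hy => exact hadd x y hx hy
  | single t r =>
    have := hsmul r _ (hterm t)
    simpa [term] using this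

lemma inv_D (i : Fin 2) (x : N2Free 𝕜 A) : inv 𝕜 (D 𝕜 i x) = - D 𝕜 i (inv 𝕜 x) := by
  induction x using induction with
  | h0 => simp
  | hadd x y hx hy => simp only [map_add, hx, hy, neg_add]
  | hsmul r x hx => simp only [map_smul, hx, smul_neg]
  | hterm t => simp [D_term, inv_term, N2Term.odd, koszul_not]

lemma inv_prod (n : ℤ) (x y : N2Free 𝕜 A) :
    inv 𝕜 (prod 𝕜 n x y) = prod 𝕜 n (inv 𝕜 x) (inv 𝕜 y) := by
  induction x using induction with
  | h0 => simp
  | hadd x x' hx hx' => simp only [map_add, LinearMap.add_apply, hx, hx']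
  | hsmul r x hx => simp only [map_smul, LinearMap.smul_apply, hx]
  | hterm s =>
    induction y using induction with
    | h0 => simp
    | hadd x y hx hy => simp only [map_add, hx, hy]
    | hsmul r x hx => simp only [map_smul, hx]
    | hterm t =>
      simp [prod_term, inv_term, N2Term.odd, koszul_xor, mul_smul]

end N2Free

section Relations

variable {𝕜 A Ω : Type*} [Field 𝕜] [CommRing A] [Module 𝕜 A] [AddCommGroup Ω] [Module A Ω]
  {br : A → A → A} {d : A → Ω}

open N2Free

lemma N2Rel.mem_ideal {x : N2Free 𝕜 A} (h : N2Rel br d x) : x ∈ N2Ideal 𝕜 br d :=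
  Submodule.mem_sInf.2 fun _ hI => hI.1 x h

lemma N2Ideal.D_mem {x : N2Free 𝕜 A} (h : x ∈ N2Ideal 𝕜 br d) (i : Fin 2) :
    D 𝕜 i x ∈ N2Ideal 𝕜 br d :=
  Submodule.mem_sInf.2 fun I hI => hI.2.1 i x (Submodule.mem_sInf.1 h I hI)

lemma N2Ideal.prod_mem {x : N2Free 𝕜 A} (h : x ∈ N2Ideal 𝕜 br d) (n : ℤ) (y : N2Free 𝕜 A) :
    prod 𝕜 n x y ∈ N2Ideal 𝕜 br d ∧ prod 𝕜 n y x ∈ N2Ideal 𝕜 br d :=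
  ⟨Submodule.mem_sInf.2 fun I hI => (hI.2.2 n x (Submodule.mem_sInf.1 h I hI) y).1,
    Submodule.mem_sInf.2 fun I hI => (hI.2.2 n x (Submodule.mem_sInf.1 h I hI) y).2⟩

lemma N2Rel.inv_eq {x : N2Free 𝕜 A} (h : N2Rel br d x) : ∃ p, inv 𝕜 x = koszul p • x := by
  cases h with
  | add f g => exact ⟨false, by simp [inv_term, N2Term.odd, koszul]⟩
  | smul r f => exact ⟨false, by simp [inv_term, N2Term.odd, koszul]⟩
  | mul f g => exact ⟨false, by simp [inv_term, N2Term.odd, koszul]⟩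
  | bracket f g => exact ⟨false, by simp [inv_term, N2Term.odd, koszul]⟩
  | diff i f k h g hd => exact ⟨true, by simp [inv_term, N2Term.odd, koszul, sub_eq_add_neg]⟩
  | weight t ht => exact ⟨t.odd, by simp [inv_term]⟩
  | D_sq t => exact ⟨t.odd, by simp [inv_term, N2Term.odd, smul_sub]⟩
  | D_anticomm t => exact ⟨t.odd, by simp [inv_term, N2Term.odd, smul_add]⟩
  | D_vac i => exact ⟨true, by simp [inv_term, N2Term.odd]⟩
  | D_prod i n s t => exact ⟨!(s.odd ^^ t.odd), by
      simp only [map_sub, map_zsmul, inv_term, N2Term.odd, koszul_not, koszul_xor]; module⟩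
  | del_prod n s t => exact ⟨s.odd ^^ t.odd, by
      simp only [map_add, map_zsmul, inv_term, N2Term.odd, Bool.not_not]; module⟩
  | vac_prod n t =>
    refine ⟨t.odd, ?_⟩
    split_ifs <;> simp [inv_term, N2Term.odd, smul_sub]
  | prod_vac n hn t => exact ⟨t.odd, by simp [inv_term, N2Term.odd]⟩
  | prod_vac_neg_one t => exact ⟨t.odd, by simp [inv_term, N2Term.odd, smul_sub]⟩
  | borcherds m n k a b c L hab hbc hac =>
    refine ⟨a.odd ^^ b.odd ^^ c.odd, ?_⟩
    simp only [map_sub, map_sum, map_zsmul, inv_term, N2Term.odd, koszul_xor, smul_sub,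
      Finset.smul_sum]
    congr 1
    · refine Finset.sum_congr rfl fun j _ => ?_
      module
    · refine Finset.sum_congr rfl fun j _ => ?_
      module

lemma N2Ideal.inv_mem {x : N2Free 𝕜 A} (h : x ∈ N2Ideal 𝕜 br d) : inv 𝕜 x ∈ N2Ideal 𝕜 br d := by
  have key : N2Ideal 𝕜 br d ≤ (N2Ideal 𝕜 br d).comap (inv 𝕜) := by
    refine sInf_le ⟨fun x hx => ?_, fun i x hx => ?_, fun n x hx y => ⟨?_, ?_⟩⟩
    · obtain ⟨p, hp⟩ := hx.inv_eq
      rw [Submodule.mem_comap, hp]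
      exact zsmul_mem hx.mem_ideal _
    · rw [Submodule.mem_comap, inv_D]
      exact neg_mem (N2Ideal.D_mem hx i)
    · rw [Submodule.mem_comap, inv_prod]
      exact (N2Ideal.prod_mem hx n _).1
    · rw [Submodule.mem_comap, inv_prod]
      exact (N2Ideal.prod_mem hx n _).2
  exact key h

end Relations

namespace N2Envelope

variable {𝕜 A Ω : Type*} [Field 𝕜] [CommRing A] [Module 𝕜 A] [AddCommGroup Ω] [Module A Ω]
  {br : A → A → A} {d : A → Ω}

instance : AddCommGroup (N2Envelope 𝕜 br d) :=
  inferInstanceAs (AddCommGroup (N2Free 𝕜 A ⧸ N2Ideal 𝕜 br d))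

instance : Module 𝕜 (N2Envelope 𝕜 br d) :=
  inferInstanceAs (Module 𝕜 (N2Free 𝕜 A ⧸ N2Ideal 𝕜 br d))

variable (𝕜 br d) in
/-- The class of a combination of formal expressions. -/
def mk : N2Free 𝕜 A →ₗ[𝕜] N2Envelope 𝕜 br d := (N2Ideal 𝕜 br d).mkQ

/-- The image of a generator. -/
def of (f : A) : N2Envelope 𝕜 br d := mk 𝕜 br d (N2Free.term 𝕜 (.of f))

/-- The operator `D i`. -/
def D (i : Fin 2) : N2Envelope 𝕜 br d →ₗ[𝕜] N2Envelope 𝕜 br d :=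
  Submodule.mapQ _ _ (N2Free.D 𝕜 i) fun _ h => N2Ideal.D_mem h i

/-- The parity involution. -/
def inv : N2Envelope 𝕜 br d →ₗ[𝕜] N2Envelope 𝕜 br d :=
  Submodule.mapQ _ _ (N2Free.inv 𝕜) fun _ h => N2Ideal.inv_mem h

/-- The product `a_(n) b = a_(n|11) b`. -/
def prod (n : ℤ) : N2Envelope 𝕜 br d →ₗ[𝕜] N2Envelope 𝕜 br d →ₗ[𝕜] N2Envelope 𝕜 br d :=
  Submodule.liftQ (N2Ideal 𝕜 br d)
    (LinearMap.flip <| Submodule.liftQ (N2Ideal 𝕜 br d)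
      (LinearMap.flip <| (N2Free.prod 𝕜 n).compr₂ (mk 𝕜 br d))
      fun y hy => by
        refine LinearMap.ext fun x => ?_
        exact (Submodule.Quotient.mk_eq_zero _).2 (N2Ideal.prod_mem hy n _).2)
    fun x hx => by
      refine LinearMap.ext fun y => ?_
      obtain ⟨y, rfl⟩ := Submodule.Quotient.mk_surjective _ y
      exact (Submodule.Quotient.mk_eq_zero _).2 (N2Ideal.prod_mem hx n y).1

/-- The modes `a_(n|11) = a_(n)`, `a_(n|01) = (D₁ a)_(n)`, `a_(n|10) = (D₂ a)_(n)` and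
`a_(n|00) = (D₂ D₁ a)_(n)`. -/
instance : N2Operations 𝕜 (N2Envelope 𝕜 br d) where
  vac := of 1
  D := D
  mode n e₁ e₂ := prod n ∘ₗ (if e₂ then .id else D 1) ∘ₗ (if e₁ then .id else D 0)

lemma D_mk (i : Fin 2) (x : N2Free 𝕜 A) : D i (mk 𝕜 br d x) = mk 𝕜 br d (N2Free.D 𝕜 i x) := rfl

lemma inv_mk (x : N2Free 𝕜 A) : inv (mk 𝕜 br d x) = mk 𝕜 br d (N2Free.inv 𝕜 x) := rfl

lemma prod_mk (n : ℤ) (x y : N2Free 𝕜 A) :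
    prod n (mk 𝕜 br d x) (mk 𝕜 br d y) = mk 𝕜 br d (N2Free.prod 𝕜 n x y) := rfl

variable (𝕜 br d) in
/-- The class of a formal expression. -/
def cls (t : N2Term A) : N2Envelope 𝕜 br d := mk 𝕜 br d (N2Free.term 𝕜 t)

lemma D_cls (i : Fin 2) (t : N2Term A) : D i (cls 𝕜 br d t) = cls 𝕜 br d (.D i t) := by
  rw [cls, D_mk, N2Free.D_term, cls]

lemma inv_cls (t : N2Term A) : inv (cls 𝕜 br d t) = koszul t.odd • cls 𝕜 br d t := by
  rw [cls, inv_mk, N2Free.inv_term, map_zsmul]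

lemma prod_cls (n : ℤ) (s t : N2Term A) :
    prod n (cls 𝕜 br d s) (cls 𝕜 br d t) = cls 𝕜 br d (.prod n s t) := by
  rw [cls, cls, prod_mk, N2Free.prod_term, cls]

lemma mk_rel {x : N2Free 𝕜 A} (h : N2Rel br d x) : mk 𝕜 br d x = 0 :=
  (Submodule.Quotient.mk_eq_zero _).2 h.mem_ideal

lemma induction {P : N2Envelope 𝕜 br d → Prop} (a : N2Envelope 𝕜 br d) (h0 : P 0)
    (hadd : ∀ a b, P a → P b → P (a + b)) (hsmul : ∀ (r : 𝕜) a, P a → P (r • a))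
    (hcls : ∀ t, P (cls 𝕜 br d t)) : P a := by
  obtain ⟨x, rfl⟩ := Submodule.Quotient.mk_surjective _ a
  induction x using N2Free.induction with
  | h0 => exact h0
  | hadd x y hx hy => exact hadd _ _ hx hy
  | hsmul r x hx => exact hsmul r _ hx
  | hterm t => exact hcls t

lemma inv_inv (a : N2Envelope 𝕜 br d) : inv (inv a) = a := by
  induction a using induction with
  | h0 => simp
  | hadd a b ha hb => simp only [map_add, ha, hb]
  | hsmul r a ha => simp only [map_smul, ha]
  | hcls t => rw [inv_cls, map_zsmul, inv_cls, smul_smul, koszul_mul_self, one_smul]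

lemma inv_D (i : Fin 2) (a : N2Envelope 𝕜 br d) : inv (D i a) = - D i (inv a) := by
  obtain ⟨x, rfl⟩ := Submodule.Quotient.mk_surjective _ a
  exact congrArg (mk 𝕜 br d) (N2Free.inv_D i x)

lemma inv_prod (n : ℤ) (a b : N2Envelope 𝕜 br d) :
    inv (prod n a b) = prod n (inv a) (inv b) := by
  obtain ⟨x, rfl⟩ := Submodule.Quotient.mk_surjective _ a
  obtain ⟨y, rfl⟩ := Submodule.Quotient.mk_surjective _ b
  exact congrArg (mk 𝕜 br d) (N2Free.inv_prod n x y)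

lemma D_sq (a : N2Envelope 𝕜 br d) : D 1 (D 1 a) = D 0 (D 0 a) := by
  induction a using induction with
  | h0 => simp
  | hadd a b ha hb => simp only [map_add, ha, hb]
  | hsmul r a ha => simp only [map_smul, ha]
  | hcls t =>
    have := mk_rel (N2Rel.D_sq (𝕜 := 𝕜) (br := br) (d := d) t)
    rw [map_sub, sub_eq_zero] at this
    simp only [D_cls]
    exact this

lemma D_anticomm (a : N2Envelope 𝕜 br d) : D 1 (D 0 a) = - D 0 (D 1 a) := by
  induction a using induction with
  | h0 => simp
  | hadd a b ha hb => simp only [map_add, ha, hb, neg_add]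
  | hsmul r a ha => simp only [map_smul, ha, smul_neg]
  | hcls t =>
    have := mk_rel (N2Rel.D_anticomm (𝕜 := 𝕜) (br := br) (d := d) t)
    rw [map_add] at this
    simp only [D_cls]
    exact eq_neg_of_add_eq_zero_right this

lemma D_prod (i : Fin 2) (n : ℤ) (a b : N2Envelope 𝕜 br d) :
    D i (prod n a b) = prod n (D i a) b + prod n (inv a) (D i b) := by
  induction a using induction with
  | h0 => simp
  | hadd a a' ha ha' => simp only [map_add, LinearMap.add_apply, ha, ha']; abel
  | hsmul r a ha => simp only [map_smul, LinearMap.smul_apply, ha, smul_add]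
  | hcls s =>
    induction b using induction with
    | h0 => simp
    | hadd a a' ha ha' => simp only [map_add, ha, ha']; abel
    | hsmul r a ha => simp only [map_smul, ha, smul_add]
    | hcls t =>
      have := mk_rel (N2Rel.D_prod (𝕜 := 𝕜) (br := br) (d := d) i n s t)
      rw [map_sub, map_sub, map_zsmul, sub_sub, sub_eq_zero] at this
      simp only [D_cls, inv_cls, prod_cls, map_zsmul, LinearMap.smul_apply]
      exact this

lemma del_prod (n : ℤ) (a b : N2Envelope 𝕜 br d) :
    prod n (D 0 (D 0 a)) b = (-n) • prod (n - 1) a b := by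
  induction a using induction with
  | h0 => simp
  | hadd a a' ha ha' => simp only [map_add, LinearMap.add_apply, ha, ha', smul_add]
  | hsmul r a ha => simp only [map_smul, LinearMap.smul_apply, ha, smul_comm r]
  | hcls s =>
    induction b using induction with
    | h0 => simp
    | hadd a a' ha ha' => simp only [map_add, ha, ha', smul_add]
    | hsmul r a ha => simp only [map_smul, ha, smul_comm r]
    | hcls t =>
      have := mk_rel (N2Rel.del_prod (𝕜 := 𝕜) (br := br) (d := d) n s t)
      rw [map_add, map_zsmul] at this
      simp only [D_cls, prod_cls, neg_smul]
      exact eq_neg_of_add_eq_zero_left this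

lemma vac_prod (n : ℤ) (a : N2Envelope 𝕜 br d) :
    prod n (of 1) a = if n = -1 then a else 0 := by
  induction a using induction with
  | h0 => simp
  | hadd a b ha hb => simp only [map_add, ha, hb]; split_ifs <;> simp
  | hsmul r a ha => simp only [map_smul, ha]; split_ifs <;> simp
  | hcls t =>
    have := mk_rel (N2Rel.vac_prod (𝕜 := 𝕜) (br := br) (d := d) n t)
    rw [map_sub, sub_eq_zero] at this
    refine (prod_cls n _ t).trans (this.trans ?_)
    split_ifs <;> simp [cls]

lemma prod_vac {n : ℤ} (hn : 0 ≤ n) (a : N2Envelope 𝕜 br d) : prod n a (of 1) = 0 := by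
  induction a using induction with
  | h0 => simp
  | hadd a b ha hb => simp only [map_add, LinearMap.add_apply, ha, hb, add_zero]
  | hsmul r a ha => simp only [map_smul, LinearMap.smul_apply, ha, smul_zero]
  | hcls t => exact (prod_cls n t _).trans (mk_rel (N2Rel.prod_vac n hn t))

lemma prod_vac_neg_one (a : N2Envelope 𝕜 br d) : prod (-1) a (of 1) = a := by
  induction a using induction with
  | h0 => simp
  | hadd a b ha hb => simp only [map_add, LinearMap.add_apply, ha, hb]
  | hsmul r a ha => simp only [map_smul, LinearMap.smul_apply, ha]
  | hcls t =>
    have := mk_rel (N2Rel.prod_vac_neg_one (𝕜 := 𝕜) (br := br) (d := d) t)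
    rw [map_sub, sub_eq_zero] at this
    exact (prod_cls _ t _).trans this

lemma D_vac (i : Fin 2) : D i (of 1 : N2Envelope 𝕜 br d) = 0 :=
  (D_cls i _).trans (mk_rel (N2Rel.D_vac i))

lemma cls_eq_zero {t : N2Term A} (ht : t.weight < 0) : cls 𝕜 br d t = 0 :=
  mk_rel (N2Rel.weight t ht)

lemma prod_eventually_zero (a b : N2Envelope 𝕜 br d) : ∃ N : ℤ, ∀ n ≥ N, prod n a b = 0 := by
  induction a using induction with
  | h0 => exact ⟨0, by simp⟩
  | hadd a a' ha ha' =>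
    obtain ⟨N, hN⟩ := ha
    obtain ⟨N', hN'⟩ := ha'
    refine ⟨max N N', fun n hn => ?_⟩
    rw [map_add, LinearMap.add_apply, hN n (le_trans (le_max_left _ _) hn),
      hN' n (le_trans (le_max_right _ _) hn), add_zero]
  | hsmul r a ha =>
    obtain ⟨N, hN⟩ := ha
    exact ⟨N, fun n hn => by rw [map_smul, LinearMap.smul_apply, hN n hn, smul_zero]⟩
  | hcls s =>
    induction b using induction with
    | h0 => exact ⟨0, by simp⟩
    | hadd a a' ha ha' =>
      obtain ⟨N, hN⟩ := ha
      obtain ⟨N', hN'⟩ := ha'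
      refine ⟨max N N', fun n hn => ?_⟩
      rw [map_add, hN n (le_trans (le_max_left _ _) hn),
        hN' n (le_trans (le_max_right _ _) hn), add_zero]
    | hsmul r a ha =>
      obtain ⟨N, hN⟩ := ha
      exact ⟨N, fun n hn => by rw [map_smul, hN n hn, smul_zero]⟩
    | hcls t =>
      refine ⟨max 0 (s.weight + t.weight), fun n hn => ?_⟩
      rw [prod_cls]
      refine cls_eq_zero ?_
      have h1 := le_trans (le_max_left _ _) hn
      have h2 := le_trans (le_max_right _ _) hn
      simp only [N2Term.weight]
      omega

/-- The operator `a, b ↦ (-1)^{|a||b|} b_(n) (a_(m) c)`, extended bilinearly. -/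
def swap (m n : ℤ) (c a b : N2Envelope 𝕜 br d) : N2Envelope 𝕜 br d :=
  (2 : 𝕜)⁻¹ • (prod n b (prod m a c) + prod n b (prod m (inv a) c) + prod n (inv b) (prod m a c)
    - prod n (inv b) (prod m (inv a) c))

lemma swap_eq [CharZero 𝕜] {p q : Bool} {a b : N2Envelope 𝕜 br d} (ha : inv a = koszul p • a)
    (hb : inv b = koszul q • b) (m n : ℤ) (c : N2Envelope 𝕜 br d) :
    swap m n c a b = koszul (p && q) • prod n b (prod m a c) := by
  have h2 : (2 : 𝕜) ≠ 0 := two_ne_zero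
  rw [swap, ha, hb]
  cases p <;> cases q <;> simp [koszul, ← two_smul 𝕜, smul_smul, h2]
  rw [← neg_add', ← two_smul 𝕜, smul_neg, smul_smul, inv_mul_cancel₀ h2, one_smul]

/-- The expression whose vanishing is locality of order `N`. -/
def loc (N : ℕ) (m n : ℤ) (c a b : N2Envelope 𝕜 br d) : N2Envelope 𝕜 br d :=
  ∑ i ∈ Finset.range (N + 1), ((-1) ^ i * (N.choose i : ℤ)) •
    (prod (m + N - i) a (prod (n + i) b c) - swap (m + N - i) (n + i) c a b)

lemma loc_cls [CharZero 𝕜] (s t u : N2Term A) (N : ℕ) (hN : s.weight + t.weight < 2 * N + 2)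
    (m n : ℤ) : loc N m n (cls 𝕜 br d u) (cls 𝕜 br d s) (cls 𝕜 br d t) = 0 := by
  obtain ⟨L, hL1, hL2, hL3⟩ : ∃ L : ℕ, N + 1 ≤ L ∧ t.weight + u.weight < 2 * (n + L) + 2 ∧
      s.weight + u.weight < 2 * (m + L) + 2 := by
    refine ⟨N + 1 + (t.weight + u.weight).natAbs + n.natAbs + (s.weight + u.weight).natAbs
      + m.natAbs, ?_, ?_, ?_⟩ <;> omega
  have hb := mk_rel (N2Rel.borcherds (𝕜 := 𝕜) (br := br) (d := d) m N n s t u L (by omega) hL2 hL3)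
  rw [map_sub, map_sum, map_sum, Finset.sum_eq_zero, zero_sub, neg_eq_zero] at hb
  swap
  · intro j _
    rw [map_zsmul]
    change _ • cls 𝕜 br d _ = 0
    rw [← prod_cls, cls_eq_zero (t := .prod (N + j) s t)]
    · simp
    · simp only [N2Term.weight]; omega
  rw [← Finset.sum_subset (Finset.range_subset_range.2 hL1)] at hb
  swap
  · intro j _ hj
    rw [Finset.mem_range, not_lt] at hj
    rw [Ring.choose_natCast, Nat.choose_eq_zero_of_lt (by omega)]
    simp
  simp only [map_zsmul, map_sub, Ring.choose_natCast, smul_sub, Finset.sum_sub_distrib] at hb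
  rw [loc]
  simp only [smul_sub, Finset.sum_sub_distrib]
  rw [sub_eq_zero] at hb ⊢
  refine Eq.trans ?_ (hb.trans ?_)
  · refine Finset.sum_congr rfl fun j _ => ?_
    rw [prod_cls, prod_cls]; rfl
  · rw [← Finset.sum_range_reflect]
    refine Finset.sum_congr rfl fun j hj => ?_
    rw [Finset.mem_range] at hj
    have hj' : j ≤ N := by omega
    rw [swap_eq (inv_cls s) (inv_cls t), prod_cls, prod_cls, smul_smul, smul_smul]
    have e1 : N + 1 - 1 - j = N - j := by omega
    have e2 : ((N - j : ℕ) : ℤ) = N - j := by omega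
    rw [e1, e2, Nat.choose_symm hj']
    have e3 : (N : ℤ) + n - (N - j) = n + j := by ring
    have e4 : m + ((N : ℤ) - j) = m + N - j := by ring
    rw [e3, e4]
    change _ • cls 𝕜 br d _ = _
    congr 1
    have e5 : ((Int.negOnePow (N : ℤ) : ℤˣ) : ℤ) = (-1) ^ (N - j) * (-1) ^ j := by
      rw [← pow_add, Nat.sub_add_cancel hj', Int.negOnePow_def]
      simp
    have e6 : ((-1 : ℤ) ^ (N - j)) * (-1) ^ (N - j) = 1 := by
      rw [← mul_pow]; simp
    rw [e5]
    linear_combination (koszul (s.odd && t.odd) * (N.choose j) * (-1) ^ j : ℤ) * e6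

lemma exists_loc [CharZero 𝕜] (a b : N2Envelope 𝕜 br d) :
    ∃ N₀ : ℕ, ∀ N ≥ N₀, ∀ m n c, loc N m n c a b = 0 := by
  induction a using induction with
  | h0 => exact ⟨0, by simp [loc, swap]⟩
  | hadd a a' ha ha' =>
    obtain ⟨N, hN⟩ := ha
    obtain ⟨N', hN'⟩ := ha'
    refine ⟨max N N', fun M hM m n c => ?_⟩
    rw [← add_zero 0]
    nth_rw 1 [← hN M (le_trans (le_max_left _ _) hM) m n c]
    rw [← hN' M (le_trans (le_max_right _ _) hM) m n c]
    simp only [loc, swap, ← Finset.sum_add_distrib, map_add, LinearMap.add_apply]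
    refine Finset.sum_congr rfl fun i _ => ?_
    module
  | hsmul r a ha =>
    obtain ⟨N, hN⟩ := ha
    refine ⟨N, fun M hM m n c => ?_⟩
    rw [← smul_zero r, ← hN M hM m n c]
    simp only [loc, swap, Finset.smul_sum, map_smul, LinearMap.smul_apply]
    refine Finset.sum_congr rfl fun i _ => ?_
    module
  | hcls s =>
    induction b using induction with
    | h0 => exact ⟨0, by simp [loc, swap]⟩
    | hadd a a' ha ha' =>
      obtain ⟨N, hN⟩ := ha
      obtain ⟨N', hN'⟩ := ha'
      refine ⟨max N N', fun M hM m n c => ?_⟩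
      rw [← add_zero 0]
      nth_rw 1 [← hN M (le_trans (le_max_left _ _) hM) m n c]
      rw [← hN' M (le_trans (le_max_right _ _) hM) m n c]
      simp only [loc, swap, ← Finset.sum_add_distrib, map_add, LinearMap.add_apply]
      refine Finset.sum_congr rfl fun i _ => ?_
      module
    | hsmul r a ha =>
      obtain ⟨N, hN⟩ := ha
      refine ⟨N, fun M hM m n c => ?_⟩
      rw [← smul_zero r, ← hN M hM m n c]
      simp only [loc, swap, Finset.smul_sum, map_smul, LinearMap.smul_apply]
      refine Finset.sum_congr rfl fun i _ => ?_
      module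
    | hcls t =>
      refine ⟨(s.weight + t.weight).natAbs, fun N hN m n c => ?_⟩
      induction c using induction with
      | h0 => simp [loc, swap]
      | hadd c c' hc hc' =>
        rw [← add_zero 0]
        nth_rw 1 [← hc]
        rw [← hc']
        simp only [loc, swap, ← Finset.sum_add_distrib, map_add]
        refine Finset.sum_congr rfl fun i _ => ?_
        module
      | hsmul r c hc =>
        rw [← smul_zero r, ← hc]
        simp only [loc, swap, Finset.smul_sum, map_smul]
        refine Finset.sum_congr rfl fun i _ => ?_
        module
      | hcls u => exact loc_cls s t u N (by omega) m n

lemma mode_apply (n : ℤ) (e₁ e₂ : Bool) (a b : N2Envelope 𝕜 br d) :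
    N2Operations.mode (𝕜 := 𝕜) n e₁ e₂ a b =
      prod n ((if e₂ then .id else D 1 : _ →ₗ[𝕜] _) ((if e₁ then .id else D 0 : _ →ₗ[𝕜] _) a)) b :=
  rfl

lemma inv_part {p : Bool} {a : N2Envelope 𝕜 br d} (ha : inv a = koszul p • a) (e₁ e₂ : Bool) :
    inv ((if e₂ then .id else D 1 : _ →ₗ[𝕜] _) ((if e₁ then .id else D 0 : _ →ₗ[𝕜] _) a)) =
      koszul (p ^^ !e₁ ^^ !e₂) • (if e₂ then .id else D 1 : _ →ₗ[𝕜] N2Envelope 𝕜 br d)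
        ((if e₁ then .id else D 0 : _ →ₗ[𝕜] _) a) := by
  cases e₁ <;> cases e₂ <;> cases p <;> simp [inv_D, ha, koszul]

instance [CharZero 𝕜] : N2SUSYVertexAlgebra 𝕜 (N2Envelope 𝕜 br d) where
  par p := LinearMap.ker (inv - koszul p • LinearMap.id)
  isCompl_par := by
    have h2 : (2 : 𝕜) ≠ 0 := two_ne_zero
    refine ⟨Submodule.disjoint_def.2 fun a h0 h1 => ?_, codisjoint_iff.2 ?_⟩
    · simp only [LinearMap.mem_ker, LinearMap.sub_apply, koszul, sub_eq_zero, if_true,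
        LinearMap.smul_apply, LinearMap.id_apply] at h0 h1
      simp only [Bool.false_eq_true, if_false, one_smul, neg_smul] at h0 h1
      have : (2 : 𝕜) • a = 0 := by
        rw [two_smul]; nth_rw 1 [← h0]; rw [h1]; simp
      exact (smul_eq_zero.1 this).resolve_left h2
    · rw [eq_top_iff]
      intro a _
      refine Submodule.mem_sup.2 ⟨(2 : 𝕜)⁻¹ • (a + inv a), ?_, (2 : 𝕜)⁻¹ • (a - inv a), ?_, ?_⟩
      · simp [koszul, inv_inv, add_comm]
      · simp [koszul, inv_inv]
      · rw [← smul_add, add_add_sub_cancel, ← two_smul 𝕜, smul_smul, inv_mul_cancel₀ h2, one_smul]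
  vac_mem := by
    have := inv_cls (𝕜 := 𝕜) (br := br) (d := d) (.of 1)
    exact LinearMap.mem_ker.2 (sub_eq_zero.2 this)
  D_mem i p a ha := by
    simp only [LinearMap.mem_ker, LinearMap.sub_apply, sub_eq_zero, LinearMap.smul_apply,
      LinearMap.id_apply] at ha ⊢
    rw [koszul_not, neg_smul]
    exact (inv_D i a).trans (by rw [ha, map_zsmul]; rfl)
  mode_mem j e₁ e₂ p q a ha b hb := by
    simp only [LinearMap.mem_ker, LinearMap.sub_apply, sub_eq_zero, LinearMap.smul_apply,
      LinearMap.id_apply] at ha hb ⊢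
    rw [mode_apply, inv_prod, inv_part ha, hb]
    simp only [map_zsmul, LinearMap.smul_apply, smul_smul, koszul_xor]
    congr 1; ring
  D_sq := LinearMap.ext D_sq
  D_anticomm := LinearMap.ext fun a => by
    have := D_anticomm a
    exact (congrArg (D 0 (D 1 a) + ·) this).trans (add_neg_cancel _)
  mode_eventually_zero a b := by
    choose N hN using fun x : N2Envelope 𝕜 br d => prod_eventually_zero x b
    refine ⟨max (max (N a) (N (D 1 a))) (max (N (D 0 a)) (N (D 1 (D 0 a)))), fun j hj e₁ e₂ => ?_⟩
    simp only [ge_iff_le, max_le_iff] at hj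
    rw [mode_apply]
    cases e₁ <;> cases e₂ <;> exact hN _ _ (by tauto)
  D_vac := D_vac
  vac_mode j e₁ e₂ a := by
    have h0 := D_vac (𝕜 := 𝕜) (br := br) (d := d) 0
    have h1 := D_vac (𝕜 := 𝕜) (br := br) (d := d) 1
    change prod j ((if e₂ then .id else D 1 : _ →ₗ[𝕜] _)
      ((if e₁ then .id else D 0 : _ →ₗ[𝕜] _) (of 1))) a = _
    cases e₁ <;> cases e₂ <;> simp [h0, h1, vac_prod]
  mode_vac a j hj e₁ e₂ := prod_vac hj _
  mode_vac_neg_one a := prod_vac_neg_one a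
  translation i p a ha := by
    simp only [LinearMap.mem_ker, LinearMap.sub_apply, sub_eq_zero, LinearMap.smul_apply,
      LinearMap.id_apply] at ha
    have key : ∀ (i : Fin 2) s₁ s₂ j b, Superfield.oddBracket (D i) p
        (N2Operations.field 𝕜 a) s₁ s₂ j b = koszul (s₁ ^^ s₂) •
          prod j (D i ((if !s₂ then .id else D 1 : _ →ₗ[𝕜] _)
            ((if !s₁ then .id else D 0 : _ →ₗ[𝕜] _) a))) b := by
      intro i s₁ s₂ j b
      simp only [Superfield.oddBracket, N2Operations.field, LinearMap.smul_apply,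
        LinearMap.sub_apply, LinearMap.comp_apply, mode_apply]
      rw [D_prod, inv_part ha]
      simp only [Bool.not_not, map_zsmul, LinearMap.smul_apply, add_sub_cancel_right]
    funext s₁ s₂ j
    refine LinearMap.ext fun b => (key i s₁ s₂ j b).trans ?_
    fin_cases i <;> cases s₁ <;> cases s₂ <;>
      simp [Superfield.dTheta, Superfield.theta, Superfield.dz, N2Operations.field, mode_apply,
        koszul, D_sq, D_anticomm, del_prod]
  locality p q a ha b hb := by
    simp only [LinearMap.mem_ker, LinearMap.sub_apply, sub_eq_zero, LinearMap.smul_apply,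
      LinearMap.id_apply] at ha hb
    choose N hN using fun x y : N2Envelope 𝕜 br d => exists_loc x y
    let X : Bool → Bool → N2Envelope 𝕜 br d → N2Envelope 𝕜 br d := fun e₁ e₂ a =>
      (if e₂ then .id else D 1 : _ →ₗ[𝕜] _) ((if e₁ then .id else D 0 : _ →ₗ[𝕜] _) a)
    refine ⟨∑ e : Bool × Bool × Bool × Bool, N (X e.1 e.2.1 a) (X e.2.2.1 e.2.2.2 b),
      fun s₁ s₂ t₁ t₂ m n c => ?_⟩
    refine Eq.trans ?_ (hN (X (!s₁) (!s₂) a) (X (!t₁) (!t₂) b) _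
      (Finset.single_le_sum (f := fun e : Bool × Bool × Bool × Bool =>
        N (X e.1 e.2.1 a) (X e.2.2.1 e.2.2.2 b)) (fun _ _ => Nat.zero_le _)
        (Finset.mem_univ (!s₁, !s₂, !t₁, !t₂))) m n c)
    rw [loc]
    refine Finset.sum_congr rfl fun i _ => ?_
    have h1 := inv_part ha (!s₁) (!s₂)
    have h2 := inv_part hb (!t₁) (!t₂)
    rw [swap_eq h1 h2]
    simp only [Bool.not_not]
    rfl

end N2Envelope

/-! ### Symplectic manifolds and the Poisson bracket -/

section Symplectic

variable {n : ℕ} {M : Type*} [TopologicalSpace M] [ChartedSpace (EuclideanSpace ℝ (Fin n)) M]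

/-- The representation in a chart `φ` of a field of alternating `2`-forms on `M`. -/
def formInChart (η : ∀ x : M, TangentSpace (𝓡 n) x [⋀^Fin 2]→L[ℝ] ℝ)
    (φ : OpenPartialHomeomorph M (EuclideanSpace ℝ (Fin n))) (u : EuclideanSpace ℝ (Fin n)) :
    EuclideanSpace ℝ (Fin n) [⋀^Fin 2]→L[ℝ] ℝ :=
  (η (φ.symm u)).compContinuousLinearMap (mfderiv (𝓡 n) (𝓡 n) φ.symm u)

variable (n M) in
/-- Symplectic forms on an `n`-dimensional smooth manifold: smooth, closed, nondegenerate
`2`-forms. -/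
structure SymplecticForm where
  toForm : ∀ x : M, TangentSpace (𝓡 n) x [⋀^Fin 2]→L[ℝ] ℝ
  smooth : ∀ φ ∈ IsManifold.maximalAtlas (𝓡 n) ∞ M,
    ContDiffOn ℝ ∞ (formInChart toForm φ) φ.target
  closed : ∀ φ ∈ IsManifold.maximalAtlas (𝓡 n) ∞ M, ∀ u ∈ φ.target,
    extDeriv (formInChart toForm φ) u = 0
  nondegenerate : ∀ x v, (∀ w, toForm x ![v, w] = 0) → v = 0

/-- The standard basis of `ℝⁿ`, hence also of every tangent space `T_y M`, which Mathlib identifies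
with `ℝⁿ` through the preferred chart at `y`. -/
def stdVec (n : ℕ) (μ : Fin n) : EuclideanSpace ℝ (Fin n) := EuclideanSpace.single μ 1

/-- The differential of `f` at `y`. -/
def dAt {𝕜 : Type*} [RCLike 𝕜] (f : M → 𝕜) (y : M) : EuclideanSpace ℝ (Fin n) →L[ℝ] 𝕜 :=
  mfderiv (𝓡 n) 𝓘(ℝ, 𝕜) f y

namespace SymplecticForm

variable (ω₀ : SymplecticForm n M)

/-- The matrix of `ω` at `y` in the standard basis of `T_y M`. -/
def gram (y : M) : Matrix (Fin n) (Fin n) ℝ :=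
  Matrix.of fun a b => ω₀.toForm y ![(stdVec n a : EuclideanSpace ℝ (Fin n)), stdVec n b]

/-- The component `ω_{μν} = ω(∂_μ, ∂_ν)` in the coordinates of a chart `φ`, at `y`. -/
def comp (φ : OpenPartialHomeomorph M (EuclideanSpace ℝ (Fin n))) (μ ν : Fin n) (y : M) : ℝ :=
  formInChart ω₀.toForm φ (φ y) ![stdVec n μ, stdVec n ν]

/-- The Poisson bracket `{f, g} = ∑ ω^{ab} ∂_a f ∂_b g`, where `ω^{ab} ω_{bc} = δ^a_c`. -/
def poisson {𝕜 : Type*} [RCLike 𝕜] (f g : M → 𝕜) (y : M) : 𝕜 :=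
  ∑ a, ∑ b, (((ω₀.gram y)⁻¹ a b : ℝ) : 𝕜) * dAt f y (stdVec n a) * dAt g y (stdVec n b)

end SymplecticForm

end Symplectic

section BracketSmooth

variable {n : ℕ} {M : Type*} [TopologicalSpace M] [ChartedSpace (EuclideanSpace ℝ (Fin n)) M]
  {𝕜 : Type*} [RCLike 𝕜]

lemma contDiffAt_matrix_inv {E : Type*} [NormedAddCommGroup E] [NormedSpace ℝ E]
    {W : E → Matrix (Fin n) (Fin n) ℝ} {u : E}
    (hW : ∀ a b, ContDiffAt ℝ ∞ (fun v => W v a b) u) (hdet : (W u).det ≠ 0) (a b : Fin n) :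
    ContDiffAt ℝ ∞ (fun v => (W v)⁻¹ a b) u := by
  have hd : ∀ (X : E → Matrix (Fin n) (Fin n) ℝ), (∀ a b, ContDiffAt ℝ ∞ (fun v => X v a b) u) →
      ContDiffAt ℝ ∞ (fun v => (X v).det) u := by
    intro X hX
    simp only [Matrix.det_apply]
    refine ContDiffAt.sum fun σ _ => ContDiffAt.const_smul _ (contDiffAt_prod fun i _ => hX _ _)
  simp only [Matrix.inv_def, Ring.inverse_eq_inv', Matrix.smul_apply, smul_eq_mul,
    Matrix.adjugate_apply]
  refine ((hd W hW).inv hdet).mul (hd _ fun c e => ?_)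
  by_cases h : c = b
  · subst h
    simp only [Matrix.updateRow_self]
    exact contDiffAt_const
  · simp only [Matrix.updateRow_ne h]
    exact hW c e

lemma bilin_change_basis (G P : Matrix (Fin n) (Fin n) ℝ) (hP : IsUnit P.det) (u v : Fin n → 𝕜) :
    ∑ a, ∑ b, ((G⁻¹ a b : ℝ) : 𝕜) * u a * v b =
      ∑ a, ∑ b, (((P.transpose * G * P)⁻¹ a b : ℝ) : 𝕜) * (∑ c, (P c a : 𝕜) * u c) *
        ∑ c, (P c b : 𝕜) * v c := by
  have key : ∀ (X : Matrix (Fin n) (Fin n) ℝ) (u v : Fin n → 𝕜),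
      ∑ a, ∑ b, ((X a b : ℝ) : 𝕜) * u a * v b =
        u ⬝ᵥ ((X.map (algebraMap ℝ 𝕜)).mulVec v) := by
    intro X u v
    simp only [dotProduct, Matrix.mulVec, Finset.mul_sum, Matrix.map_apply]
    refine Finset.sum_congr rfl fun a _ => Finset.sum_congr rfl fun b _ => ?_
    simp only [RCLike.algebraMap_eq_ofReal]; ring
  have hv : ∀ v : Fin n → 𝕜, (fun b => ∑ c, (P c b : 𝕜) * v c) =
      (P.transpose.map (algebraMap ℝ 𝕜)).mulVec v := by
    intro v
    funext b
    simp [Matrix.mulVec, dotProduct, RCLike.algebraMap_eq_ofReal]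
  have hPt : IsUnit P.transpose.det := by rwa [Matrix.det_transpose]
  have e1 := key (P.transpose * G * P)⁻¹ (fun b => ∑ c, (P c b : 𝕜) * u c)
    (fun b => ∑ c, (P c b : 𝕜) * v c)
  rw [key, e1, hv, hv, Matrix.mulVec_mulVec, Matrix.dotProduct_mulVec _ _ v, ← Matrix.map_mul,
    Matrix.mul_inv_rev, Matrix.mul_inv_rev, Matrix.mul_assoc, Matrix.mul_assoc,
    Matrix.nonsing_inv_mul _ hPt, Matrix.mul_one, ← Matrix.dotProduct_mulVec,
    Matrix.dotProduct_mulVec, Matrix.dotProduct_mulVec, Matrix.transpose_map,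
    Matrix.mulVec_transpose, Matrix.vecMul_vecMul, ← Matrix.map_mul, ← Matrix.mul_assoc,
    Matrix.mul_nonsing_inv _ hP, Matrix.one_mul]

lemma sum_stdVec (w : EuclideanSpace ℝ (Fin n)) : w = ∑ a, w a • stdVec n a := by
  ext i
  simp [stdVec, Finset.sum_apply, Pi.single_apply]

lemma alternating_sum (η : EuclideanSpace ℝ (Fin n) [⋀^Fin 2]→L[ℝ] ℝ)
    (v w : EuclideanSpace ℝ (Fin n)) :
    η ![v, w] = ∑ a, ∑ b, v a * η ![stdVec n a, stdVec n b] * w b := by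
  have hu0 : ∀ x y z : EuclideanSpace ℝ (Fin n), Function.update ![x, y] 0 z = ![z, y] := by
    intro x y z
    funext i
    fin_cases i <;> rfl
  have hu1 : ∀ x y z : EuclideanSpace ℝ (Fin n), Function.update ![x, y] 1 z = ![x, z] := by
    intro x y z
    funext i
    fin_cases i <;> rfl
  have h1 : ∀ v v' w, η ![v + v', w] = η ![v, w] + η ![v', w] := by
    intro v v' w
    have h := η.map_update_add ![(0 : EuclideanSpace ℝ (Fin n)), w] 0 v v'
    rwa [hu0, hu0, hu0] at h
  have h2 : ∀ (r : ℝ) v w, η ![r • v, w] = r • η ![v, w] := by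
    intro r v w
    have h := η.map_update_smul ![(0 : EuclideanSpace ℝ (Fin n)), w] 0 r v
    rwa [hu0, hu0] at h
  have h3 : ∀ v w w', η ![v, w + w'] = η ![v, w] + η ![v, w'] := by
    intro v w w'
    have h := η.map_update_add ![v, (0 : EuclideanSpace ℝ (Fin n))] 1 w w'
    rwa [hu1, hu1, hu1] at h
  have h4 : ∀ (r : ℝ) v w, η ![v, r • w] = r • η ![v, w] := by
    intro r v w
    have h := η.map_update_smul ![v, (0 : EuclideanSpace ℝ (Fin n))] 1 r w
    rwa [hu1, hu1] at h
  let L : EuclideanSpace ℝ (Fin n) →ₗ[ℝ] EuclideanSpace ℝ (Fin n) →ₗ[ℝ] ℝ :=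
    LinearMap.mk₂ ℝ (fun v w => η ![v, w]) h1 h2 h3 h4
  have hL : ∀ v w, η ![v, w] = L v w := fun _ _ => rfl
  rw [hL]
  conv_lhs => rw [sum_stdVec v, sum_stdVec w]
  simp only [map_sum, LinearMap.sum_apply, map_smul, LinearMap.smul_apply, smul_eq_mul, hL]
  rw [Finset.sum_comm]
  refine Finset.sum_congr rfl fun a _ => ?_
  rw [Finset.mul_sum]
  refine Finset.sum_congr rfl fun b _ => ?_
  ring

variable {φ : OpenPartialHomeomorph M (EuclideanSpace ℝ (Fin n))}

lemma mdifferentiable_of_mem_maximalAtlas [IsManifold (𝓡 n) ∞ M]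
    (hφ : φ ∈ IsManifold.maximalAtlas (𝓡 n) ∞ M) : φ.MDifferentiable (𝓡 n) (𝓡 n) :=
  ⟨(contMDiffOn_of_mem_maximalAtlas hφ).mdifferentiableOn (by simp),
    (contMDiffOn_symm_of_mem_maximalAtlas hφ).mdifferentiableOn (by simp)⟩

/-- The derivative of the inverse of a chart. -/
def frame (φ : OpenPartialHomeomorph M (EuclideanSpace ℝ (Fin n))) (u : EuclideanSpace ℝ (Fin n)) :
    EuclideanSpace ℝ (Fin n) →L[ℝ] EuclideanSpace ℝ (Fin n) :=
  mfderiv (𝓡 n) (𝓡 n) φ.symm u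

lemma frame_det [IsManifold (𝓡 n) ∞ M] (hφ : φ ∈ IsManifold.maximalAtlas (𝓡 n) ∞ M)
    {u : EuclideanSpace ℝ (Fin n)} (hu : u ∈ φ.target) :
    IsUnit (Matrix.of fun a μ => frame φ u (stdVec n μ) a).det := by
  have h := (mdifferentiable_of_mem_maximalAtlas hφ).comp_symm_deriv hu
  let Q : EuclideanSpace ℝ (Fin n) →L[ℝ] EuclideanSpace ℝ (Fin n) :=
    mfderiv (𝓡 n) (𝓡 n) φ (φ.symm u)
  have hQ : ∀ v, Q (frame φ u v) = v := fun v => DFunLike.congr_fun h v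
  have : (Matrix.of fun a μ => Q (stdVec n μ) a) * (Matrix.of fun a μ => frame φ u (stdVec n μ) a)
      = 1 := by
    ext a b
    have h1 := congrArg (fun v : EuclideanSpace ℝ (Fin n) => v a) (hQ (stdVec n b))
    simp only at h1
    rw [sum_stdVec (frame φ u (stdVec n b))] at h1
    simp only [map_sum, map_smul] at h1
    simp only [Matrix.mul_apply, Matrix.of_apply, Matrix.one_apply]
    simp only [WithLp.ofLp_sum, Finset.sum_apply, PiLp.smul_apply, smul_eq_mul] at h1
    simp only [mul_comm (Q _ _)]
    rw [h1]
    simp [stdVec]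
  exact Matrix.isUnit_det_of_left_inverse this

variable (ω₀ : SymplecticForm n M)

lemma SymplecticForm.poisson_symm [IsManifold (𝓡 n) ∞ M]
    (hφ : φ ∈ IsManifold.maximalAtlas (𝓡 n) ∞ M)
    {u : EuclideanSpace ℝ (Fin n)} (hu : u ∈ φ.target) (f g : M → 𝕜) :
    ω₀.poisson f g (φ.symm u) = ∑ μ, ∑ ν,
      (((Matrix.of fun μ ν => formInChart ω₀.toForm φ u ![stdVec n μ, stdVec n ν])⁻¹ μ ν : ℝ) : 𝕜) *
        dAt f (φ.symm u) (frame φ u (stdVec n μ)) * dAt g (φ.symm u) (frame φ u (stdVec n ν)) := by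
  have hd : ∀ (α : EuclideanSpace ℝ (Fin n) →L[ℝ] 𝕜) (v : EuclideanSpace ℝ (Fin n)),
      α v = ∑ a, (v a : 𝕜) * α (stdVec n a) := by
    intro α v
    conv_lhs => rw [sum_stdVec v]
    simp only [map_sum, map_smul, RCLike.real_smul_eq_coe_mul]
  have hG : (Matrix.of fun μ ν => formInChart ω₀.toForm φ u ![stdVec n μ, stdVec n ν]) =
      (Matrix.of fun a μ => frame φ u (stdVec n μ) a).transpose * ω₀.gram (φ.symm u) *
        (Matrix.of fun a μ => frame φ u (stdVec n μ) a) := by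
    ext μ ν
    let η : EuclideanSpace ℝ (Fin n) [⋀^Fin 2]→L[ℝ] ℝ := ω₀.toForm (φ.symm u)
    have e : formInChart ω₀.toForm φ u ![stdVec n μ, stdVec n ν] =
        η ![frame φ u (stdVec n μ), frame φ u (stdVec n ν)] := by
      change η (_ ∘ _) = _
      congr 1
      funext i
      fin_cases i <;> rfl
    rw [Matrix.of_apply, e, alternating_sum η]
    simp only [Matrix.mul_apply, Matrix.transpose_apply, Matrix.of_apply, Finset.sum_mul]
    rw [Finset.sum_comm]
    rfl
  rw [hG, SymplecticForm.poisson, bilin_change_basis _ _ (frame_det hφ hu)]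
  simp only [hd _ (frame φ u _), Matrix.of_apply]

lemma SymplecticForm.det_formInChart_ne_zero [IsManifold (𝓡 n) ∞ M]
    (hφ : φ ∈ IsManifold.maximalAtlas (𝓡 n) ∞ M)
    {u : EuclideanSpace ℝ (Fin n)} (hu : u ∈ φ.target) :
    (Matrix.of fun μ ν => formInChart ω₀.toForm φ u ![stdVec n μ, stdVec n ν]).det ≠ 0 := by
  intro h0
  obtain ⟨v, hv, hv0⟩ := Matrix.exists_vecMul_eq_zero_iff.2 h0
  let v' : EuclideanSpace ℝ (Fin n) := WithLp.toLp 2 v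
  have hz : ∀ w, formInChart ω₀.toForm φ u ![v', w] = 0 := by
    intro w
    rw [alternating_sum, Finset.sum_comm]
    refine Finset.sum_eq_zero fun b _ => ?_
    rw [← Finset.sum_mul]
    have := congrFun hv0 b
    simp only [Matrix.vecMul, dotProduct, Matrix.of_apply, Pi.zero_apply] at this
    change (∑ a, v a * _) * _ = 0
    rw [this, zero_mul]
  have h := (mdifferentiable_of_mem_maximalAtlas hφ).symm_comp_deriv (φ.map_target hu)
  have h' := (mdifferentiable_of_mem_maximalAtlas hφ).comp_symm_deriv hu
  rw [φ.right_inv hu] at h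
  let Q : EuclideanSpace ℝ (Fin n) →L[ℝ] EuclideanSpace ℝ (Fin n) :=
    mfderiv (𝓡 n) (𝓡 n) φ (φ.symm u)
  have hQ : ∀ w, Q (frame φ u w) = w := fun v => DFunLike.congr_fun h' v
  have hQ' : ∀ w, frame φ u (Q w) = w := fun v => DFunLike.congr_fun h v
  have hvz : frame φ u v' = 0 := by
    refine ω₀.nondegenerate (φ.symm u) (frame φ u v') fun (w : EuclideanSpace ℝ (Fin n)) => ?_
    have := hz (Q w)
    let η : EuclideanSpace ℝ (Fin n) [⋀^Fin 2]→L[ℝ] ℝ := ω₀.toForm (φ.symm u)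
    have e : formInChart ω₀.toForm φ u ![v', Q w] = η ![frame φ u v', frame φ u (Q w)] := by
      change η (_ ∘ _) = _
      congr 1
      funext i
      fin_cases i <;> rfl
    rw [e, hQ'] at this
    exact this
  have : v' = 0 := by rw [← hQ v', hvz, map_zero]
  exact hv (by simpa [v'] using this)

lemma dAt_symm [IsManifold (𝓡 n) ∞ M] (hφ : φ ∈ IsManifold.maximalAtlas (𝓡 n) ∞ M)
    {u : EuclideanSpace ℝ (Fin n)} (hu : u ∈ φ.target) {f : M → 𝕜}
    (hf : ContMDiffAt (𝓡 n) 𝓘(ℝ, 𝕜) ∞ f (φ.symm u)) (v : EuclideanSpace ℝ (Fin n)) :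
    dAt f (φ.symm u) (frame φ u v) = fderiv ℝ (f ∘ φ.symm) u v := by
  have h := mfderiv_comp u (hf.mdifferentiableAt (by simp))
    ((mdifferentiable_of_mem_maximalAtlas hφ).mdifferentiableAt_symm hu)
  rw [mfderiv_eq_fderiv] at h
  exact (DFunLike.congr_fun h v).symm

lemma contDiffAt_symm [IsManifold (𝓡 n) ∞ M] (hφ : φ ∈ IsManifold.maximalAtlas (𝓡 n) ∞ M)
    {u : EuclideanSpace ℝ (Fin n)} (hu : u ∈ φ.target) {f : M → 𝕜}
    (hf : ContMDiffAt (𝓡 n) 𝓘(ℝ, 𝕜) ∞ f (φ.symm u)) : ContDiffAt ℝ ∞ (f ∘ φ.symm) u :=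
  (hf.comp u (contMDiffAt_symm_of_mem_maximalAtlas hφ hu)).contDiffAt

lemma SymplecticForm.contMDiffAt_poisson [IsManifold (𝓡 n) ∞ M] {f g : M → 𝕜} {y : M}
    (hf : ∀ᶠ z in 𝓝 y, ContMDiffAt (𝓡 n) 𝓘(ℝ, 𝕜) ∞ f z)
    (hg : ∀ᶠ z in 𝓝 y, ContMDiffAt (𝓡 n) 𝓘(ℝ, 𝕜) ∞ g z) :
    ContMDiffAt (𝓡 n) 𝓘(ℝ, 𝕜) ∞ (ω₀.poisson f g) y := by
  set φ := chartAt (EuclideanSpace ℝ (Fin n)) y with hφdef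
  have hφ : φ ∈ IsManifold.maximalAtlas (𝓡 n) ∞ M := IsManifold.chart_mem_maximalAtlas y
  have hy : y ∈ φ.source := mem_chart_source _ y
  have hu : φ y ∈ φ.target := φ.map_source hy
  let H : EuclideanSpace ℝ (Fin n) → 𝕜 := fun u => ∑ μ, ∑ ν,
      (((Matrix.of fun μ ν => formInChart ω₀.toForm φ u ![stdVec n μ, stdVec n ν])⁻¹ μ ν : ℝ) : 𝕜) *
        fderiv ℝ (f ∘ φ.symm) u (stdVec n μ) * fderiv ℝ (g ∘ φ.symm) u (stdVec n ν)
  have hH : ContDiffAt ℝ ∞ H (φ y) := by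
    refine ContDiffAt.sum fun μ _ => ContDiffAt.sum fun ν _ => ContDiffAt.mul (ContDiffAt.mul ?_ ?_) ?_
    · refine (RCLike.ofRealCLM (K := 𝕜)).contDiff.contDiffAt.comp (φ y)
        (contDiffAt_matrix_inv (W := fun u => Matrix.of fun μ ν =>
          formInChart ω₀.toForm φ u ![stdVec n μ, stdVec n ν]) (fun a b => ?_) (ω₀.det_formInChart_ne_zero hφ hu) μ ν)
      have h := ((ω₀.smooth φ hφ).contDiffAt (φ.open_target.mem_nhds hu))
      exact (ContinuousAlternatingMap.apply ℝ (EuclideanSpace ℝ (Fin n)) ℝ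
        ![stdVec n a, stdVec n b]).contDiff.contDiffAt.comp (φ y) h
    · have h := contDiffAt_symm hφ hu (f := f) (by rw [φ.left_inv hy]; exact hf.self_of_nhds)
      exact (h.fderiv_right (m := ∞) (by simp)).clm_apply contDiffAt_const
    · have h := contDiffAt_symm hφ hu (f := g) (by rw [φ.left_inv hy]; exact hg.self_of_nhds)
      exact (h.fderiv_right (m := ∞) (by simp)).clm_apply contDiffAt_const
  have hc : ContMDiffAt (𝓡 n) 𝓘(ℝ, 𝕜) ∞ (H ∘ φ) y :=
    hH.contMDiffAt.comp y (contMDiffAt_of_mem_maximalAtlas hφ hy)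
  refine hc.congr_of_eventuallyEq ?_
  filter_upwards [hf, hg, φ.open_source.mem_nhds hy] with z hfz hgz hz
  have hz' := φ.map_source hz
  have hl := φ.left_inv hz
  have e := ω₀.poisson_symm hφ hz' f g
  rw [← hl] at hfz hgz
  simp only [dAt_symm hφ hz' hfz, dAt_symm hφ hz' hgz] at e
  rw [hl] at e
  exact e

end BracketSmooth

/-! ### The sheaf of `N = 2` SUSY vertex algebras of a symplectic manifold -/

section Sheaf

open Filter (Germ)

instance (priority := low) germAlgebra {X R : Type*} [CommRing R] (l : Filter X) :
    Algebra R (Germ l R) :=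
  Algebra.ofModule
    (fun _ x y => Filter.Germ.inductionOn₂ x y fun _ _ =>
      congrArg _ (funext fun _ => smul_mul_assoc _ _ _))
    (fun _ x y => Filter.Germ.inductionOn₂ x y fun _ _ =>
      congrArg _ (funext fun _ => mul_smul_comm _ _ _))

/-- The algebra of germs at `x` of smooth functions. -/
def smoothGerm (𝕜 : Type*) [RCLike 𝕜] (n : ℕ) {M : Type*} [TopologicalSpace M]
    [ChartedSpace (EuclideanSpace ℝ (Fin n)) M] (x : M) : Subalgebra 𝕜 (Germ (𝓝 x) 𝕜) where
  carrier := {g | ∃ f : M → 𝕜,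
    (∀ᶠ y in 𝓝 x, ContMDiffAt (𝓡 n) 𝓘(ℝ, 𝕜) ∞ f y) ∧ (f : Germ (𝓝 x) 𝕜) = g}
  mul_mem' := by
    rintro _ _ ⟨f, hf, rfl⟩ ⟨g, hg, rfl⟩
    refine ⟨f * g, ?_, rfl⟩
    filter_upwards [hf, hg] with y h1 h2 using
      (contDiff_fst.mul contDiff_snd : ContDiff ℝ ∞ fun p : 𝕜 × 𝕜 => p.1 * p.2).comp_contMDiffAt
        (h1.prodMk_space h2)
  add_mem' := by
    rintro _ _ ⟨f, hf, rfl⟩ ⟨g, hg, rfl⟩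
    refine ⟨f + g, ?_, rfl⟩
    filter_upwards [hf, hg] with y h1 h2 using h1.add h2
  algebraMap_mem' r := by
    refine ⟨fun _ => r, .of_forall fun _ => contMDiffAt_const, ?_⟩
    rw [Algebra.algebraMap_eq_smul_one]
    exact congrArg _ (funext fun _ => (mul_one r).symm)

/-- The smooth functions on an open set `U`, represented by functions that are defined on `M`. -/
def SmoothOn (𝕜 : Type*) [RCLike 𝕜] (n : ℕ) {M : Type*} [TopologicalSpace M]
    [ChartedSpace (EuclideanSpace ℝ (Fin n)) M] (U : Opens M) : Type _ :=
  {f : M → 𝕜 // ContMDiffOn (𝓡 n) 𝓘(ℝ, 𝕜) ∞ f U}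

variable {𝕜 : Type*} [RCLike 𝕜] {n : ℕ} {M : Type*} [TopologicalSpace M]
  [ChartedSpace (EuclideanSpace ℝ (Fin n)) M]

/-- The germ at `y ∈ U` of a smooth function on `U`. -/
def SmoothOn.germ {U : Opens M} (y : U) (f : SmoothOn 𝕜 n U) : smoothGerm 𝕜 n y.1 :=
  ⟨(f.1 : Germ (𝓝 y.1) 𝕜), f.1, by
    filter_upwards [U.isOpen.mem_nhds y.2] with z hz using
      f.2.contMDiffAt (U.isOpen.mem_nhds hz), rfl⟩

/-- The restriction of a smooth function to a smaller open set. -/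
def SmoothOn.res {U V : Opens M} (h : V ≤ U) (f : SmoothOn 𝕜 n U) : SmoothOn 𝕜 n V :=
  ⟨f.1, f.2.mono h⟩

/-- The differential of a germ of a function, a germ of a field of covectors. -/
def dGerm {x : M} (f : smoothGerm 𝕜 n x) : Germ (𝓝 x) (EuclideanSpace ℝ (Fin n) →L[ℝ] 𝕜) :=
  Germ.map' (dAt (n := n) (M := M) (𝕜 := 𝕜)) (fun f g h => by
    filter_upwards [eventually_eventually_nhds.2 h] with y hy
    exact Filter.EventuallyEq.mfderiv_eq (I := 𝓡 n) (I' := 𝓘(ℝ, 𝕜)) hy) f.1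

variable [IsManifold (𝓡 n) ∞ M] (ω₀ : SymplecticForm n M)

/-- The Poisson bracket of germs of smooth functions. -/
def poissonGerm {x : M} (f g : smoothGerm 𝕜 n x) : smoothGerm 𝕜 n x :=
  ⟨Quotient.map₂ ω₀.poisson (fun f f' hf g g' hg => by
      filter_upwards [eventually_eventually_nhds.2 hf, eventually_eventually_nhds.2 hg] with y h1 h2
      have e1 : dAt (n := n) f y = dAt f' y :=
        Filter.EventuallyEq.mfderiv_eq (I := 𝓡 n) (I' := 𝓘(ℝ, 𝕜)) h1
      have e2 : dAt (n := n) g y = dAt g' y :=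
        Filter.EventuallyEq.mfderiv_eq (I := 𝓡 n) (I' := 𝓘(ℝ, 𝕜)) h2
      simp only [SymplecticForm.poisson, e1, e2]) f.1 g.1, by
    obtain ⟨_, f, hf, rfl⟩ := f
    obtain ⟨_, g, hg, rfl⟩ := g
    refine ⟨ω₀.poisson f g, ?_, rfl⟩
    filter_upwards [eventually_eventually_nhds.2 hf, eventually_eventually_nhds.2 hg] with y h1 h2
      using ω₀.contMDiffAt_poisson h1 h2⟩

variable (𝕜)

/-- The stalk at `x` of the sheaf: the `N = 2` SUSY vertex algebra generated by the Poisson algebra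
of germs at `x` of smooth functions. -/
abbrev N2Stalk (x : M) : Type _ :=
  N2Envelope 𝕜 (poissonGerm (𝕜 := 𝕜) ω₀ (x := x)) (dGerm (𝕜 := 𝕜) (n := n) (x := x))

/-- The value in the stalk at `y ∈ U` of a combination of formal expressions in smooth functions on
`U`. -/
def stalkMap {U : Opens M} (y : U) : N2Free 𝕜 (SmoothOn 𝕜 n U) →ₗ[𝕜] N2Stalk 𝕜 ω₀ y.1 :=
  N2Envelope.mk 𝕜 _ _ ∘ₗ N2Free.map 𝕜 (SmoothOn.germ y)

lemma stalkMap_D {U : Opens M} (y : U) (i : Fin 2) (t : N2Free 𝕜 (SmoothOn 𝕜 n U)) :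
    stalkMap 𝕜 ω₀ y (N2Free.D 𝕜 i t) = N2Envelope.D i (stalkMap 𝕜 ω₀ y t) := by
  induction t using N2Free.induction with
  | h0 => simp
  | hadd a b ha hb => simp only [map_add, ha, hb]
  | hsmul r a ha => simp only [map_smul, ha]
  | hterm t =>
    rw [N2Free.D_term]
    simp only [stalkMap, LinearMap.comp_apply, N2Free.map_term, N2Term.map]
    exact (N2Envelope.D_cls i _).symm

lemma stalkMap_prod {U : Opens M} (y : U) (m : ℤ) (s t : N2Free 𝕜 (SmoothOn 𝕜 n U)) :
    stalkMap 𝕜 ω₀ y (N2Free.prod 𝕜 m s t) =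
      N2Envelope.prod m (stalkMap 𝕜 ω₀ y s) (stalkMap 𝕜 ω₀ y t) := by
  induction s using N2Free.induction with
  | h0 => simp
  | hadd a b ha hb => simp only [map_add, LinearMap.add_apply, ha, hb]
  | hsmul r a ha => simp only [map_smul, LinearMap.smul_apply, ha]
  | hterm s =>
    induction t using N2Free.induction with
    | h0 => simp
    | hadd a b ha hb => simp only [map_add, ha, hb]
    | hsmul r a ha => simp only [map_smul, ha]
    | hterm t =>
      rw [N2Free.prod_term]
      simp only [stalkMap, LinearMap.comp_apply, N2Free.map_term, N2Term.map]
      exact (N2Envelope.prod_cls m _ _).symm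

lemma stalkMap_res {U V : Opens M} (h : V ≤ U) (y : V) (t : N2Free 𝕜 (SmoothOn 𝕜 n U)) :
    stalkMap 𝕜 ω₀ y (N2Free.map 𝕜 (SmoothOn.res h) t) = stalkMap 𝕜 ω₀ ⟨y.1, h y.2⟩ t := by
  induction t using N2Free.induction with
  | h0 => simp
  | hadd a b ha hb => simp only [map_add, ha, hb]
  | hsmul r a ha => simp only [map_smul, ha]
  | hterm t =>
    simp only [stalkMap, LinearMap.comp_apply, N2Free.map_term, N2Term.map_map]
    rfl

/-- The families of elements of the stalks over `U` that are given by one combination of formal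
expressions in smooth functions on `U`. -/
def n2Prelocal : TopCat.PrelocalPredicate (X := TopCat.of M) (fun x => N2Stalk 𝕜 ω₀ x) where
  pred {U} s := ∃ t : N2Free 𝕜 (SmoothOn 𝕜 n U), ∀ y : U, s y = stalkMap 𝕜 ω₀ y t
  res {U V} i s := by
    rintro ⟨t, ht⟩
    exact ⟨N2Free.map 𝕜 (SmoothOn.res i.le) t, fun y =>
      (ht ⟨y.1, i.le y.2⟩).trans (stalkMap_res 𝕜 ω₀ i.le y t).symm⟩

/-- The sheaf of `N = 2` SUSY vertex algebras associated to a symplectic manifold, as a sheaf of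
sets. -/
def n2Sheaf : TopCat.Sheaf (Type _) (TopCat.of M) :=
  TopCat.subsheafToTypes (n2Prelocal 𝕜 ω₀).sheafify

/-- The vector space of sections over `U` of the sheaf `n2Sheaf`. -/
def N2Sections (U : Opens M) : Submodule 𝕜 (∀ y : U, N2Stalk 𝕜 ω₀ y.1) where
  carrier := {s | (n2Prelocal 𝕜 ω₀).sheafify.pred (U := U) s}
  add_mem' := by
    intro a b ha hb
    refine TopCat.PrelocalPredicate.sheafify_inductionOn₂' _ _ (n2Prelocal 𝕜 ω₀)
      (fun a b => a + b) ?_ ha hb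
    rintro U V a b ⟨s, hs⟩ ⟨t, ht⟩
    refine ⟨N2Free.map 𝕜 (SmoothOn.res inf_le_left) s + N2Free.map 𝕜 (SmoothOn.res inf_le_right) t,
      fun y => ?_⟩
    rw [map_add, stalkMap_res, stalkMap_res]
    exact congrArg₂ (· + ·) (hs _) (ht _)
  zero_mem' := TopCat.PrelocalPredicate.sheafifyOf ⟨0, fun y => (map_zero _).symm⟩
  smul_mem' := by
    intro r a ha
    refine TopCat.PrelocalPredicate.sheafify_inductionOn' (n2Prelocal 𝕜 ω₀) (fun a => r • a) ?_ ha
    rintro U a ⟨s, hs⟩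
    exact ⟨r • s, fun y => by rw [map_smul, ← hs]⟩

namespace N2Sections

variable {𝕜 ω₀}

lemma D_mem {U : Opens M} (i : Fin 2) {s : ∀ y : U, N2Stalk 𝕜 ω₀ y.1} (hs : s ∈ N2Sections 𝕜 ω₀ U) :
    (fun y => N2Envelope.D i (s y)) ∈ N2Sections 𝕜 ω₀ U := by
  refine TopCat.PrelocalPredicate.sheafify_inductionOn' (n2Prelocal 𝕜 ω₀)
    (fun a => N2Envelope.D i a) ?_ hs
  rintro U a ⟨s, hs⟩
  exact ⟨N2Free.D 𝕜 i s, fun y => by rw [stalkMap_D, ← hs]⟩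

lemma prod_mem {U : Opens M} (m : ℤ) {s t : ∀ y : U, N2Stalk 𝕜 ω₀ y.1}
    (hs : s ∈ N2Sections 𝕜 ω₀ U) (ht : t ∈ N2Sections 𝕜 ω₀ U) :
    (fun y => N2Envelope.prod m (s y) (t y)) ∈ N2Sections 𝕜 ω₀ U := by
  refine TopCat.PrelocalPredicate.sheafify_inductionOn₂' _ _ (n2Prelocal 𝕜 ω₀)
    (fun a b => N2Envelope.prod m a b) ?_ hs ht
  rintro U V a b ⟨s, hs⟩ ⟨t, ht⟩
  refine ⟨N2Free.prod 𝕜 m (N2Free.map 𝕜 (SmoothOn.res inf_le_left) s)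
    (N2Free.map 𝕜 (SmoothOn.res inf_le_right) t), fun y => ?_⟩
  rw [stalkMap_prod, stalkMap_res, stalkMap_res]
  exact congrArg₂ (fun a b => N2Envelope.prod m a b) (hs _) (ht _)

lemma mode_mem {U : Opens M} (m : ℤ) (e₁ e₂ : Bool) {s t : ∀ y : U, N2Stalk 𝕜 ω₀ y.1}
    (hs : s ∈ N2Sections 𝕜 ω₀ U) (ht : t ∈ N2Sections 𝕜 ω₀ U) :
    (fun y => N2Operations.mode (𝕜 := 𝕜) m e₁ e₂ (s y) (t y)) ∈ N2Sections 𝕜 ω₀ U := by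
  cases e₁ <;> cases e₂
  · exact prod_mem m (D_mem 1 (D_mem 0 hs)) ht
  · exact prod_mem m (D_mem 0 hs) ht
  · exact prod_mem m (D_mem 1 hs) ht
  · exact prod_mem m hs ht

lemma of_mem {U : Opens M} (f : SmoothOn 𝕜 n U) :
    (fun y : U => (N2Envelope.of (f.germ y) : N2Stalk 𝕜 ω₀ y.1)) ∈ N2Sections 𝕜 ω₀ U := by
  have h : (n2Prelocal 𝕜 ω₀).pred (U := U)
      (fun y : U => (N2Envelope.of (f.germ y) : N2Stalk 𝕜 ω₀ y.1)) := by
    refine ⟨N2Free.term 𝕜 (.of f), fun y => ?_⟩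
    simp only [stalkMap, LinearMap.comp_apply, N2Free.map_term, N2Term.map]
    rfl
  exact TopCat.PrelocalPredicate.sheafifyOf (P := n2Prelocal 𝕜 ω₀) h

/-- The section of the sheaf given by a smooth function. -/
def of {U : Opens M} (f : SmoothOn 𝕜 n U) : N2Sections 𝕜 ω₀ U :=
  ⟨fun y => N2Envelope.of (f.germ y), of_mem f⟩

/-- The restriction of sections. -/
def res {U V : Opens M} (h : V ≤ U) (s : N2Sections 𝕜 ω₀ U) : N2Sections 𝕜 ω₀ V :=
  ⟨fun y => s.1 ⟨y.1, h y.2⟩, (n2Prelocal 𝕜 ω₀).sheafify.res (CategoryTheory.homOfLE h) s.1 s.2⟩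

/-- The operations on sections are those of the stalks. -/
instance (U : Opens M) : N2Operations 𝕜 (N2Sections 𝕜 ω₀ U) where
  vac := of ⟨fun _ => 1, contMDiffOn_const⟩
  D i :=
    { toFun := fun s => ⟨fun y => N2Operations.D (𝕜 := 𝕜) i (s.1 y), D_mem i s.2⟩
      map_add' := fun s t => Subtype.ext (funext fun y => map_add _ _ _)
      map_smul' := fun r s => Subtype.ext (funext fun y =>
        LinearMap.map_smul (N2Operations.D (𝕜 := 𝕜) i) r (s.1 y)) }
  mode m e₁ e₂ := LinearMap.mk₂ 𝕜
    (fun s t => ⟨fun y => N2Operations.mode (𝕜 := 𝕜) m e₁ e₂ (s.1 y) (t.1 y),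
      mode_mem m e₁ e₂ s.2 t.2⟩)
    (fun s s' t => Subtype.ext (funext fun y => LinearMap.map_add₂ _ _ _ _))
    (fun r s t => Subtype.ext (funext fun y => LinearMap.map_smul₂ _ _ _ _))
    (fun s t t' => Subtype.ext (funext fun y => map_add _ _ _))
    (fun r s t => Subtype.ext (funext fun y =>
      LinearMap.map_smul (N2Operations.mode (𝕜 := 𝕜) m e₁ e₂ (s.1 y)) r (t.1 y)))

end N2Sections

/-! ### The section `𝒢_ω` -/

/-- The domain of a chart. -/
def chartDomain (φ : OpenPartialHomeomorph M (EuclideanSpace ℝ (Fin n))) : Opens M :=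
  ⟨φ.source, φ.open_source⟩

variable {φ : OpenPartialHomeomorph M (EuclideanSpace ℝ (Fin n))}
  (hφ : φ ∈ IsManifold.maximalAtlas (𝓡 n) ∞ M)

/-- The coordinate functions `x^μ` of a chart. -/
def coordFun (μ : Fin n) : SmoothOn 𝕜 n (chartDomain φ) :=
  ⟨fun y => (φ y μ : 𝕜), by
    have h : ContDiff ℝ ∞ fun u : EuclideanSpace ℝ (Fin n) => ((u μ : ℝ) : 𝕜) :=
      (RCLike.ofRealCLM (K := 𝕜)).contDiff.comp (EuclideanSpace.proj (𝕜 := ℝ) μ).contDiff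
    exact fun y hy => h.comp_contMDiffWithinAt (contMDiffOn_of_mem_maximalAtlas hφ y hy)⟩

/-- The component functions `ω_{μν}` of the symplectic form in a chart. -/
def formFun (μ ν : Fin n) : SmoothOn 𝕜 n (chartDomain φ) :=
  ⟨fun y => (ω₀.comp φ μ ν y : 𝕜), by
    intro y hy
    have h := (ω₀.smooth φ hφ).contDiffAt (φ.open_target.mem_nhds (φ.map_source hy))
    have h' := (RCLike.ofRealCLM (K := 𝕜)).contDiff.contDiffAt.comp (φ y)
      ((ContinuousAlternatingMap.apply ℝ (EuclideanSpace ℝ (Fin n)) ℝ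
        ![stdVec n μ, stdVec n ν]).contDiff.contDiffAt.comp (φ y) h)
    exact h'.comp_contMDiffWithinAt (contMDiffOn_of_mem_maximalAtlas hφ y hy)⟩

/-- The superfields `Φ^μ` of a chart. -/
def coordField (μ : Fin n) : N2Sections 𝕜 ω₀ (chartDomain φ) :=
  N2Sections.of (coordFun 𝕜 hφ μ)

/-- The local expression
`½ ∑ ω_{μν}(Φ) (D₁ Φ^μ D₁ Φ^ν + D₂ Φ^μ D₂ Φ^ν)` in the coordinates of a chart. -/
def localG : N2Sections 𝕜 ω₀ (chartDomain φ) :=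
  (2 : 𝕜)⁻¹ • ∑ μ, ∑ ν, N2Operations.nord 𝕜 (N2Sections.of (formFun 𝕜 ω₀ hφ μ ν))
    (∑ i, N2Operations.nord 𝕜 (N2Operations.D (𝕜 := 𝕜) i (coordField 𝕜 ω₀ hφ μ))
      (N2Operations.D (𝕜 := 𝕜) i (coordField 𝕜 ω₀ hφ ν)))

end Sheaf

end

/-!
In the envelope of a Poisson algebra every element is a combination of expressions of a definite
weight and parity, and negative weights vanish. So all operator products are finite sums, and the
Borcherds identity yields the commutator formula, the quasi-associativity of the normally ordered
product (`N2Envelope.nord_prod`) and skew-symmetry (`N2Envelope.skew_symmetry`).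

The only singular operator products among functions and their first derivatives are those of `D₁
f` with `D₂ g`, whose residue is `{f, g}` up to sign. For a fixed `i`, functions and the `Dᵢ g`
therefore generate an associative supercommutative algebra under the normally ordered product.
This gives the independence of the ordering, and it makes `½ ∑ ω_{μν} Dᵢ Φ^μ Dᵢ Φ^ν` transform
like a `2`-form under a change of coordinates (`N2Envelope.SymplecticCoordinates.vector_eq`).

The superconformal relation is proved in arbitrary coordinates, without Darboux coordinates. The
zero mode of `D₂ D₁ f` acts on functions and on the `Dᵢ g` as the Hamiltonian derivation `{f, ·}`.
Its action on `𝒢` is the Lie derivative of the symplectic form along a Hamiltonian vector field,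
which vanishes because the form is closed (`N2Envelope.SymplecticCoordinates.sum_lie`), and the
higher modes vanish too. Together with the contraction `∑ ω_{μν} {x^ν, f} Dᵢ x^μ = Dᵢ f` this
shows that `[𝒢_Λ f] = (2∂ + χ₁ D₁ + χ₂ D₂) f` for all functions `f`
(`N2Envelope.SymplecticCoordinates.isSuperconformalOn_vector`). Since `𝒢` is quadratic in the `Dᵢ
f`, the commutator formula turns this into the brackets of the components of `𝒢` with `𝒢`. The
central term is the double contraction `𝒢_(1) 𝒢 = ∑ ω_{μν} {x^μ, x^ν} = -n`, and as it is a
constant, the remaining brackets vanish by skew-symmetry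
(`N2Envelope.SymplecticCoordinates.lambdaBracket_vector`).
-/

/-! ### Homogeneous elements and the identities of a vertex algebra -/

namespace N2Envelope

section Identities

variable {𝕜 A Ω : Type*} [Field 𝕜] [CommRing A] [Module 𝕜 A] [AddCommGroup Ω] [Module A Ω]
  {br : A → A → A} {d : A → Ω}

variable (𝕜 br d) in
/-- The elements of parity `p` and conformal weight `w / 2`: the span of the formal expressions of
doubled weight `w` and parity `p`. -/
noncomputable def homog (w : ℤ) (p : Bool) : Submodule 𝕜 (N2Envelope 𝕜 br d) :=
  Submodule.span 𝕜 (cls 𝕜 br d '' {t | t.weight = w ∧ t.odd = p})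

lemma homog_induction {w : ℤ} {p : Bool} {P : N2Envelope 𝕜 br d → Prop}
    {a : N2Envelope 𝕜 br d} (ha : a ∈ homog 𝕜 br d w p) (h0 : P 0)
    (hadd : ∀ a b, P a → P b → P (a + b)) (hsmul : ∀ (r : 𝕜) a, P a → P (r • a))
    (hcls : ∀ t : N2Term A, t.weight = w → t.odd = p → P (cls 𝕜 br d t)) : P a := by
  refine Submodule.span_induction ?_ h0 (fun a b _ _ => hadd a b) (fun r a _ => hsmul r a) ha
  rintro _ ⟨t, ht, rfl⟩
  exact hcls t ht.1 ht.2

lemma cls_mem (t : N2Term A) : cls 𝕜 br d t ∈ homog 𝕜 br d t.weight t.odd :=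
  Submodule.subset_span ⟨t, ⟨rfl, rfl⟩, rfl⟩

lemma of_mem_homog (f : A) : (of f : N2Envelope 𝕜 br d) ∈ homog 𝕜 br d 0 false :=
  cls_mem (.of f)

lemma D_mem_homog (i : Fin 2) {w : ℤ} {p : Bool} {a : N2Envelope 𝕜 br d}
    (ha : a ∈ homog 𝕜 br d w p) : D i a ∈ homog 𝕜 br d (w + 1) (!p) := by
  refine homog_induction (P := fun a => D i a ∈ homog 𝕜 br d (w + 1) (!p)) ha ?_ ?_ ?_ ?_
  · simp
  · intro a b h h'
    rw [map_add]
    exact add_mem h h'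
  · intro r a h
    rw [map_smul]
    exact Submodule.smul_mem _ r h
  · rintro t rfl rfl
    rw [D_cls]
    exact cls_mem (.D i t)

lemma prod_mem_homog (n : ℤ) {w w' : ℤ} {p p' : Bool} {a b : N2Envelope 𝕜 br d}
    (ha : a ∈ homog 𝕜 br d w p) (hb : b ∈ homog 𝕜 br d w' p') :
    prod n a b ∈ homog 𝕜 br d (w + w' - 2 * n - 2) (p ^^ p') := by
  refine homog_induction (P := fun a => prod n a b ∈ _) ha ?_ ?_ ?_ ?_
  · simp
  · intro a b h h'
    rw [map_add]
    exact add_mem h h'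
  · intro r a h
    rw [map_smul]
    exact Submodule.smul_mem _ r h
  · rintro s rfl rfl
    refine homog_induction (P := fun b => prod n (cls 𝕜 br d s) b ∈ _) hb ?_ ?_ ?_ ?_
    · simp
    · intro a b h h'
      rw [map_add]
      exact add_mem h h'
    · intro r a h
      rw [map_smul]
      exact Submodule.smul_mem _ r h
    · rintro t rfl rfl
      rw [prod_cls]
      exact cls_mem (.prod n s t)

lemma eq_zero_of_weight_neg {w : ℤ} {p : Bool} {a : N2Envelope 𝕜 br d}
    (ha : a ∈ homog 𝕜 br d w p) (hw : w < 0) : a = 0 := by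
  refine homog_induction (P := fun a => a = 0) ha rfl ?_ ?_ ?_
  · rintro a b rfl rfl
    exact add_zero 0
  · rintro r a rfl
    exact smul_zero r
  · rintro t rfl -
    exact cls_eq_zero hw

lemma prod_eq_zero_of_weight {n w w' : ℤ} {p p' : Bool} {a b : N2Envelope 𝕜 br d}
    (ha : a ∈ homog 𝕜 br d w p) (hb : b ∈ homog 𝕜 br d w' p') (h : w + w' < 2 * n + 2) :
    prod n a b = 0 :=
  eq_zero_of_weight_neg (prod_mem_homog n ha hb) (by omega)

lemma inv_homog {w : ℤ} {p : Bool} {a : N2Envelope 𝕜 br d} (ha : a ∈ homog 𝕜 br d w p) :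
    inv a = koszul p • a := by
  refine homog_induction (P := fun a => inv a = koszul p • a) ha ?_ ?_ ?_ ?_
  · simp
  · intro a b h h'
    rw [map_add, h, h', smul_add]
  · intro r a h
    rw [map_smul, h, smul_comm]
  · rintro t - rfl
    exact inv_cls t

/-- The Leibniz rule for the odd derivation `Dᵢ`. -/
lemma D_prod_homog (i : Fin 2) (n : ℤ) {w : ℤ} {p : Bool} {a : N2Envelope 𝕜 br d}
    (ha : a ∈ homog 𝕜 br d w p) (b : N2Envelope 𝕜 br d) :
    D i (prod n a b) = prod n (D i a) b + koszul p • prod n a (D i b) := by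
  rw [D_prod, inv_homog ha, map_zsmul, LinearMap.smul_apply]

/-- The Borcherds identity for homogeneous elements. The sums are cut off at any `L` beyond which the
weights are negative. -/
lemma borcherds (m n k : ℤ) {wa wb wc : ℤ} {pa pb pc : Bool} {a b c : N2Envelope 𝕜 br d}
    (ha : a ∈ homog 𝕜 br d wa pa) (hb : b ∈ homog 𝕜 br d wb pb) (hc : c ∈ homog 𝕜 br d wc pc)
    (L : ℕ) (hab : wa + wb < 2 * (n + L) + 2) (hbc : wb + wc < 2 * (k + L) + 2)
    (hac : wa + wc < 2 * (m + L) + 2) :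
    ∑ j ∈ Finset.range L, Ring.choose m j • prod (m + k - j) (prod (n + j) a b) c =
      ∑ j ∈ Finset.range L, ((-1) ^ j * Ring.choose n j) •
        (prod (m + n - j) a (prod (k + j) b c)
          - (koszul (pa && pb) * (Int.negOnePow n : ℤ)) •
            prod (n + k - j) b (prod (m + j) a c)) := by
  rw [← sub_eq_zero, ← Finset.sum_sub_distrib]
  refine homog_induction (P := fun a => ∑ j ∈ Finset.range L, (Ring.choose m j • prod (m + k - j)
    (prod (n + j) a b) c - ((-1) ^ j * Ring.choose n j) • (prod (m + n - j) a (prod (k + j) b c)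
      - (koszul (pa && pb) * (Int.negOnePow n : ℤ)) • prod (n + k - j) b (prod (m + j) a c))) = 0)
    ha ?_ ?_ ?_ ?_
  · simp
  · intro a a' h h'
    rw [← add_zero 0]
    nth_rw 1 [← h]
    rw [← h', ← Finset.sum_add_distrib]
    refine Finset.sum_congr rfl fun i _ => ?_
    simp only [map_add, LinearMap.add_apply]
    module
  · intro r a h
    rw [← smul_zero r, ← h, Finset.smul_sum]
    refine Finset.sum_congr rfl fun i _ => ?_
    simp only [map_smul, LinearMap.smul_apply]
    module
  rintro s rfl rfl
  refine homog_induction (P := fun b => ∑ j ∈ Finset.range L, (Ring.choose m j • prod (m + k - j)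
    (prod (n + j) _ b) c - ((-1) ^ j * Ring.choose n j) • (prod (m + n - j) _ (prod (k + j) b c)
      - (koszul (_ && pb) * (Int.negOnePow n : ℤ)) • prod (n + k - j) b (prod (m + j) _ c))) = 0)
    hb ?_ ?_ ?_ ?_
  · simp
  · intro a a' h h'
    rw [← add_zero 0]
    nth_rw 1 [← h]
    rw [← h', ← Finset.sum_add_distrib]
    refine Finset.sum_congr rfl fun i _ => ?_
    simp only [map_add, LinearMap.add_apply]
    module
  · intro r a h
    rw [← smul_zero r, ← h, Finset.smul_sum]
    refine Finset.sum_congr rfl fun i _ => ?_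
    simp only [map_smul, LinearMap.smul_apply]
    module
  rintro t rfl rfl
  refine homog_induction (P := fun c => ∑ j ∈ Finset.range L, (Ring.choose m j • prod (m + k - j)
    (prod (n + j) _ _) c - ((-1) ^ j * Ring.choose n j) • (prod (m + n - j) _ (prod (k + j) _ c)
      - (koszul (_ && _) * (Int.negOnePow n : ℤ)) • prod (n + k - j) _ (prod (m + j) _ c))) = 0)
    hc ?_ ?_ ?_ ?_
  · simp
  · intro a a' h h'
    rw [← add_zero 0]
    nth_rw 1 [← h]
    rw [← h', ← Finset.sum_add_distrib]
    refine Finset.sum_congr rfl fun i _ => ?_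
    simp only [map_add]
    module
  · intro r a h
    rw [← smul_zero r, ← h, Finset.smul_sum]
    refine Finset.sum_congr rfl fun i _ => ?_
    simp only [map_smul]
    module
  rintro u rfl -
  have h := mk_rel (N2Rel.borcherds (𝕜 := 𝕜) (br := br) (d := d) m n k s t u L hab hbc hac)
  rw [← Finset.sum_sub_distrib, map_sum] at h
  refine Eq.trans (Finset.sum_congr rfl fun j _ => ?_) h
  simp only [map_sub, map_zsmul, prod_cls]
  rfl

/-- The commutator formula `[a_(m), b_(k)] = ∑ⱼ C(m, j) (a_(j) b)_(m+k-j)` for `m ≥ 0`. -/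
lemma commutator (m : ℕ) (k : ℤ) {wa wb wc : ℤ} {pa pb pc : Bool} {a b c : N2Envelope 𝕜 br d}
    (ha : a ∈ homog 𝕜 br d wa pa) (hb : b ∈ homog 𝕜 br d wb pb) (hc : c ∈ homog 𝕜 br d wc pc) :
    prod m a (prod k b c) = koszul (pa && pb) • prod k b (prod m a c)
      + ∑ j ∈ Finset.range (m + 1), m.choose j • prod (m + k - j) (prod j a b) c := by
  obtain ⟨L, hL, h1, h2, h3⟩ : ∃ L : ℕ, m + 1 ≤ L ∧ wa + wb < 2 * (0 + L) + 2 ∧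
      wb + wc < 2 * (k + L) + 2 ∧ wa + wc < 2 * ((m : ℤ) + L) + 2 := by
    refine ⟨m + 1 + (wa + wb).natAbs + (wb + wc).natAbs + k.natAbs + (wa + wc).natAbs,
      ?_, ?_, ?_, ?_⟩ <;> omega
  -- For `n = 0` only the term `j = 0` of the right-hand side is nonzero.
  have h := borcherds m 0 k ha hb hc L h1 h2 h3
  rw [← Finset.sum_subset (Finset.range_subset_range.2 hL)] at h
  swap
  · intro j _ hj
    rw [Finset.mem_range, not_lt] at hj
    rw [Ring.choose_natCast, Nat.choose_eq_zero_of_lt (by omega)]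
    simp
  rw [Finset.sum_eq_single_of_mem (s := Finset.range L) 0 (Finset.mem_range.2 (by omega))] at h
  swap
  · intro j _ hj
    rw [Ring.choose_zero_pos _ (Nat.pos_of_ne_zero hj)]
    simp
  simp only [Ring.choose_natCast, zero_add, natCast_zsmul] at h
  rw [h]
  simp

/-- The commutator formula for `m = 0`: the zero modes are derivations of all products. -/
lemma prod_zero_prod (k : ℤ) {wa wb wc : ℤ} {pa pb pc : Bool} {a b c : N2Envelope 𝕜 br d}
    (ha : a ∈ homog 𝕜 br d wa pa) (hb : b ∈ homog 𝕜 br d wb pb) (hc : c ∈ homog 𝕜 br d wc pc) :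
    prod 0 a (prod k b c) = prod k (prod 0 a b) c + koszul (pa && pb) • prod k b (prod 0 a c) := by
  have h := commutator 0 k ha hb hc
  simp only [Nat.cast_zero, zero_add, Finset.sum_range_one, Nat.choose_self, one_smul,
    sub_zero] at h
  rw [h, add_comm]

lemma prod_one_nord {wa wb wc : ℤ} {pa pb pc : Bool} {a b c : N2Envelope 𝕜 br d}
    (ha : a ∈ homog 𝕜 br d wa pa) (hb : b ∈ homog 𝕜 br d wb pb) (hc : c ∈ homog 𝕜 br d wc pc) :
    prod 1 a (prod (-1) b c) = prod (-1) (prod 1 a b) c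
      + koszul (pa && pb) • prod (-1) b (prod 1 a c) + prod 0 (prod 0 a b) c := by
  have h := commutator 1 (-1) ha hb hc
  simp only [Nat.cast_one, Finset.sum_range_succ, Finset.sum_range_zero] at h
  norm_num at h
  rw [h]
  abel

lemma prod_two_nord {wa wb wc : ℤ} {pa pb pc : Bool} {a b c : N2Envelope 𝕜 br d}
    (ha : a ∈ homog 𝕜 br d wa pa) (hb : b ∈ homog 𝕜 br d wb pb) (hc : c ∈ homog 𝕜 br d wc pc) :
    prod 2 a (prod (-1) b c) = prod (-1) (prod 2 a b) c
      + koszul (pa && pb) • prod (-1) b (prod 2 a c) + prod 1 (prod 0 a b) c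
      + 2 • prod 0 (prod 1 a b) c := by
  have h := commutator 2 (-1) ha hb hc
  simp only [Nat.cast_ofNat, Finset.sum_range_succ, Finset.sum_range_zero] at h
  norm_num at h
  rw [h]
  abel

/-- The modes of a normally ordered product:
`(a_(-1) b)_(k) = ∑ⱼ (a_(-1-j) b_(k+j) + (-1)^{|a||b|} b_(k-1-j) a_(j))`. -/
lemma nord_prod (k : ℤ) {wa wb wc : ℤ} {pa pb pc : Bool} {a b c : N2Envelope 𝕜 br d}
    (ha : a ∈ homog 𝕜 br d wa pa) (hb : b ∈ homog 𝕜 br d wb pb) (hc : c ∈ homog 𝕜 br d wc pc)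
    (L : ℕ) (hab : wa + wb < 2 * L) (hbc : wb + wc < 2 * (k + L) + 2)
    (hac : wa + wc < 2 * L + 2) :
    prod k (prod (-1) a b) c = ∑ j ∈ Finset.range L, (prod (-1 - j) a (prod (k + j) b c)
      + koszul (pa && pb) • prod (k - 1 - j) b (prod j a c)) := by
  -- For `m = 0` only the term `j = 0` of the left-hand side is nonzero.
  have h := borcherds 0 (-1) k ha hb hc (L + 1) (by push_cast; omega) (by push_cast; omega)
    (by push_cast; omega)
  rw [Finset.sum_eq_single_of_mem 0 (Finset.mem_range.2 (by omega))] at h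
  swap
  · intro j _ hj
    rw [Ring.choose_zero_pos _ (Nat.pos_of_ne_zero hj)]
    simp
  rw [Finset.sum_range_succ, prod_eq_zero_of_weight hb hc (by omega),
    prod_eq_zero_of_weight ha hc (by omega)] at h
  simp only [map_zero, smul_zero, sub_zero, add_zero, Ring.choose_zero_right, one_smul, zero_add,
    Nat.cast_zero] at h
  rw [h]
  refine Finset.sum_congr rfl fun j _ => ?_
  have e : ((-1) ^ j * Ring.choose (-1 : ℤ) j : ℤ) = 1 := by
    rw [Ring.choose_neg, add_sub_cancel_left, Ring.choose_natCast, Nat.choose_self]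
    simp [Int.negOnePow_def, Units.smul_def, ← mul_pow]
  have e' : (-1 : ℤ) + k - j = k - 1 - j := by ring
  rw [e, one_smul, e']
  simp

/-- Skew-symmetry `b_(n) a = -(-1)^{n+|a||b|} ∑ⱼ (-1)ʲ (∂ʲ / j!) (a_(n+j) b)`, where
`(∂ʲ / j!) v = v_(-1-j) |0⟩`. -/
lemma skew_symmetry (n : ℤ) {wa wb : ℤ} {pa pb : Bool} {a b : N2Envelope 𝕜 br d}
    (ha : a ∈ homog 𝕜 br d wa pa) (hb : b ∈ homog 𝕜 br d wb pb)
    (L : ℕ) (hab : wa + wb < 2 * (n + L) + 2) :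
    prod n b a = -(koszul (pa && pb) * (Int.negOnePow n : ℤ)) •
      ∑ j ∈ Finset.range L, ((-1) ^ j : ℤ) • prod (-1 - j) (prod (n + j) a b) (of 1) := by
  obtain ⟨L', hL, h1, h2, h3⟩ : ∃ L' : ℕ, L + 1 ≤ L' ∧ wa + wb < 2 * (n + L') + 2 ∧
      wb + 0 < 2 * ((0 : ℤ) + L') + 2 ∧ wa + 0 < 2 * ((-1 : ℤ) + L') + 2 := by
    refine ⟨L + 1 + (wa + wb).natAbs + n.natAbs + wb.natAbs + wa.natAbs, ?_, ?_, ?_, ?_⟩ <;> omega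
  -- The Borcherds identity for `m = -1`, `k = 0` and the vacuum as third element: on the right-hand
  -- side only `b_(n) (a_(-1) |0⟩) = b_(n) a` survives.
  have h := borcherds (-1) n 0 ha hb (of_mem_homog (1 : A)) L' h1 h2 h3
  rw [← Finset.sum_subset (Finset.range_subset_range.2 (show L ≤ L' by omega))] at h
  swap
  · intro j _ hj
    rw [Finset.mem_range, not_lt] at hj
    rw [prod_eq_zero_of_weight ha hb (by omega)]
    simp
  rw [Finset.sum_eq_single_of_mem (s := Finset.range L') 0 (Finset.mem_range.2 (by omega))] at h
  swap
  · intro j _ hj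
    rw [prod_vac (by omega), prod_vac (by omega)]
    simp
  have e : ∀ j : ℕ, Ring.choose (-1 : ℤ) j = (-1) ^ j := by
    intro j
    rw [Ring.choose_neg, add_sub_cancel_left, Ring.choose_natCast, Nat.choose_self]
    simp [Int.negOnePow_def, Units.smul_def]
  simp only [e, Ring.choose_zero_right, Nat.cast_zero, add_zero, sub_zero, pow_zero, mul_one,
    one_smul, prod_vac le_rfl, map_zero, zero_sub, prod_vac_neg_one] at h
  rw [h, neg_smul, smul_neg, neg_neg, smul_smul]
  have e1 : ∀ p, koszul p * koszul p = 1 := koszul_mul_self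
  have e2 : ((Int.negOnePow n : ℤˣ) : ℤ) * (Int.negOnePow n : ℤ) = 1 := by
    rw [← Units.val_mul, ← Int.negOnePow_add, Int.negOnePow_even _ (Even.add_self n),
      Units.val_one]
  rw [mul_mul_mul_comm, e1, e2, mul_one, one_smul]

end Identities

end N2Envelope

/-! ### Operator products of the generators -/

namespace N2Envelope

section Generators

variable {𝕜 A Ω : Type*} [Field 𝕜] [CommRing A] [Module 𝕜 A] [AddCommGroup Ω] [Module A Ω]
  {br : A → A → A} {d : A → Ω}

/-- The operator product of `a` and `b` is regular: `a_(n) b = 0` for all `n ≥ 0`. -/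
def Regular (a b : N2Envelope 𝕜 br d) : Prop := ∀ n : ℤ, 0 ≤ n → prod n a b = 0

lemma regular_of_weight_neg {w w' : ℤ} {p p' : Bool} {a b : N2Envelope 𝕜 br d}
    (ha : a ∈ homog 𝕜 br d w p) (hb : b ∈ homog 𝕜 br d w' p') (h : w + w' < 2) : Regular a b :=
  fun _ _ => prod_eq_zero_of_weight ha hb (by omega)

lemma mem_homog_of_eq {w w' : ℤ} {p p' : Bool} {a : N2Envelope 𝕜 br d}
    (ha : a ∈ homog 𝕜 br d w p) (hw : w = w') (hp : p = p') : a ∈ homog 𝕜 br d w' p' := by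
  rwa [← hw, ← hp]

section Products

variable {wa wb wc : ℤ} {pa pb pc : Bool} {a b c : N2Envelope 𝕜 br d}

lemma nord_comm (ha : a ∈ homog 𝕜 br d wa pa) (hb : b ∈ homog 𝕜 br d wb pb) (h : Regular a b) :
    prod (-1) b a = koszul (pa && pb) • prod (-1) a b := by
  rw [skew_symmetry (-1) ha hb (1 + (wa + wb).natAbs) (by omega),
    Finset.sum_eq_single_of_mem 0 (Finset.mem_range.2 (by omega))]
  · simp [prod_vac_neg_one]
  · intro j _ hj
    rw [h _ (by omega)]
    simp

lemma Regular.symm (ha : a ∈ homog 𝕜 br d wa pa) (hb : b ∈ homog 𝕜 br d wb pb)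
    (h : Regular a b) : Regular b a := by
  intro n hn
  rw [skew_symmetry n ha hb (wa + wb).natAbs (by omega), Finset.sum_eq_zero, smul_zero]
  intro j _
  rw [h _ (by omega)]
  simp

lemma nord_assoc (ha : a ∈ homog 𝕜 br d wa pa) (hb : b ∈ homog 𝕜 br d wb pb)
    (hc : c ∈ homog 𝕜 br d wc pc) (hbc : Regular b c) (hac : Regular a c) :
    prod (-1) (prod (-1) a b) c = prod (-1) a (prod (-1) b c) := by
  rw [nord_prod (-1) ha hb hc (1 + (wa + wb).natAbs + (wb + wc).natAbs + (wa + wc).natAbs)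
    (by omega) (by omega) (by omega),
    Finset.sum_eq_single_of_mem 0 (Finset.mem_range.2 (by omega))]
  · simp [hac 0 le_rfl]
  · intro j _ hj
    rw [hac _ (by omega), hbc _ (by omega)]
    simp

lemma nord_left_comm (ha : a ∈ homog 𝕜 br d wa pa) (hb : b ∈ homog 𝕜 br d wb pb)
    (hc : c ∈ homog 𝕜 br d wc pc) (hab : Regular a b) (hbc : Regular b c) (hac : Regular a c) :
    prod (-1) b (prod (-1) a c) = koszul (pa && pb) • prod (-1) a (prod (-1) b c) := by
  rw [← nord_assoc hb ha hc hac hbc, nord_comm ha hb hab, map_zsmul, LinearMap.smul_apply,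
    nord_assoc ha hb hc hbc hac]

lemma Regular.nord_right (ha : a ∈ homog 𝕜 br d wa pa) (hb : b ∈ homog 𝕜 br d wb pb)
    (hc : c ∈ homog 𝕜 br d wc pc) (hab : Regular a b) (hac : Regular a c) :
    Regular a (prod (-1) b c) := by
  intro n hn
  obtain ⟨m, rfl⟩ := Int.eq_ofNat_of_zero_le hn
  rw [commutator m (-1) ha hb hc, hac _ hn, Finset.sum_eq_zero]
  · simp
  · intro j _
    rw [hab _ (by omega)]
    simp

/-- The zero mode of a normally ordered product, when only the zero modes of the factors act. -/
lemma nord_prod_zero (ha : a ∈ homog 𝕜 br d wa pa) (hb : b ∈ homog 𝕜 br d wb pb)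
    (hc : c ∈ homog 𝕜 br d wc pc) (hbc : ∀ n : ℤ, 1 ≤ n → prod n b c = 0)
    (hac : ∀ n : ℤ, 1 ≤ n → prod n a c = 0) :
    prod 0 (prod (-1) a b) c =
      prod (-1) a (prod 0 b c) + koszul (pa && pb) • prod (-1) b (prod 0 a c) := by
  rw [nord_prod 0 ha hb hc (1 + (wa + wb).natAbs + (wb + wc).natAbs + (wa + wc).natAbs)
    (by omega) (by omega) (by omega),
    Finset.sum_eq_single_of_mem 0 (Finset.mem_range.2 (by omega))]
  · simp
  · intro j _ hj
    rw [hac _ (by omega), hbc _ (by omega)]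
    simp

lemma del_prod_homog (n : ℤ) (ha : a ∈ homog 𝕜 br d wa pa) (b : N2Envelope 𝕜 br d) :
    D 0 (D 0 (prod n a b)) = prod n (D 0 (D 0 a)) b + prod n a (D 0 (D 0 b)) := by
  rw [D_prod_homog 0 n ha, map_add, map_zsmul, D_prod_homog 0 n ha,
    D_prod_homog 0 n (D_mem_homog 0 ha), smul_add, smul_smul, koszul_mul_self, koszul_not]
  module

end Products

lemma of_add (f g : A) : (of (f + g) : N2Envelope 𝕜 br d) = of f + of g := by
  have h := mk_rel (N2Rel.add (𝕜 := 𝕜) (br := br) (d := d) f g)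
  rwa [map_sub, map_sub, sub_sub, sub_eq_zero] at h

variable (𝕜 br d) in
/-- The additive map that sends a function to its class. -/
noncomputable def ofHom : A →+ N2Envelope 𝕜 br d := AddMonoidHom.mk' of of_add

lemma of_sum {ι : Type*} (s : Finset ι) (f : ι → A) :
    (of (∑ i ∈ s, f i) : N2Envelope 𝕜 br d) = ∑ i ∈ s, of (f i) :=
  map_sum (ofHom 𝕜 br d) f s

lemma of_neg (f : A) : (of (-f) : N2Envelope 𝕜 br d) = -of f :=
  map_neg (ofHom 𝕜 br d) f

lemma of_zero : (of 0 : N2Envelope 𝕜 br d) = 0 :=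
  map_zero (ofHom 𝕜 br d)

lemma of_mul (f g : A) : (of (f * g) : N2Envelope 𝕜 br d) = prod (-1) (of f) (of g) := by
  have h := mk_rel (N2Rel.mul (𝕜 := 𝕜) (br := br) (d := d) f g)
  rw [map_sub, sub_eq_zero] at h
  exact h.trans (prod_cls _ _ _).symm

lemma D_of_eq_sum (i : Fin 2) {k : ℕ} {f : A} {h g : Fin k → A} (hd : d f = ∑ l, h l • d (g l)) :
    (D i (of f) : N2Envelope 𝕜 br d) = ∑ l, prod (-1) (of (h l)) (D i (of (g l))) := by
  have h := mk_rel (N2Rel.diff (𝕜 := 𝕜) (br := br) i f k h g hd)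
  rw [map_sub, sub_eq_zero, map_sum] at h
  refine (D_cls i _).trans (h.trans (Finset.sum_congr rfl fun l _ => ?_))
  exact ((congrArg _ (D_cls i _)).trans (prod_cls _ _ _)).symm

lemma D_of_mem (i : Fin 2) (f : A) : D i (of f : N2Envelope 𝕜 br d) ∈ homog 𝕜 br d 1 true :=
  mem_homog_of_eq (D_mem_homog i (of_mem_homog f)) (by norm_num) rfl

lemma DD_of_mem (f : A) : D 1 (D 0 (of f : N2Envelope 𝕜 br d)) ∈ homog 𝕜 br d 2 false :=
  mem_homog_of_eq (D_mem_homog 1 (D_of_mem 0 f)) (by norm_num) rfl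

lemma regular_of_of (f g : A) : Regular (of f : N2Envelope 𝕜 br d) (of g) :=
  regular_of_weight_neg (of_mem_homog f) (of_mem_homog g) (by omega)

lemma regular_of_D (f g : A) (i : Fin 2) : Regular (of f : N2Envelope 𝕜 br d) (D i (of g)) :=
  regular_of_weight_neg (of_mem_homog f) (D_of_mem i g) (by omega)

lemma regular_D_of (f g : A) (i : Fin 2) : Regular (D i (of f) : N2Envelope 𝕜 br d) (of g) :=
  regular_of_weight_neg (D_of_mem i f) (of_mem_homog g) (by omega)

lemma D_prod_D_eq_zero (f g : A) (i j : Fin 2) (n : ℤ) (hn : 1 ≤ n) :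
    prod n (D i (of f) : N2Envelope 𝕜 br d) (D j (of g)) = 0 :=
  prod_eq_zero_of_weight (D_of_mem i f) (D_of_mem j g) (by omega)

/-- `(Dⱼ f)_(0) (Dᵢ g) = (Dᵢ Dⱼ f)_(0) g`, because `(Dⱼ f)_(0) g = 0`. -/
lemma D_prod_zero_D (f g : A) (i j : Fin 2) :
    prod 0 (D j (of f) : N2Envelope 𝕜 br d) (D i (of g)) = prod 0 (D i (D j (of f))) (of g) := by
  have h := D_prod_homog i 0 (D_of_mem (𝕜 := 𝕜) (br := br) (d := d) j f) (of g)
  rw [regular_D_of f g j 0 le_rfl, map_zero] at h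
  simp only [koszul, if_true, neg_smul, one_smul] at h
  exact (add_neg_eq_zero.1 h.symm).symm

lemma bracket_of (f g : A) :
    prod 0 (D 1 (D 0 (of f)) : N2Envelope 𝕜 br d) (of g) = of (br f g) := by
  have h := mk_rel (N2Rel.bracket (𝕜 := 𝕜) (br := br) (d := d) f g)
  rw [map_sub, sub_eq_zero] at h
  refine Eq.trans ?_ h
  exact (congrArg (fun x => prod 0 x (of g)) ((congrArg _ (D_cls 0 _)).trans (D_cls 1 _))).trans
    (prod_cls _ _ _)

lemma D0_prod_D1 (f g : A) :
    prod 0 (D 0 (of f) : N2Envelope 𝕜 br d) (D 1 (of g)) = of (br f g) := by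
  rw [D_prod_zero_D, bracket_of]

lemma D1_prod_D0 (f g : A) :
    prod 0 (D 1 (of f) : N2Envelope 𝕜 br d) (D 0 (of g)) = -of (br f g) := by
  rw [D_prod_zero_D, ← neg_neg (D 0 (D 1 (of f))), ← D_anticomm, map_neg, LinearMap.neg_apply,
    bracket_of]

lemma del_prod_zero (a b : N2Envelope 𝕜 br d) : prod 0 (D 0 (D 0 a)) b = 0 := by
  rw [del_prod, neg_zero, zero_smul]

lemma regular_D_D (f g : A) (i : Fin 2) :
    Regular (D i (of f) : N2Envelope 𝕜 br d) (D i (of g)) := by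
  intro n hn
  rcases hn.eq_or_lt with rfl | hn
  · rw [D_prod_zero_D]
    fin_cases i
    · exact del_prod_zero _ _
    · exact (congrArg (fun x => prod 0 x (of g)) (D_sq (of f))).trans (del_prod_zero _ _)
  · exact D_prod_D_eq_zero f g i i n (by omega)

/-- The zero mode of `D₂ D₁ f` is the Hamiltonian derivation `{f, ·}` on the odd generators. -/
lemma DD_prod_zero_D (f g : A) (i : Fin 2) :
    prod 0 (D 1 (D 0 (of f)) : N2Envelope 𝕜 br d) (D i (of g)) = D i (of (br f g)) := by
  have h := D_prod_homog i 0 (DD_of_mem (𝕜 := 𝕜) (br := br) (d := d) f) (of g)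
  have e : prod 0 (D i (D 1 (D 0 (of f))) : N2Envelope 𝕜 br d) (of g) = 0 := by
    fin_cases i
    · change prod 0 (D 0 (D 1 (D 0 (of f))) : N2Envelope 𝕜 br d) (of g) = 0
      rw [← neg_neg (D 0 (D 1 _)), ← D_anticomm, ← D_sq, D_sq (D 1 (of f)), map_neg,
        LinearMap.neg_apply, del_prod_zero, neg_zero]
    · change prod 0 (D 1 (D 1 (D 0 (of f))) : N2Envelope 𝕜 br d) (of g) = 0
      rw [D_sq, del_prod_zero]
  rw [bracket_of, e, zero_add] at h
  simpa [koszul] using h.symm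

lemma DD_prod_of_eq_zero (f g : A) (n : ℤ) (hn : 1 ≤ n) :
    prod n (D 1 (D 0 (of f)) : N2Envelope 𝕜 br d) (of g) = 0 :=
  prod_eq_zero_of_weight (DD_of_mem f) (of_mem_homog g) (by omega)

lemma DD_prod_D_eq_zero (f g : A) (i : Fin 2) (n : ℤ) (hn : 1 ≤ n) :
    prod n (D 1 (D 0 (of f)) : N2Envelope 𝕜 br d) (D i (of g)) = 0 :=
  prod_eq_zero_of_weight (DD_of_mem f) (D_of_mem i g) (by omega)

/-! ### Quadratic expressions in the odd generators -/

variable (𝕜 br d) in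
/-- The expression `:h (Dᵢ f Dᵢ g):`. -/
noncomputable def quad (i : Fin 2) (h f g : A) : N2Envelope 𝕜 br d :=
  prod (-1) (of h) (prod (-1) (D i (of f)) (D i (of g)))

lemma D_nord_D_mem (i : Fin 2) (f g : A) :
    prod (-1) (D i (of f)) (D i (of g)) ∈ homog 𝕜 br d 2 false :=
  mem_homog_of_eq (prod_mem_homog (-1) (D_of_mem i f) (D_of_mem i g)) (by norm_num) rfl

lemma quad_mem (i : Fin 2) (h f g : A) : quad 𝕜 br d i h f g ∈ homog 𝕜 br d 2 false :=
  mem_homog_of_eq (prod_mem_homog (-1) (of_mem_homog h) (D_nord_D_mem i f g)) (by norm_num) rfl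

lemma regular_of_D_nord_D (f g h : A) (i : Fin 2) :
    Regular (of f : N2Envelope 𝕜 br d) (prod (-1) (D i (of g)) (D i (of h))) :=
  (regular_of_D f g i).nord_right (of_mem_homog f) (D_of_mem i g) (D_of_mem i h)
    (regular_of_D f h i)

lemma D_nord_D_comm (i : Fin 2) (f g : A) :
    prod (-1) (D i (of f) : N2Envelope 𝕜 br d) (D i (of g)) =
      -prod (-1) (D i (of g)) (D i (of f)) := by
  rw [nord_comm (D_of_mem i g) (D_of_mem i f) (regular_D_D g f i)]
  simp [koszul]

lemma quad_add (i : Fin 2) (h h' f g : A) :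
    quad 𝕜 br d i (h + h') f g = quad 𝕜 br d i h f g + quad 𝕜 br d i h' f g := by
  simp only [quad, of_add, map_add, LinearMap.add_apply]

lemma quad_sum {ι : Type*} (s : Finset ι) (i : Fin 2) (h : ι → A) (f g : A) :
    quad 𝕜 br d i (∑ j ∈ s, h j) f g = ∑ j ∈ s, quad 𝕜 br d i (h j) f g := by
  simp only [quad, of_sum, map_sum, LinearMap.sum_apply]

lemma quad_zero (i : Fin 2) (f g : A) : quad 𝕜 br d i 0 f g = 0 := by
  simp only [quad, of_zero, map_zero, LinearMap.zero_apply]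

lemma of_nord_D_mem (i : Fin 2) (h f : A) :
    prod (-1) (of h : N2Envelope 𝕜 br d) (D i (of f)) ∈ homog 𝕜 br d 1 true :=
  mem_homog_of_eq (prod_mem_homog (-1) (of_mem_homog h) (D_of_mem i f)) (by norm_num) rfl

/-- Functions can be moved from the second odd factor to the front. -/
lemma nord_of_D_right (i : Fin 2) (h h' f g : A) :
    prod (-1) (of h : N2Envelope 𝕜 br d) (prod (-1) (D i (of f)) (prod (-1) (of h') (D i (of g))))
      = quad 𝕜 br d i (h * h') f g := by
  rw [nord_left_comm (of_mem_homog h') (D_of_mem i f) (D_of_mem i g) (regular_of_D h' f i)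
    (regular_D_D f g i) (regular_of_D h' g i), quad, of_mul,
    nord_assoc (of_mem_homog h) (of_mem_homog h')
    (D_nord_D_mem i f g) (regular_of_D_nord_D h' f g i) (regular_of_D_nord_D h f g i)]
  simp [koszul]

/-- The expansion of `:h (Dᵢ f Dᵢ g):` when `df` and `dg` are expressed through the differentials of
other functions. There are no corrections from reordering, since all factors have regular operator
products with each other. -/
lemma quad_expand (i : Fin 2) (h : A) {k : ℕ} {f g : A} {u v x : Fin k → A}
    (hf : d f = ∑ l, u l • d (x l)) (hg : d g = ∑ l, v l • d (x l)) :
    quad 𝕜 br d i h f g = ∑ l, ∑ l', quad 𝕜 br d i (h * u l * v l') (x l) (x l') := by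
  rw [quad, D_of_eq_sum i hf, D_of_eq_sum i hg]
  simp only [map_sum, LinearMap.sum_apply]
  rw [Finset.sum_comm]
  refine Finset.sum_congr rfl fun l _ => Finset.sum_congr rfl fun l' _ => ?_
  rw [nord_assoc (of_mem_homog _) (D_of_mem i _) (of_nord_D_mem i _ _)
    ((regular_D_of _ _ i).nord_right (D_of_mem i _) (of_mem_homog _) (D_of_mem i _)
      (regular_D_D _ _ i))
    ((regular_of_of _ _).nord_right (of_mem_homog _) (of_mem_homog _) (D_of_mem i _)
      (regular_of_D _ _ i)), nord_of_D_right, quad, ← nord_assoc (of_mem_homog _)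
    (of_mem_homog _) (D_nord_D_mem i _ _) (regular_of_D_nord_D _ _ _ i)
    (regular_of_D_nord_D _ _ _ i), ← of_mul, quad, mul_assoc]

/-- The zero mode of `:h (Dᵢ f Dᵢ g):` on elements of weight at most `½`. -/
lemma quad_prod_zero (i : Fin 2) (h f g : A) {w : ℤ} {p : Bool} {c : N2Envelope 𝕜 br d}
    (hc : c ∈ homog 𝕜 br d w p) (hw : w ≤ 1) :
    prod 0 (quad 𝕜 br d i h f g) c = prod (-1) (of h)
      (prod (-1) (D i (of f)) (prod 0 (D i (of g)) c)
        - prod (-1) (D i (of g)) (prod 0 (D i (of f)) c)) := by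
  rw [quad, nord_prod_zero (of_mem_homog h) (D_nord_D_mem i f g) hc
    (fun n hn => prod_eq_zero_of_weight (D_nord_D_mem i f g) hc (by omega))
    (fun n hn => prod_eq_zero_of_weight (of_mem_homog h) hc (by omega)),
    prod_eq_zero_of_weight (of_mem_homog h) hc (by omega),
    nord_prod_zero (D_of_mem i f) (D_of_mem i g) hc
    (fun n hn => prod_eq_zero_of_weight (D_of_mem i g) hc (by omega))
    (fun n hn => prod_eq_zero_of_weight (D_of_mem i f) hc (by omega))]
  simp [koszul, sub_eq_add_neg]

/-- The modes of `D₂ D₁ e` act on quadratic expressions by the Lie derivative along the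
Hamiltonian vector field of `e`. -/
lemma DD_prod_zero_quad (e : A) (i : Fin 2) (h f g : A) :
    prod 0 (D 1 (D 0 (of e))) (quad 𝕜 br d i h f g) = quad 𝕜 br d i (br e h) f g
      + quad 𝕜 br d i h (br e f) g + quad 𝕜 br d i h f (br e g) := by
  rw [quad, prod_zero_prod (-1) (DD_of_mem e) (of_mem_homog h) (D_nord_D_mem i f g),
    prod_zero_prod (-1) (DD_of_mem e) (D_of_mem i f) (D_of_mem i g)]
  simp only [DD_prod_zero_D, bracket_of, quad, koszul, Bool.false_and, Bool.false_eq_true, if_false,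
    one_smul, map_add]
  abel

lemma DD_prod_quad_eq_zero (e : A) (i : Fin 2) (h f g : A) (n : ℤ) (hn : 1 ≤ n) :
    prod n (D 1 (D 0 (of e))) (quad 𝕜 br d i h f g) = 0 := by
  rcases hn.eq_or_lt with rfl | hn
  · rw [quad, prod_one_nord (DD_of_mem e) (of_mem_homog h) (D_nord_D_mem i f g),
      prod_one_nord (DD_of_mem e) (D_of_mem i f) (D_of_mem i g)]
    simp only [DD_prod_zero_D, bracket_of, DD_prod_of_eq_zero _ _ 1 le_rfl,
      DD_prod_D_eq_zero _ _ _ 1 le_rfl, regular_D_D _ _ _ 0 le_rfl,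
      regular_of_D_nord_D _ _ _ _ 0 le_rfl, map_zero, LinearMap.zero_apply, smul_zero, add_zero]
  · exact prod_eq_zero_of_weight (DD_of_mem e) (quad_mem i h f g) (by omega)

end Generators

end N2Envelope

/-! ### Fields that act on functions as a superconformal vector does -/

namespace N2Envelope

section Superconformal

variable {𝕜 A Ω : Type*} [Field 𝕜] [CommRing A] [Module 𝕜 A] [AddCommGroup Ω] [Module A Ω]
  {br : A → A → A} {d : A → Ω}

/-- `G` is even of weight `1`, its zero mode kills functions and rotates `D₁ f` and `D₂ f` into each
other, and it has a regular operator product with every `D₂ D₁ f`. These properties say that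
`[G_Λ f] = (2∂ + χ₁ D₁ + χ₂ D₂) f` for all functions `f`. -/
structure IsSuperconformalOn (G : N2Envelope 𝕜 br d) : Prop where
  mem : G ∈ homog 𝕜 br d 2 false
  prod_of : ∀ f : A, prod 0 G (of f) = 0
  prod_D1 : ∀ f : A, prod 0 G (D 1 (of f)) = D 0 (of f)
  prod_D0 : ∀ f : A, prod 0 G (D 0 (of f)) = -D 1 (of f)
  regular : ∀ f : A, Regular (D 1 (D 0 (of f))) G

namespace IsSuperconformalOn

variable {G : N2Envelope 𝕜 br d} (hG : IsSuperconformalOn G)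

include hG

lemma D_mem (i : Fin 2) : D i G ∈ homog 𝕜 br d 3 true :=
  mem_homog_of_eq (D_mem_homog i hG.mem) (by norm_num) rfl

lemma DD_mem : D 1 (D 0 G) ∈ homog 𝕜 br d 4 false :=
  mem_homog_of_eq (D_mem_homog 1 (hG.D_mem 0)) (by norm_num) rfl

lemma regular_DD (f : A) : Regular G (D 1 (D 0 (of f))) :=
  (hG.regular f).symm (DD_of_mem f) hG.mem

lemma D1_prod_of (f : A) : prod 0 (D 1 G) (of f) = -D 0 (of f) := by
  have h := D_prod_homog 1 0 hG.mem (of f)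
  rw [hG.prod_of, hG.prod_D1, map_zero] at h
  simp only [koszul, Bool.false_eq_true, if_false, one_smul] at h
  exact eq_neg_of_add_eq_zero_left h.symm

lemma D0_prod_of (f : A) : prod 0 (D 0 G) (of f) = D 1 (of f) := by
  have h := D_prod_homog 0 0 hG.mem (of f)
  rw [hG.prod_of, hG.prod_D0, map_zero] at h
  simp only [koszul, Bool.false_eq_true, if_false, one_smul] at h
  exact (add_neg_eq_zero.1 h.symm)

lemma D_prod_of_eq_zero (i : Fin 2) (f : A) (n : ℤ) (hn : 1 ≤ n) : prod n (D i G) (of f) = 0 :=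
  prod_eq_zero_of_weight (hG.D_mem i) (of_mem_homog f) (by omega)

/-- By the Leibniz rule, since `G` has a regular operator product with `D₁ D₂ f = -D₂ D₁ f`. -/
lemma D0_prod_D1 (f : A) (n : ℤ) (hn : 0 ≤ n) :
    prod n (D 0 G) (D 1 (of f)) = if n = 0 then D 0 (D 0 (of f)) else 0 := by
  have h := D_prod_homog 0 n hG.mem (D 1 (of f))
  have e : prod n G (D 0 (D 1 (of f))) = 0 := by
    rw [← neg_neg (D 0 (D 1 (of f))), ← D_anticomm, map_neg, hG.regular_DD f n hn, neg_zero]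
  rw [e, smul_zero, add_zero] at h
  rw [← h]
  split_ifs with h0
  · rw [h0, hG.prod_D1]
  · rw [prod_eq_zero_of_weight hG.mem (D_of_mem 1 f) (by omega), map_zero]

lemma DD_prod_of (f : A) (n : ℤ) (hn : 0 ≤ n) :
    prod n (D 1 (D 0 G)) (of f) = if n = 0 then 2 • D 0 (D 0 (of f)) else 0 := by
  have h := D_prod_homog 1 n (hG.D_mem 0) (of f)
  rw [hG.D0_prod_D1 f n hn] at h
  split_ifs at h ⊢ with h0
  · rw [h0, hG.D0_prod_of, D_sq] at h
    simp only [koszul, if_true, neg_smul, one_smul] at h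
    rw [h0, two_smul]
    exact (eq_add_of_add_neg_eq h.symm)
  · rw [hG.D_prod_of_eq_zero 0 f n (by omega), map_zero, smul_zero, add_zero] at h
    exact h.symm

lemma D1_prod_zero_D (f : A) (i : Fin 2) : prod 0 (D 1 G) (D i (of f)) = -D 0 (D i (of f)) := by
  have h := D_prod_homog i 0 (hG.D_mem 1) (of f)
  rw [hG.D1_prod_of] at h
  simp only [koszul, if_true, neg_smul, one_smul] at h
  fin_cases i
  · change D 0 _ = prod 0 (D 0 (D 1 G)) (of f) + -prod 0 (D 1 G) (D 0 (of f)) at h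
    change prod 0 (D 1 G) (D 0 (of f)) = -D 0 (D 0 (of f))
    rw [← neg_neg (D 0 (D 1 G)), ← D_anticomm, map_neg, map_neg, LinearMap.neg_apply,
      hG.DD_prod_of f 0 le_rfl, if_pos rfl] at h
    rw [← sub_eq_add_neg, eq_sub_iff_add_eq] at h
    rw [eq_sub_of_add_eq' h]
    module
  · change D 1 _ = prod 0 (D 1 (D 1 G)) (of f) + -prod 0 (D 1 G) (D 1 (of f)) at h
    change prod 0 (D 1 G) (D 1 (of f)) = -D 0 (D 1 (of f))
    rw [D_sq, del_prod_zero, zero_add, map_neg, neg_inj] at h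
    rw [← h, D_anticomm]

lemma D0_prod_zero_D (f : A) (i : Fin 2) : prod 0 (D 0 G) (D i (of f)) = D 1 (D i (of f)) := by
  fin_cases i
  · change prod 0 (D 0 G) (D 0 (of f)) = D 1 (D 0 (of f))
    have h := D_prod_homog 0 0 (hG.D_mem 0) (of f)
    rw [hG.D0_prod_of, del_prod_zero] at h
    simp only [koszul, if_true, neg_smul, one_smul, zero_add] at h
    rw [D_anticomm, h, neg_neg]
  · exact (hG.D0_prod_D1 f 0 le_rfl).trans ((if_pos rfl).trans (D_sq _).symm)

lemma DD_prod_D (f : A) (i : Fin 2) (n : ℤ) :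
    prod n (D 1 (D 0 G)) (D i (of f)) = D i (prod n (D 1 (D 0 G)) (of f))
      + n • (if i = 0 then -prod (n - 1) (D 1 G) (of f) else prod (n - 1) (D 0 G) (of f)) := by
  have h := D_prod_homog i n hG.DD_mem (of f)
  simp only [koszul, Bool.false_eq_true, if_false, one_smul] at h
  rw [h]
  fin_cases i
  · have e : D 0 (D 1 (D 0 G)) = -D 0 (D 0 (D 1 G)) := by
      rw [D_anticomm, map_neg]
    simp [e, del_prod]
  · have e : D 1 (D 1 (D 0 G)) = D 0 (D 0 (D 0 G)) := D_sq _
    simp [e, del_prod]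

lemma DD_prod_zero_D (f : A) (i : Fin 2) :
    prod 0 (D 1 (D 0 G)) (D i (of f)) = 2 • D 0 (D 0 (D i (of f))) := by
  rw [hG.DD_prod_D, hG.DD_prod_of f 0 le_rfl, if_pos rfl, zero_smul, add_zero, map_nsmul]
  fin_cases i
  · rfl
  · congr 1
    change D 1 (D 0 (D 0 (of f))) = D 0 (D 0 (D 1 (of f)))
    rw [D_anticomm, D_anticomm, map_neg, neg_neg]

lemma DD_prod_one_D (f : A) (i : Fin 2) :
    prod 1 (D 1 (D 0 G)) (D i (of f)) = D i (of f) := by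
  rw [hG.DD_prod_D, hG.DD_prod_of f 1 (by omega), if_neg one_ne_zero, map_zero, zero_add, one_smul,
    sub_self, hG.D1_prod_of, hG.D0_prod_of, neg_neg]
  fin_cases i <;> rfl

lemma DD_prod_two_D (f : A) (i : Fin 2) : prod 2 (D 1 (D 0 G)) (D i (of f)) = 0 :=
  prod_eq_zero_of_weight hG.DD_mem (D_of_mem i f) (by omega)

lemma DD_prod_zero_quad (i : Fin 2) (h f g : A) :
    prod 0 (D 1 (D 0 G)) (quad 𝕜 br d i h f g) = 2 • D 0 (D 0 (quad 𝕜 br d i h f g)) := by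
  rw [quad, prod_zero_prod (-1) hG.DD_mem (of_mem_homog h) (D_nord_D_mem i f g),
    prod_zero_prod (-1) hG.DD_mem (D_of_mem i f) (D_of_mem i g),
    del_prod_homog _ (of_mem_homog h), del_prod_homog _ (D_of_mem i f)]
  simp only [hG.DD_prod_of _ 0 le_rfl, hG.DD_prod_zero_D, if_true, koszul, Bool.false_and,
    Bool.false_eq_true, if_false, one_smul, map_add, map_nsmul, LinearMap.smul_apply, smul_add]

lemma DD_prod_one_quad (i : Fin 2) (h f g : A) :
    prod 1 (D 1 (D 0 G)) (quad 𝕜 br d i h f g) = 2 • quad 𝕜 br d i h f g := by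
  rw [quad, prod_one_nord hG.DD_mem (of_mem_homog h) (D_nord_D_mem i f g),
    prod_one_nord hG.DD_mem (D_of_mem i f) (D_of_mem i g)]
  simp only [hG.DD_prod_of _ 0 le_rfl, hG.DD_prod_of _ 1 zero_le_one, hG.DD_prod_zero_D,
    hG.DD_prod_one_D, if_true, one_ne_zero, if_false, koszul, Bool.false_and,
    Bool.false_eq_true, one_smul, map_add, map_nsmul, LinearMap.smul_apply, del_prod_zero,
    map_zero, LinearMap.zero_apply, zero_add, smul_zero, add_zero]
  exact (two_smul ℕ _).symm

/-- The contributions `2 (∂a)_(1) b = -2 a_(0) b` of the commutator formula vanish, since the factors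
`a, b` have regular operator products. -/
lemma DD_prod_two_quad (i : Fin 2) (h f g : A) :
    prod 2 (D 1 (D 0 G)) (quad 𝕜 br d i h f g) = 0 := by
  rw [quad, prod_two_nord hG.DD_mem (of_mem_homog h) (D_nord_D_mem i f g),
    prod_two_nord hG.DD_mem (D_of_mem i f) (D_of_mem i g)]
  simp only [hG.DD_prod_of _ 0 le_rfl, hG.DD_prod_of _ 1 zero_le_one, hG.DD_prod_of _ 2 zero_le_two,
    hG.DD_prod_zero_D, hG.DD_prod_one_D, hG.DD_prod_two_D, if_true, one_ne_zero, two_ne_zero,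
    if_false, del_prod, sub_self, regular_of_D_nord_D _ _ _ _ 0 le_rfl, regular_D_D _ _ _ 0 le_rfl,
    map_zero, map_nsmul, LinearMap.smul_apply, LinearMap.zero_apply, smul_zero, add_zero]

lemma D1_prod_zero_quad (i : Fin 2) (h f g : A) :
    prod 0 (D 1 G) (quad 𝕜 br d i h f g) = -D 0 (quad 𝕜 br d i h f g) := by
  rw [quad, prod_zero_prod (-1) (hG.D_mem 1) (of_mem_homog h) (D_nord_D_mem i f g),
    prod_zero_prod (-1) (hG.D_mem 1) (D_of_mem i f) (D_of_mem i g),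
    D_prod_homog _ _ (of_mem_homog h), D_prod_homog _ _ (D_of_mem i f)]
  simp only [hG.D1_prod_of, hG.D1_prod_zero_D, koszul, Bool.and_false, Bool.and_true,
    Bool.false_eq_true, if_false, if_true, one_smul, neg_smul, map_add, map_neg,
    LinearMap.neg_apply]
  abel

lemma D0_prod_zero_quad (i : Fin 2) (h f g : A) :
    prod 0 (D 0 G) (quad 𝕜 br d i h f g) = D 1 (quad 𝕜 br d i h f g) := by
  rw [quad, prod_zero_prod (-1) (hG.D_mem 0) (of_mem_homog h) (D_nord_D_mem i f g),
    prod_zero_prod (-1) (hG.D_mem 0) (D_of_mem i f) (D_of_mem i g),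
    D_prod_homog _ _ (of_mem_homog h), D_prod_homog _ _ (D_of_mem i f)]
  simp only [hG.D0_prod_of, hG.D0_prod_zero_D, koszul, Bool.and_false, Bool.and_true,
    Bool.false_eq_true, if_false, if_true]

/-- The first mode of `G` contracts both odd factors: `G_(0)` turns `Dᵢ f` into `± Dⱼ f` with `j ≠ i`,
which then contracts with `Dᵢ g`. -/
lemma prod_one_quad (i : Fin 2) (h f g : A) :
    prod 1 G (quad 𝕜 br d i h f g) = of (h * br f g) := by
  rw [quad, prod_one_nord hG.mem (of_mem_homog h) (D_nord_D_mem i f g),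
    prod_one_nord hG.mem (D_of_mem i f) (D_of_mem i g), hG.prod_of,
    prod_eq_zero_of_weight hG.mem (of_mem_homog h) (by omega),
    prod_eq_zero_of_weight hG.mem (D_of_mem i f) (by omega),
    prod_eq_zero_of_weight hG.mem (D_of_mem i g) (by omega), of_mul]
  simp only [map_zero, LinearMap.zero_apply, koszul, Bool.false_and, Bool.false_eq_true, if_false,
    one_smul, zero_add, add_zero]
  congr 1
  fin_cases i
  · change prod 0 (prod 0 G (D 0 (of f))) (D 0 (of g)) = _
    rw [hG.prod_D0, map_neg, LinearMap.neg_apply, D1_prod_D0, neg_neg]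
  · change prod 0 (prod 0 G (D 1 (of f))) (D 1 (of g)) = _
    rw [hG.prod_D1, N2Envelope.D0_prod_D1]

end IsSuperconformalOn

end Superconformal

/-! ### The superconformal vector in symplectic coordinates -/

section Coordinates

variable {𝕜 A Ω : Type*} [Field 𝕜] [CommRing A] [Module 𝕜 A] [AddCommGroup Ω] [Module A Ω]

/-- Coordinates `x^μ`, with partial derivatives `pd μ`, on an algebra `A` with a differential `d` and
an antisymmetric bracket that is a derivation in its second argument and is inverse to the closed
`2`-form `½ ∑ w_{μν} dx^μ dx^ν`. The field `hamilton` expresses that the two are inverse: the form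
contracted with the bracket `{x^ν, f}` is `df`. The Jacobi identity is not required, because the
closedness of the form is used in its place. -/
structure SymplecticCoordinates (br : A → A → A) (d : A → Ω) (n : ℕ) where
  x : Fin n → A
  w : Fin n → Fin n → A
  pd : Fin n → Derivation ℤ A A
  d_eq : ∀ f, d f = ∑ μ, pd μ f • d (x μ)
  pd_x : ∀ μ ν, pd μ (x ν) = if μ = ν then 1 else 0
  pd_comm : ∀ μ ν f, pd μ (pd ν f) = pd ν (pd μ f)
  w_swap : ∀ μ ν, w μ ν = -w ν μ
  closed : ∀ μ ν ρ, pd μ (w ν ρ) + pd ν (w ρ μ) + pd ρ (w μ ν) = 0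
  br_swap : ∀ f g, br f g = -br g f
  br_eq : ∀ f g, br f g = ∑ ρ, br f (x ρ) * pd ρ g
  hamilton : ∀ f μ, ∑ ν, w μ ν * br (x ν) f = pd μ f

namespace SymplecticCoordinates

variable {br : A → A → A} {d : A → Ω} {n : ℕ} (X : SymplecticCoordinates br d n)

/-- The Lie derivative of the symplectic form along a Hamiltonian vector field vanishes. -/
lemma lie_eq_zero (e : A) (μ ν : Fin n) :
    br e (X.w μ ν) + ∑ ρ, X.w ρ ν * X.pd μ (br e (X.x ρ))
      + ∑ ρ, X.w μ ρ * X.pd ν (br e (X.x ρ)) = 0 := by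
  have ham : ∀ μ, ∑ ρ, X.w μ ρ * br e (X.x ρ) = -X.pd μ e := by
    intro μ
    rw [← X.hamilton, ← Finset.sum_neg_distrib]
    exact Finset.sum_congr rfl fun ρ _ => by rw [X.br_swap e, mul_neg]
  have key : ∀ μ ν, ∑ ρ, X.w μ ρ * X.pd ν (br e (X.x ρ)) =
      -X.pd ν (X.pd μ e) - ∑ ρ, br e (X.x ρ) * X.pd ν (X.w μ ρ) := by
    intro μ ν
    rw [← map_neg, ← ham, map_sum, eq_sub_iff_add_eq, ← Finset.sum_add_distrib]
    exact Finset.sum_congr rfl fun ρ _ => by rw [Derivation.leibniz, smul_eq_mul, smul_eq_mul]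
  have key' : ∑ ρ, X.w ρ ν * X.pd μ (br e (X.x ρ)) =
      X.pd μ (X.pd ν e) + ∑ ρ, br e (X.x ρ) * X.pd μ (X.w ν ρ) := by
    have h := key ν μ
    rw [← neg_inj, ← Finset.sum_neg_distrib] at h
    rw [Finset.sum_congr rfl fun ρ _ => show X.w ρ ν * X.pd μ (br e (X.x ρ)) =
      -(X.w ν ρ * X.pd μ (br e (X.x ρ))) by rw [X.w_swap ρ ν, neg_mul], h]
    ring
  have c : ∑ ρ, br e (X.x ρ) * X.pd ρ (X.w μ ν) + ∑ ρ, br e (X.x ρ) * X.pd μ (X.w ν ρ)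
      - ∑ ρ, br e (X.x ρ) * X.pd ν (X.w μ ρ) = 0 := by
    rw [← Finset.sum_add_distrib, ← Finset.sum_sub_distrib]
    refine Finset.sum_eq_zero fun ρ _ => ?_
    have h := X.closed ρ μ ν
    rw [X.w_swap ρ μ, map_neg] at h
    linear_combination br e (X.x ρ) * h
  rw [key, key', X.br_eq e (X.w μ ν), X.pd_comm μ ν]
  linear_combination c

variable (𝕜) in
/-- The vector `½ ∑ w_{μν} (D₁ x^μ D₁ x^ν + D₂ x^μ D₂ x^ν)`. -/
noncomputable def vector : N2Envelope 𝕜 br d :=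
  (2 : 𝕜)⁻¹ • ∑ μ, ∑ ν, ∑ i, quad 𝕜 br d i (X.w μ ν) (X.x μ) (X.x ν)

/-- Linear maps that agree on the quadratic expressions agree on the superconformal vector. -/
lemma map_vector_eq {V : Type*} [AddCommGroup V] [Module 𝕜 V]
    {S T : N2Envelope 𝕜 br d →ₗ[𝕜] V}
    (h : ∀ i h f g, S (quad 𝕜 br d i h f g) = T (quad 𝕜 br d i h f g)) :
    S (X.vector 𝕜) = T (X.vector 𝕜) := by
  simp only [vector, map_smul, map_sum, h]

lemma vector_mem : X.vector 𝕜 ∈ homog 𝕜 br d 2 false :=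
  Submodule.smul_mem _ _ <| Submodule.sum_mem _ fun _ _ => Submodule.sum_mem _ fun _ _ =>
    Submodule.sum_mem _ fun i _ => quad_mem i _ _ _

/-- Contraction of the form with one pair of odd generators gives a differential. -/
lemma sum_contraction (i : Fin 2) (f : A) :
    ∑ μ, ∑ ν, prod (-1) (of (X.w μ ν))
      (prod (-1) (D i (of (X.x μ))) (of (br (X.x ν) f))
        - prod (-1) (D i (of (X.x ν))) (of (br (X.x μ) f))) =
      (2 : 𝕜) • (D i (of f) : N2Envelope 𝕜 br d) := by
  have e : ∀ h g u : A, prod (-1) (of h) (prod (-1) (D i (of g)) (of u)) =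
      prod (-1) (of (h * u)) (D i (of g) : N2Envelope 𝕜 br d) := by
    intro h g u
    rw [nord_comm (of_mem_homog u) (D_of_mem i g) (regular_of_D u g i), of_mul,
      nord_assoc (of_mem_homog h) (of_mem_homog u) (D_of_mem i g) (regular_of_D u g i)
      (regular_of_D h g i)]
    simp [koszul]
  have s : ∑ μ, ∑ ν, prod (-1) (of (X.w μ ν * br (X.x ν) f)) (D i (of (X.x μ))) =
      (D i (of f) : N2Envelope 𝕜 br d) := by
    rw [D_of_eq_sum i (X.d_eq f)]
    refine Finset.sum_congr rfl fun μ _ => ?_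
    rw [← X.hamilton, of_sum, map_sum, LinearMap.sum_apply]
  have s' : ∑ μ, ∑ ν, prod (-1) (of (X.w μ ν * br (X.x μ) f)) (D i (of (X.x ν))) =
      -(D i (of f) : N2Envelope 𝕜 br d) := by
    rw [Finset.sum_comm, ← s, ← Finset.sum_neg_distrib]
    refine Finset.sum_congr rfl fun μ _ => ?_
    rw [← Finset.sum_neg_distrib]
    refine Finset.sum_congr rfl fun ν _ => ?_
    rw [X.w_swap, neg_mul, of_neg, map_neg, LinearMap.neg_apply]
  simp only [map_sub, e, Finset.sum_sub_distrib]
  rw [s, s', sub_neg_eq_add, two_smul]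

/-- The quadratic expression of the symplectic form is invariant under Hamiltonian derivations. -/
lemma sum_lie (i : Fin 2) (e : A) :
    ∑ μ, ∑ ν, (quad 𝕜 br d i (br e (X.w μ ν)) (X.x μ) (X.x ν)
      + quad 𝕜 br d i (X.w μ ν) (br e (X.x μ)) (X.x ν)
      + quad 𝕜 br d i (X.w μ ν) (X.x μ) (br e (X.x ν))) = 0 := by
  have s1 : ∑ μ, ∑ ν, quad 𝕜 br d i (X.w μ ν) (br e (X.x μ)) (X.x ν) =
      ∑ μ, ∑ ν, quad 𝕜 br d i (∑ ρ, X.w ρ ν * X.pd μ (br e (X.x ρ))) (X.x μ) (X.x ν) := by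
    calc _ = ∑ μ, ∑ ν, ∑ l, quad 𝕜 br d i (X.w μ ν * X.pd l (br e (X.x μ))) (X.x l) (X.x ν) := by
          refine Finset.sum_congr rfl fun μ _ => Finset.sum_congr rfl fun ν _ => ?_
          rw [quad_expand i _ (X.d_eq (br e (X.x μ))) (X.d_eq (X.x ν))]
          refine Finset.sum_congr rfl fun l _ => ?_
          rw [Finset.sum_eq_single ν]
          · rw [X.pd_x, if_pos rfl, mul_one]
          · intro ρ _ h
            rw [X.pd_x, if_neg h, mul_zero, quad_zero]
          · simp
      _ = _ := by
          rw [Finset.sum_congr rfl fun μ _ => Finset.sum_comm, Finset.sum_comm]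
          refine Finset.sum_congr rfl fun l _ => ?_
          rw [Finset.sum_comm]
          exact Finset.sum_congr rfl fun ν _ => (quad_sum _ i _ _ _).symm
  have s2 : ∑ μ, ∑ ν, quad 𝕜 br d i (X.w μ ν) (X.x μ) (br e (X.x ν)) =
      ∑ μ, ∑ ν, quad 𝕜 br d i (∑ ρ, X.w μ ρ * X.pd ν (br e (X.x ρ))) (X.x μ) (X.x ν) := by
    refine Finset.sum_congr rfl fun μ _ => ?_
    calc _ = ∑ ν, ∑ l, quad 𝕜 br d i (X.w μ ν * X.pd l (br e (X.x ν))) (X.x μ) (X.x l) := by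
          refine Finset.sum_congr rfl fun ν _ => ?_
          rw [quad_expand i _ (X.d_eq (X.x μ)) (X.d_eq (br e (X.x ν))), Finset.sum_eq_single μ]
          · simp only [X.pd_x, if_true, mul_one]
          · intro ρ _ h
            simp only [X.pd_x, if_neg h, mul_zero, zero_mul, quad_zero, Finset.sum_const_zero]
          · simp
      _ = _ := by
          rw [Finset.sum_comm]
          exact Finset.sum_congr rfl fun ν _ => (quad_sum _ i _ _ _).symm
  simp only [Finset.sum_add_distrib]
  rw [s1, s2]
  simp only [← Finset.sum_add_distrib, ← quad_add]
  refine Finset.sum_eq_zero fun μ _ => Finset.sum_eq_zero fun ν _ => ?_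
  rw [X.lie_eq_zero, quad_zero]

lemma isSuperconformalOn_vector [CharZero 𝕜] : IsSuperconformalOn (X.vector 𝕜) where
  mem := X.vector_mem
  prod_of f := by
    simp only [vector, map_smul, map_sum, LinearMap.smul_apply, LinearMap.sum_apply]
    rw [Finset.sum_eq_zero, smul_zero]
    refine fun μ _ => Finset.sum_eq_zero fun ν _ => Finset.sum_eq_zero fun i _ => ?_
    rw [quad_prod_zero i _ _ _ (of_mem_homog f) (by omega), regular_D_of _ _ _ 0 le_rfl,
      regular_D_of _ _ _ 0 le_rfl]
    simp
  prod_D1 f := by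
    simp only [vector, map_smul, map_sum, LinearMap.smul_apply, LinearMap.sum_apply, map_add,
      LinearMap.add_apply, quad_prod_zero _ _ _ _ (D_of_mem 1 f) le_rfl, Fin.sum_univ_two,
      D0_prod_D1,
      regular_D_D _ _ _ 0 le_rfl, map_zero, sub_self, add_zero]
    rw [X.sum_contraction, smul_smul, inv_mul_cancel₀ two_ne_zero, one_smul]
  prod_D0 f := by
    simp only [vector, map_smul, map_sum, LinearMap.smul_apply, LinearMap.sum_apply, map_add,
      LinearMap.add_apply, quad_prod_zero _ _ _ _ (D_of_mem 0 f) le_rfl, Fin.sum_univ_two,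
      D1_prod_D0,
      regular_D_D _ _ _ 0 le_rfl, map_zero, sub_self, zero_add, map_neg, neg_sub_neg]
    rw [← neg_inj, neg_neg, ← smul_neg]
    simp only [← Finset.sum_neg_distrib, ← map_neg, neg_sub]
    rw [X.sum_contraction, smul_smul, inv_mul_cancel₀ two_ne_zero, one_smul]
  regular f m hm := by
    simp only [vector, map_smul, map_sum]
    rcases hm.eq_or_lt with rfl | hm
    · simp only [DD_prod_zero_quad]
      rw [Finset.sum_congr rfl fun μ _ => Finset.sum_comm, Finset.sum_comm,
        Finset.sum_eq_zero fun i _ => X.sum_lie i f, smul_zero]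
    · simp only [DD_prod_quad_eq_zero _ _ _ _ _ m hm, Finset.sum_const_zero, smul_zero]

lemma sum_w_br : ∑ μ, ∑ ν, X.w μ ν * br (X.x μ) (X.x ν) = -(n : A) := by
  have h : ∀ μ, ∑ ν, X.w μ ν * br (X.x μ) (X.x ν) = -1 := by
    intro μ
    have h := X.hamilton (X.x μ) μ
    rw [X.pd_x, if_pos rfl] at h
    rw [← h, ← Finset.sum_neg_distrib]
    exact Finset.sum_congr rfl fun ν _ => by rw [X.br_swap, mul_neg]
  simp [h]

lemma vector_prod_one [CharZero 𝕜] :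
    prod 1 (X.vector 𝕜) (X.vector 𝕜) = -((n : 𝕜) • (of 1 : N2Envelope 𝕜 br d)) := by
  have h := X.isSuperconformalOn_vector (𝕜 := 𝕜)
  nth_rw 2 [vector]
  simp only [map_smul, map_sum, map_add, h.prod_one_quad, Fin.sum_univ_two, ← two_smul 𝕜,
    ← Finset.smul_sum, ← of_sum]
  rw [smul_smul, inv_mul_cancel₀ two_ne_zero, one_smul, X.sum_w_br, of_neg, ← nsmul_one]
  congr 1
  rw [Nat.cast_smul_eq_nsmul]
  exact map_nsmul (ofHom 𝕜 br d) n 1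

/-- `G_(0) G = 0` by skew-symmetry, since `G_(1) G` is a multiple of the vacuum. -/
lemma vector_prod_zero [CharZero 𝕜] : prod 0 (X.vector 𝕜) (X.vector 𝕜) = 0 := by
  have h := skew_symmetry 0 (X.vector_mem (𝕜 := 𝕜)) (X.vector_mem (𝕜 := 𝕜)) 2 (by norm_num)
  simp only [Finset.sum_range_succ, Finset.sum_range_zero] at h
  norm_num [X.vector_prod_one, vac_prod, prod_vac_neg_one, koszul] at h
  have h2 : (2 : 𝕜) • prod 0 (X.vector 𝕜) (X.vector 𝕜) = 0 := by
    rw [two_smul]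
    nth_rw 1 [h]
    exact neg_add_cancel _
  exact (smul_eq_zero.1 h2).resolve_left two_ne_zero

/-- `(Dᵢ G)_(1) G = 0`: by skew-symmetry it equals `G_(1) (Dᵢ G)`, and by the Leibniz rule it equals
`-G_(1) (Dᵢ G)`, since `G_(1) G` is a multiple of the vacuum. -/
lemma D_vector_prod_one [CharZero 𝕜] (i : Fin 2) :
    prod 1 (D i (X.vector 𝕜)) (X.vector 𝕜) = 0 := by
  have hG := X.isSuperconformalOn_vector (𝕜 := 𝕜)
  have h := skew_symmetry 1 hG.mem (hG.D_mem i) 2 (by norm_num)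
  simp only [Finset.sum_range_succ, Finset.sum_range_zero] at h
  norm_num [prod_vac_neg_one, koszul, prod_eq_zero_of_weight hG.mem (hG.D_mem i)
    (show (2 : ℤ) + 3 < 2 * 2 + 2 by norm_num)] at h
  have h' := D_prod_homog i 1 hG.mem (X.vector 𝕜)
  rw [X.vector_prod_one, map_neg, map_smul, D_vac, smul_zero, neg_zero] at h'
  simp only [koszul, Bool.false_eq_true, if_false, one_smul] at h'
  have h2 : (2 : 𝕜) • prod 1 (D i (X.vector 𝕜)) (X.vector 𝕜) = 0 := by
    rw [two_smul]
    nth_rw 2 [h]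
    exact h'.symm
  exact (smul_eq_zero.1 h2).resolve_left two_ne_zero

lemma DD_vector_prod_zero [CharZero 𝕜] :
    prod 0 (D 1 (D 0 (X.vector 𝕜))) (X.vector 𝕜) = (2 : 𝕜) • D 0 (D 0 (X.vector 𝕜)) := by
  refine X.map_vector_eq (S := prod 0 (D 1 (D 0 (X.vector 𝕜))))
    (T := (2 : 𝕜) • (D 0 ∘ₗ D 0)) fun i h f g => ?_
  rw [X.isSuperconformalOn_vector.DD_prod_zero_quad, two_smul, LinearMap.smul_apply, two_smul]
  rfl

lemma DD_vector_prod_one [CharZero 𝕜] :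
    prod 1 (D 1 (D 0 (X.vector 𝕜))) (X.vector 𝕜) = (2 : 𝕜) • X.vector 𝕜 := by
  refine X.map_vector_eq (S := prod 1 (D 1 (D 0 (X.vector 𝕜))))
    (T := (2 : 𝕜) • LinearMap.id) fun i h f g => ?_
  rw [X.isSuperconformalOn_vector.DD_prod_one_quad, two_smul, LinearMap.smul_apply, two_smul]
  rfl

lemma DD_vector_prod_two [CharZero 𝕜] : prod 2 (D 1 (D 0 (X.vector 𝕜))) (X.vector 𝕜) = 0 :=
  X.map_vector_eq (S := prod 2 (D 1 (D 0 (X.vector 𝕜)))) (T := 0)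
    fun i h f g => X.isSuperconformalOn_vector.DD_prod_two_quad i h f g

lemma D1_vector_prod_zero [CharZero 𝕜] :
    prod 0 (D 1 (X.vector 𝕜)) (X.vector 𝕜) = -D 0 (X.vector 𝕜) :=
  X.map_vector_eq (S := prod 0 (D 1 (X.vector 𝕜))) (T := -D 0)
    fun i h f g => X.isSuperconformalOn_vector.D1_prod_zero_quad i h f g

lemma D0_vector_prod_zero [CharZero 𝕜] :
    prod 0 (D 0 (X.vector 𝕜)) (X.vector 𝕜) = D 1 (X.vector 𝕜) :=
  X.map_vector_eq (S := prod 0 (D 0 (X.vector 𝕜))) (T := D 1)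
    fun i h f g => X.isSuperconformalOn_vector.D0_prod_zero_quad i h f g

/-- The `Λ`-bracket of the `N = 2` superconformal algebra with central charge `c = 3n`. -/
theorem lambdaBracket_vector [CharZero 𝕜] (c : 𝕜) (hc : c = 3 * (n : 𝕜)) :
    lambdaBracket 𝕜 (X.vector 𝕜) (X.vector 𝕜) =
      LambdaSeries.monomial 1 false false ((2 : 𝕜) • X.vector 𝕜)
      + LambdaSeries.monomial 0 false false ((2 : 𝕜) • N2Operations.del 𝕜 (X.vector 𝕜))
      + LambdaSeries.monomial 0 true false (N2Operations.D (𝕜 := 𝕜) 0 (X.vector 𝕜))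
      + LambdaSeries.monomial 0 false true (N2Operations.D (𝕜 := 𝕜) 1 (X.vector 𝕜))
      + LambdaSeries.monomial 1 true true ((c / 3) • N2Operations.vac 𝕜) := by
  have hG := X.isSuperconformalOn_vector (𝕜 := 𝕜)
  have hc' : c / 3 = n := by rw [hc, mul_div_cancel_left₀ _ three_ne_zero]
  funext j e₁ e₂
  rw [hc', lambdaBracket, mode_apply]
  -- The weight of the brackets is negative from the third power of `λ` on.
  rcases j with _ | _ | _ | j
  · cases e₁ <;> cases e₂ <;>
      simp [LambdaSeries.monomial, koszul, X.vector_prod_zero, X.D0_vector_prod_zero,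
        X.D1_vector_prod_zero, X.DD_vector_prod_zero, N2Operations.del]
    all_goals rfl
  · cases e₁ <;> cases e₂ <;>
      simp [LambdaSeries.monomial, koszul, X.vector_prod_one, X.D_vector_prod_one,
        X.DD_vector_prod_one]
    rfl
  · have h0 := X.DD_vector_prod_two (𝕜 := 𝕜)
    have h1 := fun i => prod_eq_zero_of_weight (hG.D_mem i) hG.mem
      (show (3 : ℤ) + 2 < 2 * 2 + 2 by norm_num)
    have h2 := prod_eq_zero_of_weight hG.mem hG.mem (show (2 : ℤ) + 2 < 2 * 2 + 2 by norm_num)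
    cases e₁ <;> cases e₂ <;> simp [LambdaSeries.monomial, h0, h1, h2]
  · have h0 := prod_eq_zero_of_weight hG.DD_mem hG.mem
      (show (4 : ℤ) + 2 < 2 * ((j : ℤ) + 1 + 1 + 1) + 2 by omega)
    have h1 := fun i => prod_eq_zero_of_weight (hG.D_mem i) hG.mem
      (show (3 : ℤ) + 2 < 2 * ((j : ℤ) + 1 + 1 + 1) + 2 by omega)
    have h2 := prod_eq_zero_of_weight hG.mem hG.mem
      (show (2 : ℤ) + 2 < 2 * ((j : ℤ) + 1 + 1 + 1) + 2 by omega)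
    cases e₁ <;> cases e₂ <;> simp [LambdaSeries.monomial, h0, h1, h2]

end SymplecticCoordinates

end Coordinates

end N2Envelope

/-! ### Change of coordinates -/

namespace N2Envelope.SymplecticCoordinates

variable {𝕜 A Ω : Type*} [Field 𝕜] [CommRing A] [Module 𝕜 A] [AddCommGroup Ω] [Module A Ω]
  {br : A → A → A} {d : A → Ω} {n : ℕ} (X Y : SymplecticCoordinates br d n)

/-- The chain rule. It follows from the nondegeneracy of the bracket. -/
lemma chain_rule (μ : Fin n) (f : A) : X.pd μ f = ∑ a, X.pd μ (Y.x a) * Y.pd a f := by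
  simp only [← X.hamilton _ μ, Finset.sum_mul]
  rw [Finset.sum_comm]
  refine Finset.sum_congr rfl fun ν _ => ?_
  rw [Y.br_eq (X.x ν) f, Finset.mul_sum]
  exact Finset.sum_congr rfl fun a _ => (mul_assoc _ _ _).symm

/-- The components of the form are determined by the bracket. -/
lemma w_unique (u : Fin n → A) (μ : Fin n) (h : ∀ f, ∑ ν, u ν * br (X.x ν) f = X.pd μ f)
    (σ : Fin n) : u σ = X.w μ σ := by
  -- The bracket matrix is also a right inverse, so `v` is recovered from `∑ v_ν {x^ν, x^ρ}`.
  have key : ∀ v : Fin n → A, ∑ ρ, (∑ ν, v ν * br (X.x ν) (X.x ρ)) * X.w ρ σ = v σ := by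
    intro v
    have e : ∀ ν, ∑ ρ, br (X.x ν) (X.x ρ) * X.w ρ σ = if σ = ν then 1 else 0 := by
      intro ν
      rw [← X.pd_x, ← X.hamilton]
      refine Finset.sum_congr rfl fun ρ _ => ?_
      rw [X.br_swap, X.w_swap ρ σ, neg_mul_neg, mul_comm]
    simp only [Finset.sum_mul]
    rw [Finset.sum_comm]
    simp only [mul_assoc, ← Finset.mul_sum, e]
    simp
  rw [← key u, ← key (X.w μ)]
  simp only [h, X.hamilton]

/-- The transformation law of the components of the form. -/
lemma w_transform (μ ν : Fin n) :
    X.w μ ν = ∑ a, ∑ b, Y.w a b * X.pd μ (Y.x a) * X.pd ν (Y.x b) := by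
  refine (X.w_unique (fun ν => ∑ a, ∑ b, Y.w a b * X.pd μ (Y.x a) * X.pd ν (Y.x b)) μ
    (fun f => ?_) ν).symm
  have e : ∀ b, ∑ ν, X.pd ν (Y.x b) * br (X.x ν) f = br (Y.x b) f := by
    intro b
    rw [X.br_swap (Y.x b) f, X.br_eq f, ← Finset.sum_neg_distrib]
    exact Finset.sum_congr rfl fun ν _ => by rw [X.br_swap]; ring
  calc _ = ∑ a, ∑ b, Y.w a b * X.pd μ (Y.x a) * ∑ ν, X.pd ν (Y.x b) * br (X.x ν) f := by
        simp only [Finset.sum_mul, Finset.mul_sum]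
        rw [Finset.sum_comm]
        refine Finset.sum_congr rfl fun a _ => ?_
        rw [Finset.sum_comm]
        exact Finset.sum_congr rfl fun b _ => Finset.sum_congr rfl fun ν _ => mul_assoc _ _ _
    _ = _ := by
        rw [X.chain_rule Y]
        refine Finset.sum_congr rfl fun a _ => ?_
        rw [← Y.hamilton, Finset.mul_sum]
        refine Finset.sum_congr rfl fun b _ => ?_
        rw [e]
        ring

/-- The superconformal vector does not depend on the coordinates. -/
theorem vector_eq : Y.vector 𝕜 = X.vector 𝕜 := by
  rw [vector, vector]
  congr 1
  calc _ = ∑ a, ∑ b, ∑ i, ∑ μ, ∑ ν,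
        quad 𝕜 br d i (Y.w a b * X.pd μ (Y.x a) * X.pd ν (Y.x b)) (X.x μ) (X.x ν) :=
        Finset.sum_congr rfl fun a _ => Finset.sum_congr rfl fun b _ =>
          Finset.sum_congr rfl fun i _ => quad_expand i _ (X.d_eq _) (X.d_eq _)
    _ = ∑ a, ∑ b, ∑ μ, ∑ ν, ∑ i,
        quad 𝕜 br d i (Y.w a b * X.pd μ (Y.x a) * X.pd ν (Y.x b)) (X.x μ) (X.x ν) := by
        refine Finset.sum_congr rfl fun a _ => Finset.sum_congr rfl fun b _ => ?_
        rw [Finset.sum_comm]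
        exact Finset.sum_congr rfl fun μ _ => Finset.sum_comm
    _ = ∑ μ, ∑ ν, ∑ a, ∑ b, ∑ i,
        quad 𝕜 br d i (Y.w a b * X.pd μ (Y.x a) * X.pd ν (Y.x b)) (X.x μ) (X.x ν) := by
        rw [Finset.sum_congr rfl fun a _ => Finset.sum_comm, Finset.sum_comm]
        refine Finset.sum_congr rfl fun μ _ => ?_
        rw [Finset.sum_congr rfl fun a _ => Finset.sum_comm, Finset.sum_comm]
    _ = _ := by
        refine Finset.sum_congr rfl fun μ _ => Finset.sum_congr rfl fun ν _ => ?_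
        rw [Finset.sum_congr rfl fun a _ => Finset.sum_comm, Finset.sum_comm]
        refine Finset.sum_congr rfl fun i _ => ?_
        rw [X.w_transform Y, quad_sum]
        exact Finset.sum_congr rfl fun a _ => (quad_sum _ _ _ _ _).symm

end N2Envelope.SymplecticCoordinates

/-! ### Calculus in a chart -/

lemma ContinuousAlternatingMap.apply_swap_two {E : Type*} [AddCommGroup E] [Module ℝ E]
    [TopologicalSpace E] (η : E [⋀^Fin 2]→L[ℝ] ℝ) (v w : E) : η ![v, w] = -η ![w, v] := by
  have h := η.map_swap ![w, v] (show (0 : Fin 2) ≠ 1 by decide)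
  refine Eq.trans (congrArg η ?_) h
  funext i
  fin_cases i <;> rfl

section Chart

variable {𝕜 : Type*} [RCLike 𝕜] {n : ℕ} {M : Type*} [TopologicalSpace M]
  [ChartedSpace (EuclideanSpace ℝ (Fin n)) M]
  {φ : OpenPartialHomeomorph M (EuclideanSpace ℝ (Fin n))}

/-- The partial derivative `∂f/∂x^μ` in the coordinates of a chart. -/
noncomputable def chartDeriv (φ : OpenPartialHomeomorph M (EuclideanSpace ℝ (Fin n))) (μ : Fin n)
    (f : M → 𝕜) (z : M) : 𝕜 :=
  fderiv ℝ (f ∘ φ.symm) (φ z) (stdVec n μ)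

lemma comp_symm_eventuallyEq {z : M} (hz : z ∈ φ.source) {f g : M → 𝕜} (h : f =ᶠ[𝓝 z] g) :
    f ∘ φ.symm =ᶠ[𝓝 (φ z)] g ∘ φ.symm := by
  have hc := φ.continuousAt_symm (φ.map_source hz)
  rw [ContinuousAt, φ.left_inv hz] at hc
  exact hc.eventually h

lemma chartDeriv_congr {z : M} (hz : z ∈ φ.source) {f g : M → 𝕜} (h : f =ᶠ[𝓝 z] g) (μ : Fin n) :
    chartDeriv φ μ f =ᶠ[𝓝 z] chartDeriv φ μ g := by
  filter_upwards [eventually_eventually_nhds.2 h, φ.open_source.mem_nhds hz] with y hy hys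
  rw [chartDeriv, (comp_symm_eventuallyEq hys hy).fderiv_eq, chartDeriv]

lemma chartDeriv_coord {z : M} (hz : z ∈ φ.source) (μ ν : Fin n) :
    chartDeriv φ μ (fun y => (φ y ν : 𝕜)) z = if μ = ν then 1 else 0 := by
  let L : EuclideanSpace ℝ (Fin n) →L[ℝ] 𝕜 :=
    (RCLike.ofRealCLM (K := 𝕜)).comp (EuclideanSpace.proj (𝕜 := ℝ) ν)
  have e : (fun y => (φ y ν : 𝕜)) ∘ φ.symm =ᶠ[𝓝 (φ z)] L := by
    filter_upwards [φ.open_target.mem_nhds (φ.map_source hz)] with u hu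
    change ((φ (φ.symm u) ν : ℝ) : 𝕜) = (u ν : 𝕜)
    rw [φ.right_inv hu]
  rw [chartDeriv, e.fderiv_eq, L.fderiv]
  change ((stdVec n μ ν : ℝ) : 𝕜) = _
  simp [stdVec, eq_comm]

variable [IsManifold (𝓡 n) ∞ M] (hφ : φ ∈ IsManifold.maximalAtlas (𝓡 n) ∞ M)
  {z : M} (hz : z ∈ φ.source)

include hφ hz

lemma contDiffAt_comp_symm {f : M → 𝕜} (hf : ContMDiffAt (𝓡 n) 𝓘(ℝ, 𝕜) ∞ f z) :
    ContDiffAt ℝ ∞ (f ∘ φ.symm) (φ z) :=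
  contDiffAt_symm hφ (φ.map_source hz) (by rwa [φ.left_inv hz])

lemma contMDiffAt_chartDeriv {f : M → 𝕜} (hf : ContMDiffAt (𝓡 n) 𝓘(ℝ, 𝕜) ∞ f z) (μ : Fin n) :
    ContMDiffAt (𝓡 n) 𝓘(ℝ, 𝕜) ∞ (chartDeriv φ μ f) z := by
  have h : ContDiffAt ℝ ∞ (fun u => fderiv ℝ (f ∘ φ.symm) u (stdVec n μ)) (φ z) :=
    ((contDiffAt_comp_symm hφ hz hf).fderiv_right (m := ∞) (by simp)).clm_apply contDiffAt_const
  exact h.contMDiffAt.comp z (contMDiffAt_of_mem_maximalAtlas hφ hz)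

lemma contMDiffAt_coord (ν : Fin n) :
    ContMDiffAt (𝓡 n) 𝓘(ℝ, 𝕜) ∞ (fun y => (φ y ν : 𝕜)) z := by
  have h : ContDiff ℝ ∞ fun u : EuclideanSpace ℝ (Fin n) => ((u ν : ℝ) : 𝕜) :=
    (RCLike.ofRealCLM (K := 𝕜)).contDiff.comp (EuclideanSpace.proj (𝕜 := ℝ) ν).contDiff
  exact h.contDiffAt.contMDiffAt.comp z (contMDiffAt_of_mem_maximalAtlas hφ hz)

lemma dAt_frame {f : M → 𝕜} (hf : ContMDiffAt (𝓡 n) 𝓘(ℝ, 𝕜) ∞ f z)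
    (v : EuclideanSpace ℝ (Fin n)) :
    dAt f z (frame φ (φ z) v) = ∑ μ, (v μ : 𝕜) * chartDeriv φ μ f z := by
  have h := dAt_symm hφ (φ.map_source hz) (f := f) (by rwa [φ.left_inv hz]) v
  rw [φ.left_inv hz] at h
  rw [h]
  conv_lhs => rw [sum_stdVec v]
  simp only [map_sum, map_smul, RCLike.real_smul_eq_coe_mul, chartDeriv]

/-- `df = ∑ ∂f/∂x^μ dx^μ`. -/
lemma dAt_eq_sum {f : M → 𝕜} (hf : ContMDiffAt (𝓡 n) 𝓘(ℝ, 𝕜) ∞ f z) :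
    dAt (n := n) f z = ∑ μ, chartDeriv φ μ f z • dAt (n := n) (fun y => (φ y μ : 𝕜)) z := by
  have h := (mdifferentiable_of_mem_maximalAtlas hφ).symm_comp_deriv hz
  let Q : EuclideanSpace ℝ (Fin n) →L[ℝ] EuclideanSpace ℝ (Fin n) := mfderiv (𝓡 n) (𝓡 n) φ z
  have hQ : ∀ w, frame φ (φ z) (Q w) = w := fun w => DFunLike.congr_fun h w
  refine ContinuousLinearMap.ext fun w => ?_
  rw [← hQ w, sum_apply, dAt_frame hφ hz hf]
  refine Finset.sum_congr rfl fun μ _ => ?_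
  rw [smul_apply, dAt_frame hφ hz (contMDiffAt_coord hφ hz μ)]
  simp only [chartDeriv_coord hz]
  simp [mul_comm]

lemma chartDeriv_add {f g : M → 𝕜} (hf : ContMDiffAt (𝓡 n) 𝓘(ℝ, 𝕜) ∞ f z)
    (hg : ContMDiffAt (𝓡 n) 𝓘(ℝ, 𝕜) ∞ g z) (μ : Fin n) :
    chartDeriv φ μ (f + g) z = chartDeriv φ μ f z + chartDeriv φ μ g z := by
  have h := fderiv_add ((contDiffAt_comp_symm hφ hz hf).differentiableAt (by simp))
    ((contDiffAt_comp_symm hφ hz hg).differentiableAt (by simp))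
  exact DFunLike.congr_fun h _

lemma chartDeriv_mul {f g : M → 𝕜} (hf : ContMDiffAt (𝓡 n) 𝓘(ℝ, 𝕜) ∞ f z)
    (hg : ContMDiffAt (𝓡 n) 𝓘(ℝ, 𝕜) ∞ g z) (μ : Fin n) :
    chartDeriv φ μ (f * g) z = f z * chartDeriv φ μ g z + g z * chartDeriv φ μ f z := by
  have h := fderiv_mul ((contDiffAt_comp_symm hφ hz hf).differentiableAt (by simp))
    ((contDiffAt_comp_symm hφ hz hg).differentiableAt (by simp))
  refine (DFunLike.congr_fun h _).trans ?_
  simp [chartDeriv, φ.left_inv hz]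

lemma chartDeriv_comm {f : M → 𝕜} (hf : ContMDiffAt (𝓡 n) 𝓘(ℝ, 𝕜) ∞ f z) (μ ν : Fin n) :
    chartDeriv φ μ (chartDeriv φ ν f) z = chartDeriv φ ν (chartDeriv φ μ f) z := by
  have hF := contDiffAt_comp_symm hφ hz hf
  have hd : DifferentiableAt ℝ (fderiv ℝ (f ∘ φ.symm)) (φ z) :=
    (hF.fderiv_right (m := ∞) (by simp)).differentiableAt (by simp)
  have key : ∀ μ ν, chartDeriv φ μ (chartDeriv φ ν f) z =
      fderiv ℝ (fderiv ℝ (f ∘ φ.symm)) (φ z) (stdVec n μ) (stdVec n ν) := by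
    intro μ ν
    have e : chartDeriv φ ν f ∘ φ.symm =ᶠ[𝓝 (φ z)]
        fun u => fderiv ℝ (f ∘ φ.symm) u (stdVec n ν) := by
      filter_upwards [φ.open_target.mem_nhds (φ.map_source hz)] with u hu
      rw [Function.comp_apply, chartDeriv, φ.right_inv hu]
    rw [chartDeriv, e.fderiv_eq, fderiv_clm_apply hd (differentiableAt_const _)]
    simp
  rw [key, key]
  exact hF.isSymmSndFDerivAt (by
    rw [minSmoothness_of_isRCLikeNormedField]
    exact WithTop.coe_le_coe.2 le_top) _ _

variable (ω₀ : SymplecticForm n M)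

lemma poisson_eq_sum {f g : M → 𝕜} (hf : ContMDiffAt (𝓡 n) 𝓘(ℝ, 𝕜) ∞ f z)
    (hg : ContMDiffAt (𝓡 n) 𝓘(ℝ, 𝕜) ∞ g z) :
    ω₀.poisson f g z = ∑ μ, ∑ ν, (((Matrix.of fun μ ν => ω₀.comp φ μ ν z)⁻¹ μ ν : ℝ) : 𝕜) *
      chartDeriv φ μ f z * chartDeriv φ ν g z := by
  have h := ω₀.poisson_symm hφ (φ.map_source hz) f g
  have e : ∀ {f : M → 𝕜}, ContMDiffAt (𝓡 n) 𝓘(ℝ, 𝕜) ∞ f z → ∀ μ,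
      dAt f z (frame φ (φ z) (stdVec n μ)) = chartDeriv φ μ f z := by
    intro f hf μ
    rw [dAt_frame hφ hz hf]
    simp [stdVec]
  simp only [φ.left_inv hz, e hf, e hg] at h
  exact h

/-- The Hamiltonian vector field of `f` contracted with the form is `df`. -/
lemma sum_comp_mul_poisson {f : M → 𝕜} (hf : ContMDiffAt (𝓡 n) 𝓘(ℝ, 𝕜) ∞ f z) (μ : Fin n) :
    ∑ ν, (ω₀.comp φ μ ν z : 𝕜) * ω₀.poisson (fun y => (φ y ν : 𝕜)) f z = chartDeriv φ μ f z := by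
  have hdet : IsUnit (Matrix.of fun μ ν => ω₀.comp φ μ ν z).det :=
    isUnit_iff_ne_zero.2 (ω₀.det_formInChart_ne_zero hφ (φ.map_source hz))
  have h : ∀ β, ∑ ν, (ω₀.comp φ μ ν z : 𝕜) *
      (((Matrix.of fun μ ν => ω₀.comp φ μ ν z)⁻¹ ν β : ℝ) : 𝕜) = if μ = β then 1 else 0 := by
    intro β
    have h := congrFun (congrFun (Matrix.mul_nonsing_inv _ hdet) μ) β
    rw [Matrix.mul_apply, Matrix.one_apply] at h
    have h' := congrArg (fun r : ℝ => (r : 𝕜)) h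
    simp only [RCLike.ofReal_sum, RCLike.ofReal_mul, Matrix.of_apply] at h'
    rw [h']
    split_ifs <;> simp
  simp only [fun ν => poisson_eq_sum hφ hz ω₀ (contMDiffAt_coord hφ hz ν) hf,
    chartDeriv_coord hz, mul_ite, mul_one, mul_zero, ite_mul, zero_mul]
  have e : ∀ ν, ∑ α, ∑ β, (if α = ν then
      (((Matrix.of fun μ ν => ω₀.comp φ μ ν z)⁻¹ α β : ℝ) : 𝕜) * chartDeriv φ β f z else 0) =
      ∑ β, (((Matrix.of fun μ ν => ω₀.comp φ μ ν z)⁻¹ ν β : ℝ) : 𝕜) * chartDeriv φ β f z := by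
    intro ν
    rw [Finset.sum_comm]
    simp
  simp only [e, Finset.mul_sum]
  rw [Finset.sum_comm]
  simp only [← mul_assoc, ← Finset.sum_mul, h]
  simp

lemma poisson_eq_sum_coord {f g : M → 𝕜} (hf : ContMDiffAt (𝓡 n) 𝓘(ℝ, 𝕜) ∞ f z)
    (hg : ContMDiffAt (𝓡 n) 𝓘(ℝ, 𝕜) ∞ g z) :
    ω₀.poisson f g z =
      ∑ ρ, ω₀.poisson f (fun y => (φ y ρ : 𝕜)) z * chartDeriv φ ρ g z := by
  rw [poisson_eq_sum hφ hz ω₀ hf hg, Finset.sum_comm]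
  refine Finset.sum_congr rfl fun ρ _ => ?_
  rw [poisson_eq_sum hφ hz ω₀ hf (contMDiffAt_coord hφ hz ρ)]
  simp [chartDeriv_coord hz, Finset.sum_mul]

/-- The form is closed: `∂_μ ω_{νρ} + ∂_ν ω_{ρμ} + ∂_ρ ω_{μν} = 0`. -/
lemma chartDeriv_comp_cyclic (μ ν ρ : Fin n) :
    chartDeriv φ μ (fun y => (ω₀.comp φ ν ρ y : 𝕜)) z
      + chartDeriv φ ν (fun y => (ω₀.comp φ ρ μ y : 𝕜)) z
      + chartDeriv φ ρ (fun y => (ω₀.comp φ μ ν y : 𝕜)) z = 0 := by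
  set W := formInChart ω₀.toForm φ
  have hW : DifferentiableAt ℝ W (φ z) :=
    ((ω₀.smooth φ hφ).contDiffAt (φ.open_target.mem_nhds (φ.map_source hz))).differentiableAt
      (by simp)
  have hWc : ∀ v : Fin 2 → EuclideanSpace ℝ (Fin n),
      DifferentiableAt ℝ (fun u => W u v) (φ z) := fun v =>
    (ContinuousAlternatingMap.apply ℝ (EuclideanSpace ℝ (Fin n)) ℝ v).differentiableAt.comp _ hW
  have key : ∀ α β γ, chartDeriv φ α (fun y => (ω₀.comp φ β γ y : 𝕜)) z =
      ((fderiv ℝ (fun u => W u ![stdVec n β, stdVec n γ]) (φ z) (stdVec n α) : ℝ) : 𝕜) := by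
    intro α β γ
    have e : (fun y => (ω₀.comp φ β γ y : 𝕜)) ∘ φ.symm =ᶠ[𝓝 (φ z)]
        RCLike.ofRealCLM (K := 𝕜) ∘ fun u => W u ![stdVec n β, stdVec n γ] := by
      filter_upwards [φ.open_target.mem_nhds (φ.map_source hz)] with u hu
      change ((formInChart ω₀.toForm φ (φ (φ.symm u)) _ : ℝ) : 𝕜) = (W u _ : 𝕜)
      rw [φ.right_inv hu]
    rw [chartDeriv, e.fderiv_eq, ((RCLike.ofRealCLM (K := 𝕜)).hasFDerivAt.comp _
      (hWc _).hasFDerivAt).fderiv]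
    rfl
  have h : extDeriv W (φ z) ![stdVec n μ, stdVec n ν, stdVec n ρ] = 0 := by
    rw [ω₀.closed φ hφ (φ z) (φ.map_source hz)]
    rfl
  rw [extDeriv_apply hW, Fin.sum_univ_three] at h
  have r0 : (0 : Fin 3).removeNth ![stdVec n μ, stdVec n ν, stdVec n ρ] =
      ![stdVec n ν, stdVec n ρ] := by
    funext i; fin_cases i <;> rfl
  have r1 : (1 : Fin 3).removeNth ![stdVec n μ, stdVec n ν, stdVec n ρ] =
      ![stdVec n μ, stdVec n ρ] := by
    funext i; fin_cases i <;> rfl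
  have r2 : (2 : Fin 3).removeNth ![stdVec n μ, stdVec n ν, stdVec n ρ] =
      ![stdVec n μ, stdVec n ν] := by
    funext i; fin_cases i <;> rfl
  rw [r0, r1, r2] at h
  have sw : (fun u => W u ![stdVec n ρ, stdVec n μ]) = -fun u => W u ![stdVec n μ, stdVec n ρ] :=
    funext fun u => (W u).apply_swap_two _ _
  rw [key, key, key, sw, fderiv_neg, ← RCLike.ofReal_add, ← RCLike.ofReal_add]
  refine (congrArg _ ?_).trans RCLike.ofReal_zero
  refine Eq.trans ?_ h
  simp

omit hφ hz [IsManifold (𝓡 n) ∞ M]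

lemma comp_swap (μ ν : Fin n) (y : M) : ω₀.comp φ μ ν y = -ω₀.comp φ ν μ y :=
  ContinuousAlternatingMap.apply_swap_two _ _ _

lemma poisson_swap (f g : M → 𝕜) (y : M) : ω₀.poisson f g y = -ω₀.poisson g f y := by
  have hT : (ω₀.gram y).transpose = -ω₀.gram y :=
    Matrix.ext fun a b => ContinuousAlternatingMap.apply_swap_two _ _ _
  have h : ∀ a b, (ω₀.gram y)⁻¹ a b = -(ω₀.gram y)⁻¹ b a := by
    intro a b
    by_cases hu : IsUnit (ω₀.gram y).det
    · have e : (-ω₀.gram y)⁻¹ = -(ω₀.gram y)⁻¹ :=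
        Matrix.inv_eq_right_inv (by rw [neg_mul_neg, Matrix.mul_nonsing_inv _ hu])
      rw [← hT, ← Matrix.transpose_nonsing_inv] at e
      exact congrFun (congrFun e b) a
    · simp [Matrix.nonsing_inv_apply_not_isUnit _ hu]
  rw [SymplecticForm.poisson, SymplecticForm.poisson, Finset.sum_comm, ← Finset.sum_neg_distrib]
  refine Finset.sum_congr rfl fun a _ => ?_
  rw [← Finset.sum_neg_distrib]
  refine Finset.sum_congr rfl fun b _ => ?_
  rw [h, RCLike.ofReal_neg]
  ring

end Chart

/-! ### Germs of functions in a chart -/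

section Germs

open Filter (Germ)

variable {𝕜 : Type*} [RCLike 𝕜] {n : ℕ} {M : Type*} [TopologicalSpace M]
  [ChartedSpace (EuclideanSpace ℝ (Fin n)) M] [IsManifold (𝓡 n) ∞ M]
  {φ : OpenPartialHomeomorph M (EuclideanSpace ℝ (Fin n))}
  (hφ : φ ∈ IsManifold.maximalAtlas (𝓡 n) ∞ M)

/-- The partial derivative `∂/∂x^μ` in the coordinates of a chart, on germs of functions. -/
noncomputable def germDeriv (y : chartDomain φ) (μ : Fin n) :
    Derivation ℤ (smoothGerm 𝕜 n y.1) (smoothGerm 𝕜 n y.1) :=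
  Derivation.mk' (AddMonoidHom.toIntLinearMap <| AddMonoidHom.mk'
    (fun f => ⟨Germ.map' (chartDeriv φ μ) (fun f g h => chartDeriv_congr y.2 h μ) f.1, by
      obtain ⟨_, f, hf, rfl⟩ := f
      refine ⟨chartDeriv φ μ f, ?_, rfl⟩
      filter_upwards [hf, φ.open_source.mem_nhds y.2] with z hz hzs
        using contMDiffAt_chartDeriv hφ hzs hz μ⟩)
    (by
      rintro ⟨_, f, hf, rfl⟩ ⟨_, g, hg, rfl⟩
      refine Subtype.ext (Filter.Germ.coe_eq.2 ?_)
      filter_upwards [hf, hg, φ.open_source.mem_nhds y.2] with z hfz hgz hz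
        using chartDeriv_add hφ hz hfz hgz μ))
    (by
      rintro ⟨_, f, hf, rfl⟩ ⟨_, g, hg, rfl⟩
      refine Subtype.ext (Filter.Germ.coe_eq.2 ?_)
      filter_upwards [hf, hg, φ.open_source.mem_nhds y.2] with z hfz hgz hz
        using chartDeriv_mul hφ hz hfz hgz μ)

variable (ω₀ : SymplecticForm n M)

lemma smoothGerm_sum_val {y : M} {ι : Type*} (s : Finset ι) (F : ι → smoothGerm 𝕜 n y)
    (f : ι → M → 𝕜) (h : ∀ i, (F i).1 = (f i : Germ (𝓝 y) 𝕜)) :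
    (∑ i ∈ s, F i).1 = ((fun z => ∑ i ∈ s, f i z : M → 𝕜) : Germ (𝓝 y) 𝕜) := by
  classical
  induction s using Finset.induction_on with
  | empty => simp only [Finset.sum_empty]; rfl
  | insert i s hi ih =>
    simp only [Finset.sum_insert hi]
    exact congrArg₂ (· + ·) (h i) ih

lemma germ_sum_coe {α V : Type*} [AddCommMonoid V] {l : Filter α} {ι : Type*} (s : Finset ι)
    (f : ι → α → V) :
    ∑ i ∈ s, (f i : Germ l V) = ((fun z => ∑ i ∈ s, f i z : α → V) : Germ l V) := by
  classical
  induction s using Finset.induction_on with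
  | empty => simp only [Finset.sum_empty]; rfl
  | insert i s hi ih =>
    simp only [Finset.sum_insert hi]
    exact congrArg ((f i : Germ l V) + ·) ih

variable (𝕜) in
/-- The coordinates of a chart, as symplectic coordinates on the Poisson algebra of germs. -/
noncomputable def chartCoordinates (y : chartDomain φ) :
    N2Envelope.SymplecticCoordinates (poissonGerm (𝕜 := 𝕜) ω₀ (x := y.1)) (dGerm (𝕜 := 𝕜) (n := n))
      n where
  x μ := (coordFun 𝕜 hφ μ).germ y
  w μ ν := (formFun 𝕜 ω₀ hφ μ ν).germ y
  pd μ := germDeriv hφ y μ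
  d_eq := by
    rintro ⟨_, f, hf, rfl⟩
    refine Eq.trans ?_ (germ_sum_coe Finset.univ fun μ z =>
      chartDeriv φ μ f z • dAt (n := n) (fun y => (φ y μ : 𝕜)) z).symm
    refine Filter.Germ.coe_eq.2 ?_
    filter_upwards [hf, φ.open_source.mem_nhds y.2] with z hfz hz using dAt_eq_sum hφ hz hfz
  pd_x μ ν := by
    have h : (germDeriv hφ y μ ((coordFun 𝕜 hφ ν).germ y)).1 =
        ((fun _ => if μ = ν then 1 else 0 : M → 𝕜) : Germ (𝓝 y.1) 𝕜) := by
      refine Filter.Germ.coe_eq.2 ?_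
      filter_upwards [φ.open_source.mem_nhds y.2] with z hz using chartDeriv_coord hz μ ν
    refine Subtype.ext (h.trans ?_)
    split_ifs <;> rfl
  pd_comm := by
    rintro μ ν ⟨_, f, hf, rfl⟩
    refine Subtype.ext (Filter.Germ.coe_eq.2 ?_)
    filter_upwards [hf, φ.open_source.mem_nhds y.2] with z hfz hz
      using chartDeriv_comm hφ hz hfz μ ν
  w_swap μ ν := by
    refine Subtype.ext (Filter.Germ.coe_eq.2 (.of_forall fun z => ?_))
    exact (congrArg _ (comp_swap ω₀ μ ν z)).trans (RCLike.ofReal_neg _)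
  closed μ ν ρ := by
    refine Subtype.ext (Filter.Germ.coe_eq.2 ?_)
    filter_upwards [φ.open_source.mem_nhds y.2] with z hz
      using chartDeriv_comp_cyclic hφ hz ω₀ μ ν ρ
  br_swap := by
    rintro ⟨_, f, hf, rfl⟩ ⟨_, g, hg, rfl⟩
    exact Subtype.ext (Filter.Germ.coe_eq.2 (.of_forall fun z => poisson_swap ω₀ f g z))
  br_eq := by
    rintro ⟨_, f, hf, rfl⟩ ⟨_, g, hg, rfl⟩
    refine Subtype.ext (Eq.trans ?_ (smoothGerm_sum_val Finset.univ _
      (fun ρ z => ω₀.poisson f (fun y => (φ y ρ : 𝕜)) z * chartDeriv φ ρ g z)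
      fun ρ => rfl).symm)
    refine Filter.Germ.coe_eq.2 ?_
    filter_upwards [hf, hg, φ.open_source.mem_nhds y.2] with z hfz hgz hz
      using poisson_eq_sum_coord hφ hz ω₀ hfz hgz
  hamilton := by
    rintro ⟨_, f, hf, rfl⟩ μ
    refine Subtype.ext ((smoothGerm_sum_val Finset.univ _
      (fun ν z => (ω₀.comp φ μ ν z : 𝕜) * ω₀.poisson (fun y => (φ y ν : 𝕜)) f z)
      fun ν => rfl).trans ?_)
    refine Filter.Germ.coe_eq.2 ?_
    filter_upwards [hf, φ.open_source.mem_nhds y.2] with z hfz hz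
      using sum_comp_mul_poisson hφ hz ω₀ hfz μ

end Germs

/-! ### Sections of the sheaf -/

section Sections

variable {𝕜 : Type*} [RCLike 𝕜] {n : ℕ} {M : Type*} [TopologicalSpace M]
  [ChartedSpace (EuclideanSpace ℝ (Fin n)) M] [IsManifold (𝓡 n) ∞ M] {ω₀ : SymplecticForm n M}

/-- The value in a stalk of the local expression in the coordinates of a chart. -/
lemma localG_val {φ : OpenPartialHomeomorph M (EuclideanSpace ℝ (Fin n))}
    (hφ : φ ∈ IsManifold.maximalAtlas (𝓡 n) ∞ M) (y : chartDomain φ) :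
    (localG 𝕜 ω₀ hφ).1 y = (chartCoordinates 𝕜 hφ ω₀ y).vector 𝕜 := by
  have e : ∀ (ι : Type) [Fintype ι] (F : ι → N2Sections 𝕜 ω₀ (chartDomain φ)),
      (∑ i, F i).1 y = ∑ i, (F i).1 y := by
    intro ι _ F
    rw [Submodule.coe_sum, Finset.sum_apply]
  have e' : ∀ (F : Fin 2 → N2Sections 𝕜 ω₀ (chartDomain φ)) (a : N2Sections 𝕜 ω₀ (chartDomain φ)),
      (N2Operations.nord 𝕜 a (∑ i, F i)).1 y =
        ∑ i, N2Envelope.prod (-1) (a.1 y) ((F i).1 y) := by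
    intro F a
    rw [← map_sum, ← e]
    rfl
  rw [localG, N2Envelope.SymplecticCoordinates.vector]
  refine congrArg ((2 : 𝕜)⁻¹ • ·) ((e _ _).trans (Finset.sum_congr rfl fun μ _ =>
    (e _ _).trans (Finset.sum_congr rfl fun ν _ => (e' _ _).trans ?_)))
  rfl

/-- The value of a `λ`-series of sections in a stalk. -/
lemma monomial_val {U : TopologicalSpace.Opens M} (j : ℕ) (e₁ e₂ : Bool) (v : N2Sections 𝕜 ω₀ U)
    (y : U) (j' : ℕ) (e₁' e₂' : Bool) :
    (LambdaSeries.monomial j e₁ e₂ v j' e₁' e₂').1 y =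
      LambdaSeries.monomial j e₁ e₂ (v.1 y) j' e₁' e₂' := by
  rw [LambdaSeries.monomial, LambdaSeries.monomial]
  split_ifs <;> rfl

open N2Envelope in
/-- In the associative supercommutative algebra generated by functions and the `Dᵢ g` for one `i`,
normally ordered products of three factors do not depend on their arrangement. -/
lemma nord_arrangements {A Ω : Type*} [CommRing A] [Module 𝕜 A] [AddCommGroup Ω] [Module A Ω]
    {br : A → A → A} {d : A → Ω} (f g h : A) (i : Fin 2) {a b c : N2Envelope 𝕜 br d}
    (ha : a = of f) (hb : b = D i (of g)) (hc : c = D i (of h)) :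
    prod (-1) b c = -prod (-1) c b ∧
    prod (-1) (prod (-1) a b) c = prod (-1) a (prod (-1) b c) ∧
    prod (-1) (prod (-1) b a) c = prod (-1) a (prod (-1) b c) ∧
    prod (-1) b (prod (-1) a c) = prod (-1) a (prod (-1) b c) ∧
    prod (-1) b (prod (-1) c a) = prod (-1) a (prod (-1) b c) ∧
    prod (-1) (prod (-1) b c) a = prod (-1) a (prod (-1) b c) := by
  subst ha hb hc
  have comm : ∀ g, prod (-1) (D i (of g)) (of f) =
      prod (-1) (of f) (D i (of g) : N2Envelope 𝕜 br d) := by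
    intro g
    rw [nord_comm (of_mem_homog f) (D_of_mem i g) (regular_of_D f g i)]
    simp [koszul]
  have left : prod (-1) (prod (-1) (of f) (D i (of g))) (D i (of h)) =
      prod (-1) (of f) (prod (-1) (D i (of g)) (D i (of h) : N2Envelope 𝕜 br d)) :=
    nord_assoc (of_mem_homog f) (D_of_mem i g) (D_of_mem i h) (regular_D_D g h i)
      (regular_of_D f h i)
  have mid : prod (-1) (D i (of g)) (prod (-1) (of f) (D i (of h))) =
      prod (-1) (of f) (prod (-1) (D i (of g)) (D i (of h) : N2Envelope 𝕜 br d)) := by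
    rw [← left, ← comm g, nord_assoc (D_of_mem i g) (of_mem_homog f) (D_of_mem i h)
      (regular_of_D f h i) (regular_D_D g h i)]
  refine ⟨D_nord_D_comm i g h, left, by rw [comm, left], mid, by rw [comm, mid], ?_⟩
  rw [nord_comm (of_mem_homog f) (D_nord_D_mem i g h) (regular_of_D_nord_D f g h i)]
  simp [koszul]

end Sections

theorem mainTheorem4 {𝕜 : Type*} [RCLike 𝕜] {n : ℕ} {M : Type*} [TopologicalSpace M]
    [ChartedSpace (EuclideanSpace ℝ (Fin n)) M] [IsManifold (𝓡 n) ∞ M] (ω₀ : SymplecticForm n M) :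
    -- there are no ordering ambiguities in the products `f Dᵢg Dᵢh`
    (∀ (U : Opens M) (f g h : SmoothOn 𝕜 n U) (i : Fin 2) (a b c : N2Sections 𝕜 ω₀ U),
      a = N2Sections.of f → b = N2Operations.D (𝕜 := 𝕜) i (N2Sections.of (ω₀ := ω₀) g) →
      c = N2Operations.D (𝕜 := 𝕜) i (N2Sections.of (ω₀ := ω₀) h) →
      N2Operations.nord 𝕜 b c = -N2Operations.nord 𝕜 c b ∧
      N2Operations.nord 𝕜 (N2Operations.nord 𝕜 a b) c =
        N2Operations.nord 𝕜 a (N2Operations.nord 𝕜 b c) ∧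
      N2Operations.nord 𝕜 (N2Operations.nord 𝕜 b a) c =
        N2Operations.nord 𝕜 a (N2Operations.nord 𝕜 b c) ∧
      N2Operations.nord 𝕜 b (N2Operations.nord 𝕜 a c) =
        N2Operations.nord 𝕜 a (N2Operations.nord 𝕜 b c) ∧
      N2Operations.nord 𝕜 b (N2Operations.nord 𝕜 c a) =
        N2Operations.nord 𝕜 a (N2Operations.nord 𝕜 b c) ∧
      N2Operations.nord 𝕜 (N2Operations.nord 𝕜 b c) a =
        N2Operations.nord 𝕜 a (N2Operations.nord 𝕜 b c)) ∧
    -- the local expressions define a unique global section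
    ∃ G : N2Sections 𝕜 ω₀ ⊤,
      (∀ (φ : OpenPartialHomeomorph M (EuclideanSpace ℝ (Fin n)))
        (hφ : φ ∈ IsManifold.maximalAtlas (𝓡 n) ∞ M),
        N2Sections.res le_top G = localG 𝕜 ω₀ hφ) ∧
      (∀ G' : N2Sections 𝕜 ω₀ ⊤,
        (∀ (φ : OpenPartialHomeomorph M (EuclideanSpace ℝ (Fin n)))
          (hφ : φ ∈ IsManifold.maximalAtlas (𝓡 n) ∞ M),
          N2Sections.res le_top G' = localG 𝕜 ω₀ hφ) → G' = G) ∧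
      -- the `N = 2` superconformal algebra with central charge `c = 3 dim M`
      ∀ c : 𝕜, c = 3 * (n : 𝕜) →
        lambdaBracket 𝕜 G G =
          LambdaSeries.monomial 1 false false ((2 : 𝕜) • G)
          + LambdaSeries.monomial 0 false false ((2 : 𝕜) • N2Operations.del 𝕜 G)
          + LambdaSeries.monomial 0 true false (N2Operations.D (𝕜 := 𝕜) 0 G)
          + LambdaSeries.monomial 0 false true (N2Operations.D (𝕜 := 𝕜) 1 G)
          + LambdaSeries.monomial 1 true true ((c / 3) • N2Operations.vac 𝕜) := by
  refine ⟨?_, ?_⟩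
  · rintro U f g h i a b c rfl rfl rfl
    have key := fun y : U => nord_arrangements (𝕜 := 𝕜) (br := poissonGerm (𝕜 := 𝕜) ω₀ (x := y.1))
      (d := dGerm (𝕜 := 𝕜) (n := n)) (f.germ y) (g.germ y) (h.germ y) i rfl rfl rfl
    exact ⟨Subtype.ext (funext fun y => (key y).1), Subtype.ext (funext fun y => (key y).2.1),
      Subtype.ext (funext fun y => (key y).2.2.1), Subtype.ext (funext fun y => (key y).2.2.2.1),
      Subtype.ext (funext fun y => (key y).2.2.2.2.1),
      Subtype.ext (funext fun y => (key y).2.2.2.2.2)⟩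
  have hch := fun y : M => IsManifold.chart_mem_maximalAtlas (I := 𝓡 n) (n := ∞) y
  have hsrc := fun y : M => mem_chart_source (EuclideanSpace ℝ (Fin n)) y
  -- The stalks of `G` are computed in the preferred charts; any other chart gives the same value.
  let g : ∀ y : (⊤ : Opens M), N2Stalk 𝕜 ω₀ y.1 := fun y =>
    (chartCoordinates 𝕜 (hch y.1) ω₀ ⟨y.1, hsrc y.1⟩).vector 𝕜
  have hg : ∀ (φ : OpenPartialHomeomorph M (EuclideanSpace ℝ (Fin n)))
      (hφ : φ ∈ IsManifold.maximalAtlas (𝓡 n) ∞ M) (y : chartDomain φ),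
      g ⟨y.1, trivial⟩ = (localG 𝕜 ω₀ hφ).1 y := by
    intro φ hφ y
    rw [localG_val hφ y]
    exact (chartCoordinates 𝕜 hφ ω₀ y).vector_eq
      (chartCoordinates 𝕜 (hch y.1) ω₀ ⟨y.1, hsrc y.1⟩)
  have hmem : g ∈ N2Sections 𝕜 ω₀ ⊤ := by
    intro y
    obtain ⟨V, hyV, i, t, ht⟩ := (localG 𝕜 ω₀ (hch y.1)).2 ⟨y.1, hsrc y.1⟩
    exact ⟨V, hyV, CategoryTheory.homOfLE le_top, t, fun z =>
      (hg _ (hch y.1) ⟨z.1, i.le z.2⟩).trans (ht z)⟩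
  refine ⟨⟨g, hmem⟩, fun φ hφ => Subtype.ext (funext fun y => hg φ hφ y), fun G' hG' => ?_, ?_⟩
  · refine Subtype.ext (funext fun y => ?_)
    have h := congrArg (fun s => s.1 ⟨y.1, hsrc y.1⟩) (hG' _ (hch y.1))
    exact h.trans (hg _ (hch y.1) ⟨y.1, hsrc y.1⟩).symm
  · intro c hc
    funext j e₁ e₂
    refine Subtype.ext (funext fun y => ?_)
    have h := (chartCoordinates 𝕜 (hch y.1) ω₀ ⟨y.1, hsrc y.1⟩).lambdaBracket_vector (𝕜 := 𝕜) c hc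
    replace h := congrFun (congrFun (congrFun h j) e₁) e₂
    refine h.trans ?_
    simp only [Pi.add_apply, Submodule.coe_add, monomial_val]
    rfl
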